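/- Let $p,q\ge 1$ be integers and let $B_{p+q}$ be the group of signed permutations of $\{\pm1,\dots,\pm(p+q)\}$, i.e. permutations $\sigma$ with $\sigma(-i)=-\sigma(i)$ for all $i$. Write $[a_1\,\dots\,a_k]=(a_1\,\dots\,a_k\,{-a_1}\,\dots\,{-a_k})$ (a zero cycle) and $((a_1\,\dots\,a_k))=(a_1\,\dots\,a_k)({-a_1}\,\dots\,{-a_k})$ (a paired nonzero cycle). The type $B$ transpositions are the elements $[i]$ and $((i\,j))$ with $i\ne\pm j$; the absolute length $\ell(\pi)$ is the least $k$ such that $\pi$ is a product of $k$ type $B$ transpositions, and the absolute order is defined by $\pi\le\sigma\iff\ell(\sigma)=\ell(\pi)+\ell(\pi^{-1}\sigma)$. Let $\gamma_{p,q}=[1\,\dots\,p][p+1\,\dots\,p+q]$ and let $\mathcal S^B_{\mathrm{nc}}(p,q)=[\epsilon,\gamma_{p,q}]$ be the interval between the identity $\epsilon$ and $\gamma_{p,q}$ in the absolute order. A paired nonzero cycle $((a_1\,\dots\,a_k))$ is connected if $\{a_1,\dots,a_k\}$ meets both $\{\pm1,\dots,\pm p\}$ and $\{\pm(p+1),\dots,\pm(p+q)\}$.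 The connectivity of $\sigma$ is the number of its connected paired nonzero cycles, and a maximal chain of $\mathcal S^B_{\mathrm{nc}}(p,q)$ is connected if at least one of its elements has nonzero connectivity. Then the number of connected maximal chains of $\mathcal S^B_{\mathrm{nc}}(p,q)$ is equal to $$\frac{2pq}{p+q}\binom{p+q}{q}p^pq^q.$$ Equivalently, let $D_{p+q}$ be the Weyl group of those $\sigma\in B_{p+q}$ that send an even number of positive integers to negative ones, whose reflections are the type $B$ transpositions lying in $D_{p+q}$. The number of minimal factorizations of $\gamma_{p,q}$ in $D_{p+q}$, i.e. of tuples $(\tau_1,\dots,\tau_k)$ of reflections of $D_{p+q}$ with $\tau_1\cdots\tau_k=\gamma_{p,q}$ and $k$ as small as possible, is also equal to $$\frac{2pq}{p+q}\binom{p+q}{q}p^pq^q.$$ -/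

import Mathlib

namespace AnnularB

/-! ### Signed permutations -/

/-- The set `{±1, …, ±n}`, as a type. -/
abbrev SignedSet (n : ℕ) : Type := {x : ℤ // x ∈ (Finset.Icc (-(n : ℤ)) (n : ℤ)).erase 0}

namespace SignedSet

instance (n : ℕ) : InvolutiveNeg (SignedSet n) where
  neg x := ⟨-x.1, by
    have h := x.2
    simp only [Finset.mem_erase, Finset.mem_Icc] at h ⊢
    omega⟩
  neg_neg x := Subtype.ext (neg_neg x.1)

@[simp] theorem coe_neg {n : ℕ} (x : SignedSet n) : ((-x : SignedSet n) : ℤ) = -(x : ℤ) := rfl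

theorem coe_ne_zero {n : ℕ} (x : SignedSet n) : (x : ℤ) ≠ 0 :=
  (Finset.mem_erase.mp x.2).1

theorem ne_neg {n : ℕ} (x : SignedSet n) : x ≠ -x := fun h => by
  have h1 := congrArg (Subtype.val) h
  have h2 := coe_ne_zero x
  rw [coe_neg] at h1
  omega

end SignedSet

/-- The group `B_n` of signed permutations, inside the permutations of `{±1, …, ±n}`. -/
def signedPermSubgroup (n : ℕ) : Subgroup (Equiv.Perm (SignedSet n)) where
  carrier := {σ | ∀ x, σ (-x) = -σ x}
  mul_mem' {σ τ} hσ hτ x := by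
    simp only [Equiv.Perm.mul_apply]
    rw [hτ x, hσ]
  one_mem' _ := rfl
  inv_mem' {σ} hσ x := by
    rw [Equiv.Perm.inv_eq_iff_eq, hσ]; simp

/-- The group `B_n` of signed permutations of `{±1, …, ±n}`. -/
abbrev SignedPerm (n : ℕ) : Type := signedPermSubgroup n

theorem SignedPerm.apply_neg {n : ℕ} (σ : SignedPerm n) (x : SignedSet n) :
    σ.1 (-x) = -σ.1 x := σ.2 x

/-! ### Cycles -/

/-- The zero cycle `[a₁ a₂ … a_k] = (a₁ a₂ … a_k -a₁ -a₂ … -a_k)`. -/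
def zeroCycle {n : ℕ} (l : List (SignedSet n)) : Equiv.Perm (SignedSet n) :=
  (l ++ l.map (fun x => -x)).formPerm

/-- The paired nonzero cycle `((a₁ a₂ … a_k)) = (a₁ a₂ … a_k)(-a₁ -a₂ … -a_k)`. -/
def pairedCycle {n : ℕ} (l : List (SignedSet n)) : Equiv.Perm (SignedSet n) :=
  l.formPerm * (l.map (fun x => -x)).formPerm

/-- The type `B` transpositions: `ε_i = [i]`, and `((i j))` with `i ≠ ±j`. -/
def transpositions (n : ℕ) : Set (SignedPerm n) :=
  {τ | (∃ i, (τ : Equiv.Perm (SignedSet n)) = zeroCycle [i]) ∨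
    ∃ i j, i ≠ j ∧ i ≠ -j ∧ (τ : Equiv.Perm (SignedSet n)) = pairedCycle [i, j]}

theorem zeroCycle_singleton {n : ℕ} (i : SignedSet n) : zeroCycle [i] = Equiv.swap i (-i) := by
  simp [zeroCycle]

theorem pairedCycle_pair {n : ℕ} (i j : SignedSet n) :
    pairedCycle [i, j] = Equiv.swap i j * Equiv.swap (-i) (-j) := by
  simp [pairedCycle]

theorem zeroCycle_mem {n : ℕ} {l : List (SignedSet n)}
    (hl : (l ++ l.map (fun x => -x)).Nodup) : zeroCycle l ∈ signedPermSubgroup n := by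
  intro x
  have hinj : Function.Injective (fun x : SignedSet n => -x) := neg_injective
  have key : ((l ++ l.map (fun x => -x)).map (fun x => -x)).formPerm = zeroCycle l := by
    refine List.formPerm_eq_of_isRotated (hl.map hinj) ?_
    have : (l ++ l.map (fun x => -x)).map (fun x => -x) = l.map (fun x => -x) ++ l := by
      simp
    rw [this]
    exact List.isRotated_append
  by_cases hx : x ∈ l ++ l.map (fun x => -x)
  · obtain ⟨k, hk, rfl⟩ := List.getElem_of_mem hx
    rw [← key]
    have h1 := List.formPerm_apply_getElem _ (hl.map hinj) k (by simpa using hk)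
    have h2 := List.formPerm_apply_getElem _ hl k hk
    rw [key]
    rw [key] at h1
    simp only [List.getElem_map, List.length_map] at h1
    rw [h1, zeroCycle, h2]
  · have hx' : -x ∉ l ++ l.map (fun x => -x) := by
      simp only [List.mem_append, List.mem_map, not_or, not_exists, not_and] at hx ⊢
      refine ⟨fun h => hx.2 _ h (neg_neg x), fun y hy h => hx.1 ?_⟩
      rwa [← neg_injective h]
    rw [zeroCycle, List.formPerm_apply_of_notMem hx, List.formPerm_apply_of_notMem hx']

theorem pairedSwap_neg {α : Type*} [DecidableEq α] [InvolutiveNeg α] (hα : ∀ a : α, a ≠ -a)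
    (i j x : α) (h : i ≠ -j) :
    (Equiv.swap i j * Equiv.swap (-i) (-j)) (-x) =
      -(Equiv.swap i j * Equiv.swap (-i) (-j)) x := by
  have h1 := hα i
  have h2 := hα j
  have h3 : ∀ a b : α, -a = -b ↔ a = b := fun _ _ => neg_inj
  have h4 : ∀ a b : α, -a = b ↔ a = -b := fun _ _ => neg_eq_iff_eq_neg
  have h5 : ∀ a : α, - -a = a := neg_neg
  simp only [Equiv.Perm.mul_apply, Equiv.swap_apply_def]
  grind

theorem pairedSwap_sq {α : Type*} [DecidableEq α] [InvolutiveNeg α] (hα : ∀ a : α, a ≠ -a)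
    (i j x : α) (h : i ≠ -j) :
    (Equiv.swap i j * Equiv.swap (-i) (-j) * (Equiv.swap i j * Equiv.swap (-i) (-j))) x = x := by
  have h1 := hα i
  have h2 := hα j
  have h3 : ∀ a b : α, -a = -b ↔ a = b := fun _ _ => neg_inj
  have h4 : ∀ a b : α, -a = b ↔ a = -b := fun _ _ => neg_eq_iff_eq_neg
  simp only [Equiv.Perm.mul_apply, Equiv.swap_apply_def]
  grind

theorem pairedSwap_mem {n : ℕ} (i j : SignedSet n) (h : i ≠ -j) :
    pairedCycle [i, j] ∈ signedPermSubgroup n := by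
  intro x
  rw [pairedCycle_pair]
  exact pairedSwap_neg SignedSet.ne_neg i j x h

/-! ### Word length and minimal factorizations -/

section Word

variable {G : Type*} [Group G]

/-- The factorizations of `g` into a product of elements of `T`. -/
def factorizations (T : Set G) (g : G) : Set (List G) :=
  {l | (∀ τ ∈ l, τ ∈ T) ∧ l.prod = g}

/-- The smallest integer `k` such that `g` can be written as a product of `k` elements of `T`. -/
noncomputable def wordLength (T : Set G) (g : G) : ℕ :=
  sInf {k | ∃ l ∈ factorizations T g, l.length = k}

/-- The factorizations of `g` into the least possible number of elements of `T`. -/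
def minimalFactorizations (T : Set G) (g : G) : Set (List G) :=
  {l | l ∈ factorizations T g ∧ l.length = wordLength T g}

theorem wordLength_one (T : Set G) : wordLength T 1 = 0 :=
  Nat.sInf_eq_zero.mpr (Or.inl ⟨[], by simp [factorizations], rfl⟩)

theorem exists_of_wordLength {T : Set G} (hT : ∀ g : G, (factorizations T g).Nonempty) (g : G) :
    ∃ l ∈ factorizations T g, l.length = wordLength T g :=
  Nat.sInf_mem (s := {k | ∃ l ∈ factorizations T g, l.length = k})
    (let ⟨l, hl⟩ := hT g; ⟨l.length, l, hl, rfl⟩)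

theorem wordLength_mul_le {T : Set G} (hT : ∀ g : G, (factorizations T g).Nonempty) (g h : G) :
    wordLength T (g * h) ≤ wordLength T g + wordLength T h := by
  obtain ⟨l, hl, hl'⟩ := exists_of_wordLength hT g
  obtain ⟨m, hm, hm'⟩ := exists_of_wordLength hT h
  refine Nat.sInf_le ⟨l ++ m, ⟨?_, ?_⟩, by simp [hl', hm']⟩
  · intro τ hτ
    rcases List.mem_append.mp hτ with h1 | h1
    · exact hl.1 τ h1
    · exact hm.1 τ h1
  · rw [List.prod_append, hl.2, hm.2]

theorem eq_one_of_wordLength {T : Set G} (hT : ∀ g : G, (factorizations T g).Nonempty) {g : G}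
    (hg : wordLength T g = 0) : g = 1 := by
  obtain ⟨l, hl, hl'⟩ := exists_of_wordLength hT g
  rw [hg, List.length_eq_zero_iff] at hl'
  rw [← hl.2, hl', List.prod_nil]

end Word

/-- Every signed permutation is a product of type `B` transpositions. -/
theorem factorizations_nonempty {n : ℕ} (σ : SignedPerm n) :
    (factorizations (transpositions n) σ).Nonempty := by
  suffices H : ∀ (k : ℕ) (σ : SignedPerm n),
      (Finset.univ.filter fun x => σ.1 x ≠ x).card = k →
        (factorizations (transpositions n) σ).Nonempty from H _ σ rfl
  intro k
  induction k using Nat.strong_induction_on with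
  | _ k ih =>
    intro σ hk
    by_cases hσ : ∀ x, σ.1 x = x
    · refine ⟨[], by simp, ?_⟩
      rw [List.prod_nil]
      exact Subtype.ext (Equiv.ext fun x => (hσ x).symm)
    · push Not at hσ
      obtain ⟨i, hi⟩ := hσ
      obtain ⟨τ, hτ, hτi, hτx⟩ : ∃ τ ∈ transpositions n, τ.1 * τ.1 = 1 ∧
          τ.1 (σ.1 i) = i ∧ ∀ x, σ.1 x = x → τ.1 x = x := by
        by_cases hj : σ.1 i = -i
        · refine ⟨⟨zeroCycle [i], zeroCycle_mem ?_⟩, Or.inl ⟨i, rfl⟩, ?_, ?_, ?_⟩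
          · simpa using SignedSet.ne_neg i
          · simp [zeroCycle_singleton]
          · simp [zeroCycle_singleton, hj]
          · intro x hx
            simp only [zeroCycle_singleton]
            refine Equiv.swap_apply_of_ne_of_ne ?_ ?_
            · rintro rfl; exact hi hx
            · rintro rfl
              rw [SignedPerm.apply_neg, neg_inj] at hx
              exact hi hx
        · have hj' : i ≠ -σ.1 i := fun h => hj (by rw [h, neg_neg, ← h])
          have hni : -i ≠ σ.1 i := fun h => hj h.symm
          refine ⟨⟨pairedCycle [i, σ.1 i], pairedSwap_mem _ _ hj'⟩,
            Or.inr ⟨i, σ.1 i, Ne.symm hi, hj', rfl⟩, ?_, ?_, ?_⟩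
          · simp only [pairedCycle_pair]
            exact Equiv.ext fun x => pairedSwap_sq SignedSet.ne_neg i (σ.1 i) x hj'
          · simp only [pairedCycle_pair, Equiv.Perm.mul_apply]
            rw [Equiv.swap_apply_of_ne_of_ne hni.symm (SignedSet.ne_neg _),
              Equiv.swap_apply_right]
          · intro x hx
            have e1 : x ≠ i := fun h => hi (h ▸ hx)
            have e2 : x ≠ -i := fun h => by
              rw [h, SignedPerm.apply_neg, neg_inj] at hx
              exact hi hx
            have e3 : x ≠ σ.1 i := fun h => e1 (σ.1.injective (hx.trans h))
            have e4 : x ≠ -σ.1 i := fun h => e2 (σ.1.injective (by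
              rw [hx, SignedPerm.apply_neg, ← h]))
            simp only [pairedCycle_pair, Equiv.Perm.mul_apply]
            rw [Equiv.swap_apply_of_ne_of_ne e2 e4, Equiv.swap_apply_of_ne_of_ne e1 e3]
      have hlt : (Finset.univ.filter fun x => (τ * σ).1 x ≠ x).card < k := by
        rw [← hk]
        refine Finset.card_lt_card ⟨fun x => ?_, fun h => ?_⟩
        · simp only [Finset.mem_filter, Finset.mem_univ, true_and]
          intro hx hx'
          exact hx (by simp [hx', hτx.2 x hx'])
        · have h1 := (Finset.mem_filter.mp (h (Finset.mem_filter.mpr ⟨Finset.mem_univ i, hi⟩))).2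
          exact h1 hτx.1
      obtain ⟨l, hl⟩ := ih _ hlt (τ * σ) rfl
      refine ⟨τ :: l, ?_, ?_⟩
      · intro x hx
        rcases List.mem_cons.mp hx with rfl | hx
        · exact hτ
        · exact hl.1 x hx
      · rw [List.prod_cons, hl.2, ← mul_assoc]
        have : τ * τ = 1 := Subtype.ext hτi
        rw [this, one_mul]

/-! ### The absolute order -/

/-- The absolute length on `B_n`. -/
noncomputable def absLength {n : ℕ} (σ : SignedPerm n) : ℕ := wordLength (transpositions n) σ

/-- The absolute order on `B_n`: `π ≤ σ` iff `ℓ(σ) = ℓ(π) + ℓ(π⁻¹σ)`. -/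
instance absoluteOrder (n : ℕ) : PartialOrder (SignedPerm n) where
  le π σ := absLength σ = absLength π + absLength (π⁻¹ * σ)
  le_refl π := by
    rw [inv_mul_cancel]
    exact (Nat.add_eq_left.mpr (wordLength_one _)).symm
  le_trans π σ ρ h1 h2 := by
    have h3 : absLength (π⁻¹ * ρ) ≤ absLength (π⁻¹ * σ) + absLength (σ⁻¹ * ρ) := by
      have := wordLength_mul_le factorizations_nonempty (π⁻¹ * σ) (σ⁻¹ * ρ)
      rwa [mul_assoc, mul_inv_cancel_left] at this
    have h4 : absLength ρ ≤ absLength π + absLength (π⁻¹ * ρ) := by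
      have := wordLength_mul_le factorizations_nonempty π (π⁻¹ * ρ)
      rwa [mul_inv_cancel_left] at this
    omega
  le_antisymm π σ h1 h2 := by
    have h3 : absLength (π⁻¹ * σ) = 0 := by omega
    exact inv_mul_eq_one.mp (eq_one_of_wordLength factorizations_nonempty h3)

theorem absoluteOrder_le_iff {n : ℕ} (π σ : SignedPerm n) :
    π ≤ σ ↔ absLength σ = absLength π + absLength (π⁻¹ * σ) := Iff.rfl

/-! ### Annular noncrossing permutations of type `B` -/

section Annular

variable (p q : ℕ)

/-- The list `1, 2, …, p` in `{±1, …, ±(p+q)}`. -/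
def outerList : List (SignedSet (p + q)) :=
  List.ofFn fun i : Fin p => ⟨(i : ℤ) + 1, by
    have := i.2
    simp only [Finset.mem_erase, Finset.mem_Icc]
    omega⟩

/-- The list `p+1, p+2, …, p+q` in `{±1, …, ±(p+q)}`. -/
def innerList : List (SignedSet (p + q)) :=
  List.ofFn fun j : Fin q => ⟨(p : ℤ) + (j : ℤ) + 1, by
    have := j.2
    simp only [Finset.mem_erase, Finset.mem_Icc]
    omega⟩

theorem nodup_append_neg {n : ℕ} {l : List (SignedSet n)} (hl : l.Nodup)
    (hpos : ∀ x ∈ l, 0 < (x : ℤ)) : (l ++ l.map (fun x => -x)).Nodup := by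
  refine List.Nodup.append hl (hl.map neg_injective) ?_
  intro x hx hx'
  obtain ⟨y, hy, rfl⟩ := List.mem_map.mp hx'
  have h1 := hpos _ hx
  have h2 := hpos _ hy
  rw [SignedSet.coe_neg] at h1
  omega

theorem outerList_nodup : (outerList p q ++ (outerList p q).map (fun x => -x)).Nodup := by
  refine nodup_append_neg (List.nodup_ofFn.mpr fun i j h => ?_) fun x hx => ?_
  · have := congrArg Subtype.val h
    simp only at this
    exact Fin.ext (by omega)
  · obtain ⟨i, rfl⟩ := (List.mem_ofFn' _ _).mp hx
    simp only
    omega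

theorem innerList_nodup : (innerList p q ++ (innerList p q).map (fun x => -x)).Nodup := by
  refine nodup_append_neg (List.nodup_ofFn.mpr fun i j h => ?_) fun x hx => ?_
  · have := congrArg Subtype.val h
    simp only at this
    exact Fin.ext (by omega)
  · obtain ⟨i, rfl⟩ := (List.mem_ofFn' _ _).mp hx
    simp only
    omega

/-- The signed permutation `γ_{p,q} = [1 … p][p+1 … p+q]`. -/
def gamma : SignedPerm (p + q) :=
  ⟨zeroCycle (outerList p q) * zeroCycle (innerList p q),
    mul_mem (zeroCycle_mem (outerList_nodup p q)) (zeroCycle_mem (innerList_nodup p q))⟩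

/-- The poset `S^B_nc(p,q) = [ε, γ_{p,q}]` of annular noncrossing permutations of type `B`. -/
abbrev AnnularNC : Type := Set.Icc (1 : SignedPerm (p + q)) (gamma p q)

variable {p q}

/-- The connected paired nonzero cycles `((a₁ … a_k))` of `σ`, each recorded by the set
`{±a₁, …, ±a_k}`: the cycle through `a` is nonzero when it does not contain `-a`, and the paired
cycle is connected when it meets both `{±1, …, ±p}` and `{±(p+1), …, ±(p+q)}`. -/
def connectedCycles (σ : SignedPerm (p + q)) : Set (Set (SignedSet (p + q))) :=
  {S | ∃ a, ¬ σ.1.SameCycle a (-a) ∧ S = {b | σ.1.SameCycle a b ∨ σ.1.SameCycle a (-b)} ∧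
    (∃ b ∈ S, |(b : ℤ)| ≤ p) ∧ (∃ b ∈ S, (p : ℤ) < |(b : ℤ)|)}

/-- The connectivity of `σ`: the number of its connected paired nonzero cycles. -/
noncomputable def connectivity (σ : SignedPerm (p + q)) : ℕ := (connectedCycles σ).ncard

/-- A maximal chain of `S^B_nc(p,q)` is connected unless all its elements have connectivity `0`. -/
def IsConnectedChain (C : Flag (AnnularNC p q)) : Prop :=
  ¬ ∀ π ∈ C, connectivity (π : SignedPerm (p + q)) = 0

end Annular

/-! ### The Weyl group `D_n` -/

/-- The positive elements of `{±1, …, ±n}`. -/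
noncomputable def positives (n : ℕ) : Finset (SignedSet n) := Finset.univ.filter fun x => 0 < (x : ℤ)

/-- The positive integers that `σ` sends to negative integers. -/
noncomputable def negatedSet {n : ℕ} (σ : SignedPerm n) : Finset (SignedSet n) :=
  (positives n).filter fun x => (σ.1 x : ℤ) < 0

theorem prod_sign_eq {n : ℕ} (σ : SignedPerm n) :
    ∏ x ∈ positives n, (σ.1 x : ℤ).sign = (-1) ^ (negatedSet σ).card := by
  have : ∀ x ∈ positives n, (σ.1 x : ℤ).sign = if (σ.1 x : ℤ) < 0 then -1 else 1 := by
    intro x _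
    have := SignedSet.coe_ne_zero (σ.1 x)
    split_ifs with h
    · exact Int.sign_eq_neg_one_of_neg h
    · exact Int.sign_eq_one_of_pos (by omega)
  rw [Finset.prod_congr rfl this, Finset.prod_ite]
  simp [negatedSet]

theorem prod_sign_mul {n : ℕ} (σ τ : SignedPerm n) :
    ∏ x ∈ positives n, ((σ * τ).1 x : ℤ).sign =
      (∏ x ∈ positives n, (σ.1 x : ℤ).sign) * ∏ x ∈ positives n, (τ.1 x : ℤ).sign := by
  let f : SignedSet n → SignedSet n := fun x => if 0 < (τ.1 x : ℤ) then τ.1 x else -τ.1 x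
  have hf : ∀ x ∈ positives n, f x ∈ positives n := by
    intro x _
    have := SignedSet.coe_ne_zero (τ.1 x)
    simp only [f, positives, Finset.mem_filter, Finset.mem_univ, true_and]
    split_ifs with h
    · exact h
    · rw [SignedSet.coe_neg]; omega
  have hinj : Set.InjOn f (positives n) := by
    intro x hx y hy hxy
    have hx : 0 < (x : ℤ) := (Finset.mem_filter.mp hx).2
    have hy : 0 < (y : ℤ) := (Finset.mem_filter.mp hy).2
    have h : τ.1 x = τ.1 y ∨ τ.1 x = τ.1 (-y) := by
      rw [SignedPerm.apply_neg]
      simp only [f] at hxy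
      split_ifs at hxy
      · exact Or.inl hxy
      · exact Or.inr hxy
      · exact Or.inr (neg_eq_iff_eq_neg.mp hxy)
      · exact Or.inl (neg_injective hxy)
    rcases h with h | h
    · exact τ.1.injective h
    · have := congrArg Subtype.val (τ.1.injective h)
      rw [SignedSet.coe_neg] at this
      omega
  have hre : ∏ x ∈ positives n, (σ.1 x : ℤ).sign = ∏ x ∈ positives n, (σ.1 (f x) : ℤ).sign :=
    (Finset.prod_nbij f hf hinj (Finset.surjOn_of_injOn_of_card_le f hf hinj le_rfl)
      fun _ _ => rfl).symm
  rw [hre, ← Finset.prod_mul_distrib]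
  refine Finset.prod_congr rfl fun x _ => ?_
  have h0 := SignedSet.coe_ne_zero (τ.1 x)
  have h1 : (σ * τ).1 x = σ.1 (τ.1 x) := rfl
  simp only [f, h1]
  split_ifs with h
  · rw [Int.sign_eq_one_of_pos h, mul_one]
  · have h2 : (τ.1 x : ℤ) < 0 := by omega
    rw [Int.sign_eq_neg_one_of_neg h2, SignedPerm.apply_neg, SignedSet.coe_neg, Int.sign_neg]
    ring

theorem even_card_negatedSet_iff {n : ℕ} (σ : SignedPerm n) :
    Even (negatedSet σ).card ↔ ∏ x ∈ positives n, (σ.1 x : ℤ).sign = 1 := by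
  rw [prod_sign_eq, neg_one_pow_eq_one_iff_even (by norm_num)]

theorem prod_sign_one (n : ℕ) :
    ∏ x ∈ positives n, ((1 : SignedPerm n).1 x : ℤ).sign = 1 :=
  Finset.prod_eq_one fun _ hx => Int.sign_eq_one_of_pos (Finset.mem_filter.mp hx).2

/-- The Weyl group `D_n`: the signed permutations that send an even number of positive integers
to negative integers. -/
def weylD (n : ℕ) : Subgroup (SignedPerm n) where
  carrier := {σ | Even (negatedSet σ).card}
  mul_mem' {σ τ} hσ hτ := by
    simp only [Set.mem_ofPred_eq, even_card_negatedSet_iff] at *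
    rw [prod_sign_mul, hσ, hτ, one_mul]
  one_mem' := by
    simp only [Set.mem_ofPred_eq, even_card_negatedSet_iff]
    exact prod_sign_one n
  inv_mem' {σ} hσ := by
    simp only [Set.mem_ofPred_eq, even_card_negatedSet_iff] at *
    have h := prod_sign_mul σ σ⁻¹
    rw [mul_inv_cancel, prod_sign_one, hσ, one_mul] at h
    exact h.symm

/-- The reflections of `D_n`: the type `B` transpositions that lie in `D_n`. -/
def reflectionsD (n : ℕ) : Set (SignedPerm n) := {τ | τ ∈ transpositions n ∧ τ ∈ weylD n}

end AnnularB

namespace AnnularB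

/-! ### Orbits of a permutation multiplied by a transposition -/

section Orbits

open Equiv Equiv.Perm Function

variable {α : Type*} [Fintype α] [DecidableEq α]

/-- The orbit of `x` under `σ`. -/
def orb (σ : Perm α) (x : α) : Finset α := Finset.univ.filter fun y => σ.SameCycle x y

/-- The set of orbits of `σ`. -/
def orbs (σ : Perm α) : Finset (Finset α) := Finset.univ.image (orb σ)

theorem mem_orb {σ : Perm α} {x y : α} : y ∈ orb σ x ↔ σ.SameCycle x y := by simp [orb]

theorem mem_orb_self (σ : Perm α) (x : α) : x ∈ orb σ x := mem_orb.mpr (SameCycle.refl σ x)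

theorem orb_mem_orbs (σ : Perm α) (x : α) : orb σ x ∈ orbs σ :=
  Finset.mem_image_of_mem _ (Finset.mem_univ x)

theorem orb_eq_iff {σ : Perm α} {x y : α} : orb σ x = orb σ y ↔ σ.SameCycle x y := by
  constructor
  · intro h
    exact mem_orb.mp (h ▸ mem_orb_self σ y)
  · intro h
    ext z
    rw [mem_orb, mem_orb]
    exact ⟨fun h' => h.symm.trans h', fun h' => h.trans h'⟩

theorem orb_eq_of_mem {σ : Perm α} {x y : α} (h : y ∈ orb σ x) : orb σ y = orb σ x :=
  (orb_eq_iff.mpr (mem_orb.mp h)).symm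

theorem card_orb_pos (σ : Perm α) (x : α) : 0 < (orb σ x).card :=
  Finset.card_pos.mpr ⟨x, mem_orb_self σ x⟩

theorem mem_orb_iff_pow {σ : Perm α} {x y : α} : y ∈ orb σ x ↔ ∃ k : ℕ, (σ ^ k) x = y := by
  rw [mem_orb]
  exact ⟨fun h => h.exists_nat_pow_eq, fun ⟨k, hk⟩ => ⟨k, by simpa using hk⟩⟩

theorem pow_mem_orb (σ : Perm α) (x : α) (k : ℕ) : (σ ^ k) x ∈ orb σ x :=
  mem_orb_iff_pow.mpr ⟨k, rfl⟩

omit [DecidableEq α] in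
theorem exists_period (σ : Perm α) (x : α) :
    0 < minimalPeriod σ x ∧ (σ ^ minimalPeriod σ x) x = x := by
  refine ⟨minimalPeriod_pos_of_mem_periodicPts ⟨orderOf σ, orderOf_pos σ, ?_⟩, ?_⟩
  · rw [IsPeriodicPt, IsFixedPt, Perm.iterate_eq_pow, pow_orderOf_eq_one, one_apply]
  · rw [← Perm.iterate_eq_pow, iterate_minimalPeriod]

theorem orb_eq_image_of_period {σ : Perm α} {x : α} {m : ℕ} (hm : 0 < m) (h : (σ ^ m) x = x) :
    orb σ x = (Finset.Icc 1 m).image fun k => (σ ^ k) x := by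
  ext y
  rw [mem_orb_iff_pow, Finset.mem_image]
  constructor
  · rintro ⟨k, rfl⟩
    have hp : IsPeriodicPt σ m x := by
      rwa [IsPeriodicPt, IsFixedPt, Perm.iterate_eq_pow]
    have h2 : (σ ^ (k % m)) x = (σ ^ k) x := by
      have := hp.iterate_mod_apply k
      rwa [Perm.iterate_eq_pow, Perm.iterate_eq_pow] at this
    rcases Nat.eq_zero_or_pos (k % m) with h0 | h0
    · refine ⟨m, Finset.mem_Icc.mpr ⟨hm, le_rfl⟩, ?_⟩
      rw [h, ← h2, h0, pow_zero, one_apply]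
    · exact ⟨k % m, Finset.mem_Icc.mpr ⟨h0, (Nat.mod_lt k hm).le⟩, h2⟩
  · rintro ⟨k, _, rfl⟩
    exact ⟨k, rfl⟩

omit [Fintype α] [DecidableEq α] in
theorem pow_injOn_range (σ : Perm α) (x : α) :
    Set.InjOn (fun k => (σ ^ k) x) (Set.Iio (minimalPeriod σ x)) := by
  have := iterate_injOn_Iio_minimalPeriod (f := σ) (x := x)
  simpa only [Perm.iterate_eq_pow] using this

theorem pow_injOn_Icc (σ : Perm α) (x : α) :
    Set.InjOn (fun k => (σ ^ k) x) (Set.Icc 1 (minimalPeriod σ x)) := by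
  intro k hk l hl h
  have h2 : (σ ^ (k - 1)) x = (σ ^ (l - 1)) x := by
    refine σ.injective ?_
    rw [← Perm.mul_apply, ← Perm.mul_apply, ← pow_succ', ← pow_succ', Nat.sub_add_cancel hk.1,
      Nat.sub_add_cancel hl.1]
    exact h
  have hk2 := hk.2
  have hl2 := hl.2
  have hk1 := hk.1
  have hl1 := hl.1
  have := pow_injOn_range σ x (Set.mem_Iio.mpr (by omega)) (Set.mem_Iio.mpr (by omega)) h2
  omega

theorem card_orb (σ : Perm α) (x : α) : (orb σ x).card = minimalPeriod σ x := by
  rw [orb_eq_image_of_period (exists_period σ x).1 (exists_period σ x).2,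
    Finset.card_image_of_injOn, Nat.card_Icc, Nat.add_sub_cancel]
  rw [Finset.coe_Icc]
  exact pow_injOn_Icc σ x

omit [Fintype α] in
theorem mul_swap_pow_apply {σ : Perm α} {i j : α} {m : ℕ} (hm : 0 < m)
    (h : ∀ k, 0 < k → k < m → (σ ^ k) i ≠ i ∧ (σ ^ k) i ≠ j) :
    ((σ * swap i j) ^ m) j = (σ ^ m) i := by
  induction m with
  | zero => omega
  | succ m ih =>
    rcases Nat.eq_zero_or_pos m with rfl | h0
    · simp
    · rw [pow_succ', Perm.mul_apply, ih h0 fun k h1 h2 => h k h1 (by omega), Perm.mul_apply,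
        swap_apply_of_ne_of_ne (h m h0 (by omega)).1 (h m h0 (by omega)).2, pow_succ',
        Perm.mul_apply]

theorem pow_ne_of_lt_period {σ : Perm α} {i : α} {a k : ℕ} (ha : a < minimalPeriod σ i)
    (hk : k < minimalPeriod σ i) (h : k ≠ a) : (σ ^ k) i ≠ (σ ^ a) i :=
  fun h' => h (pow_injOn_range σ i hk ha h')

/-- If `j = σᵃ i` then `σ * swap i j` has the cycle `(σ i, …, σᵃ i)`. -/
theorem orb_mul_swap_pow {σ : Perm α} {i : α} {a : ℕ} (ha : 0 < a) (ha' : a < minimalPeriod σ i) :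
    orb (σ * swap i ((σ ^ a) i)) ((σ ^ a) i) = (Finset.Icc 1 a).image fun k => (σ ^ k) i := by
  have hpow : ∀ m, 0 < m → m ≤ a →
      ((σ * swap i ((σ ^ a) i)) ^ m) ((σ ^ a) i) = (σ ^ m) i := by
    intro m hm hma
    refine mul_swap_pow_apply hm fun k hk hkm => ⟨?_, ?_⟩
    · have := pow_ne_of_lt_period (σ := σ) (i := i) (a := 0) (k := k) (by omega) (by omega)
        (by omega)
      simpa using this
    · exact pow_ne_of_lt_period ha' (by omega) (by omega)
  rw [orb_eq_image_of_period ha (hpow a ha le_rfl)]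
  refine Finset.image_congr fun k hk => ?_
  rw [Finset.coe_Icc] at hk
  exact hpow k hk.1 hk.2

theorem card_orb_mul_swap_pow {σ : Perm α} {i : α} {a : ℕ} (ha : 0 < a)
    (ha' : a < minimalPeriod σ i) : (orb (σ * swap i ((σ ^ a) i)) ((σ ^ a) i)).card = a := by
  rw [orb_mul_swap_pow ha ha', Finset.card_image_of_injOn, Nat.card_Icc, Nat.add_sub_cancel]
  rw [Finset.coe_Icc]
  exact (pow_injOn_Icc σ i).mono (Set.Icc_subset_Icc_right ha'.le)

theorem exists_pow_of_sameCycle {σ : Perm α} {i j : α} (hij : i ≠ j) (h : σ.SameCycle i j) :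
    ∃ a, 0 < a ∧ a < minimalPeriod σ i ∧ (σ ^ a) i = j := by
  have h1 := mem_orb.mpr h
  rw [orb_eq_image_of_period (exists_period σ i).1 (exists_period σ i).2] at h1
  obtain ⟨a, ha, rfl⟩ := Finset.mem_image.mp h1
  have ha := Finset.mem_Icc.mp ha
  refine ⟨a, ha.1, lt_of_le_of_ne ha.2 ?_, rfl⟩
  rintro rfl
  exact hij (exists_period σ i).2.symm

theorem minimalPeriod_eq_of_sameCycle {σ : Perm α} {i j : α} (h : σ.SameCycle i j) :
    minimalPeriod σ i = minimalPeriod σ j := by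
  rw [← card_orb, ← card_orb, orb_eq_iff.mpr h]

variable {σ : Perm α} {i j : α}

theorem not_sameCycle_mul_swap (hij : i ≠ j) (h : σ.SameCycle i j) :
    ¬ (σ * swap i j).SameCycle i j := by
  obtain ⟨a, ha, ha', rfl⟩ := exists_pow_of_sameCycle hij h
  intro hs
  have h1 := mem_orb.mpr hs.symm
  rw [orb_mul_swap_pow ha ha'] at h1
  obtain ⟨k, hk, hk'⟩ := Finset.mem_image.mp h1
  have hk := Finset.mem_Icc.mp hk
  have := pow_ne_of_lt_period (σ := σ) (i := i) (a := 0) (k := k) (by omega) (by omega) (by omega)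
  exact this (by simpa using hk')

theorem orb_union_of_sameCycle (hij : i ≠ j) (h : σ.SameCycle i j) :
    orb σ i = orb (σ * swap i j) i ∪ orb (σ * swap i j) j := by
  obtain ⟨a, ha, ha', rfl⟩ := exists_pow_of_sameCycle hij h
  set c := minimalPeriod σ i with hc
  have hc2 : minimalPeriod σ ((σ ^ a) i) = c := (minimalPeriod_eq_of_sameCycle h).symm
  have hi : (σ ^ (c - a)) ((σ ^ a) i) = i := by
    rw [← Perm.mul_apply, ← pow_add, Nat.sub_add_cancel ha'.le]
    exact (exists_period σ i).2
  have h2 := orb_mul_swap_pow (σ := σ) (i := (σ ^ a) i) (a := c - a) (by omega) (by omega)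
  rw [hi, swap_comm] at h2
  rw [orb_mul_swap_pow ha ha', h2, orb_eq_image_of_period (exists_period σ i).1
    (exists_period σ i).2]
  ext y
  simp only [Finset.mem_image, Finset.mem_union, Finset.mem_Icc]
  constructor
  · rintro ⟨k, hk, rfl⟩
    rcases le_or_gt k a with hka | hka
    · exact Or.inr ⟨k, ⟨hk.1, hka⟩, rfl⟩
    · refine Or.inl ⟨k - a, ⟨by omega, by omega⟩, ?_⟩
      rw [← Perm.mul_apply, ← pow_add, Nat.sub_add_cancel hka.le]
  · rintro (⟨k, hk, rfl⟩ | ⟨k, hk, rfl⟩)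
    · refine ⟨k + a, ⟨by omega, by omega⟩, ?_⟩
      rw [← Perm.mul_apply, ← pow_add]
    · exact ⟨k, ⟨hk.1, by omega⟩, rfl⟩

theorem orb_mul_swap_of_notMem {x : α} (hi : i ∉ orb σ x) (hj : j ∉ orb σ x) :
    orb (σ * swap i j) x = orb σ x := by
  have key : ∀ k : ℕ, ((σ * swap i j) ^ k) x = (σ ^ k) x := by
    intro k
    induction k with
    | zero => rfl
    | succ k ih =>
      have h1 := pow_mem_orb σ x k
      rw [pow_succ', Perm.mul_apply, ih, Perm.mul_apply, swap_apply_of_ne_of_ne, pow_succ',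
        Perm.mul_apply]
      · exact fun h => hi (h ▸ h1)
      · exact fun h => hj (h ▸ h1)
  ext y
  simp only [mem_orb_iff_pow, key]

/-- Two different orbits are joined by a transposition. -/
theorem sameCycle_mul_swap (h : ¬ σ.SameCycle i j) : (σ * swap i j).SameCycle i j := by
  have hne : ∀ k, 0 < k → k < minimalPeriod σ i → (σ ^ k) i ≠ i ∧ (σ ^ k) i ≠ j := by
    intro k hk hk'
    refine ⟨?_, fun h' => h (mem_orb.mp (h' ▸ pow_mem_orb σ i k))⟩
    have := pow_ne_of_lt_period (σ := σ) (i := i) (a := 0) (k := k) (by omega) (by omega)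
      (by omega)
    simpa using this
  have h1 := mul_swap_pow_apply (exists_period σ i).1 hne
  rw [(exists_period σ i).2] at h1
  exact (mem_orb.mp (mem_orb_iff_pow.mpr ⟨_, h1⟩)).symm

theorem orb_union_of_not_sameCycle (h : ¬ σ.SameCycle i j) :
    orb (σ * swap i j) i = orb σ i ∪ orb σ j := by
  have hij : i ≠ j := fun h' => h (h' ▸ SameCycle.refl σ i)
  have h1 := orb_union_of_sameCycle hij (sameCycle_mul_swap h)
  rwa [mul_assoc, swap_mul_self, mul_one] at h1

theorem orb_disjoint (h : ¬ σ.SameCycle i j) : Disjoint (orb σ i) (orb σ j) := by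
  rw [Finset.disjoint_left]
  intro x hx hx'
  exact h ((mem_orb.mp hx).trans (mem_orb.mp hx').symm)

theorem notMem_of_mem_orbs_erase {O : Finset α} (hO : O ∈ (orbs σ).erase (orb σ i)) : i ∉ O := by
  obtain ⟨hne, hO⟩ := Finset.mem_erase.mp hO
  obtain ⟨x, _, rfl⟩ := Finset.mem_image.mp hO
  exact fun h => hne (orb_eq_of_mem h).symm

theorem orbs_mul_swap (hij : i ≠ j) (h : σ.SameCycle i j) :
    orbs (σ * swap i j) = insert (orb (σ * swap i j) i) (insert (orb (σ * swap i j) j)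
      ((orbs σ).erase (orb σ i))) := by
  have hu := orb_union_of_sameCycle hij h
  have key : ∀ x, x ∉ orb σ i → orb (σ * swap i j) x = orb σ x := by
    intro x hx
    refine orb_mul_swap_of_notMem (fun h' => hx ?_) fun h' => hx ?_
    · exact orb_eq_of_mem h' ▸ mem_orb_self σ x
    · exact mem_orb.mpr (h.trans (mem_orb.mp h').symm)
  ext O
  simp only [Finset.mem_insert, Finset.mem_erase]
  constructor
  · intro hO
    obtain ⟨x, _, rfl⟩ := Finset.mem_image.mp hO
    by_cases hx : x ∈ orb σ i
    · rw [hu, Finset.mem_union] at hx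
      rcases hx with hx | hx
      · exact Or.inl (orb_eq_of_mem hx)
      · exact Or.inr (Or.inl (orb_eq_of_mem hx))
    · refine Or.inr (Or.inr ⟨?_, ?_⟩) 
      · rw [key x hx]
        exact fun h' => hx (h' ▸ mem_orb_self σ x)
      · rw [key x hx]
        exact orb_mem_orbs σ x
  · rintro (rfl | rfl | ⟨hne, hO⟩)
    · exact orb_mem_orbs _ _
    · exact orb_mem_orbs _ _
    · obtain ⟨x, _, rfl⟩ := Finset.mem_image.mp hO
      rw [← key x fun h' => hne (orb_eq_of_mem h')]
      exact orb_mem_orbs _ _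

@[to_additive]
theorem prod_orbs_mul_swap {M : Type*} [CommMonoid M] (hij : i ≠ j) (h : σ.SameCycle i j)
    (F F' : Finset α → M) (hF : ∀ O, i ∉ O → j ∉ O → F O = F' O) :
    (∏ O ∈ orbs (σ * swap i j), F' O) * F (orb σ i) =
      (∏ O ∈ orbs σ, F O) * F' (orb (σ * swap i j) i) * F' (orb (σ * swap i j) j) := by
  have h1 : orb (σ * swap i j) j ∉ (orbs σ).erase (orb σ i) := by
    intro h'
    rw [orb_eq_iff.mpr h] at h'
    exact notMem_of_mem_orbs_erase h' (mem_orb_self _ _)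
  have h2 : orb (σ * swap i j) i ∉ insert (orb (σ * swap i j) j) ((orbs σ).erase (orb σ i)) := by
    rw [Finset.mem_insert, not_or]
    exact ⟨fun h' => not_sameCycle_mul_swap hij h (orb_eq_iff.mp h'),
      fun h' => notMem_of_mem_orbs_erase h' (mem_orb_self _ _)⟩
  rw [orbs_mul_swap hij h, Finset.prod_insert h2, Finset.prod_insert h1,
    ← Finset.prod_erase_mul _ _ (orb_mem_orbs σ i)]
  have h3 : ∏ O ∈ (orbs σ).erase (orb σ i), F' O = ∏ O ∈ (orbs σ).erase (orb σ i), F O := by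
    refine Finset.prod_congr rfl fun O hO => (hF O (notMem_of_mem_orbs_erase hO) ?_).symm
    rw [orb_eq_iff.mpr h] at hO
    exact notMem_of_mem_orbs_erase hO
  rw [h3]
  simp only [mul_assoc, mul_comm, mul_left_comm]

@[to_additive]
theorem prod_orbs_mul_swap_of_not {M : Type*} [CommMonoid M] (h : ¬ σ.SameCycle i j)
    (F F' : Finset α → M) (hF : ∀ O, i ∉ O → j ∉ O → F O = F' O) :
    (∏ O ∈ orbs (σ * swap i j), F' O) * F (orb σ i) * F (orb σ j) =
      (∏ O ∈ orbs σ, F O) * F' (orb (σ * swap i j) i) := by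
  have hij : i ≠ j := fun h' => h (h' ▸ SameCycle.refl σ i)
  have := prod_orbs_mul_swap hij (sameCycle_mul_swap h) F' F fun O h1 h2 => (hF O h1 h2).symm
  rw [mul_assoc σ, swap_mul_self, mul_one] at this
  exact this.symm

theorem sum_orb_mul_swap {M : Type*} [AddCommMonoid M] (σ : Perm α) (i : α) (F : ℕ → M) :
    ∑ j ∈ (orb σ i).erase i, F (orb (σ * swap i j) j).card =
      ∑ a ∈ Finset.Ico 1 (orb σ i).card, F a := by
  symm
  refine Finset.sum_bij (fun a _ => (σ ^ a) i) ?_ ?_ ?_ ?_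
  · intro a ha
    have ha := Finset.mem_Ico.mp ha
    rw [card_orb] at ha
    refine Finset.mem_erase.mpr ⟨?_, pow_mem_orb σ i a⟩
    simpa using pow_ne_of_lt_period (σ := σ) (i := i) (a := 0) (k := a) (by omega) ha.2 (by omega)
  · intro a ha b hb hab
    have ha := Finset.mem_Ico.mp ha
    have hb := Finset.mem_Ico.mp hb
    rw [card_orb] at ha hb
    exact pow_injOn_range σ i ha.2 hb.2 hab
  · intro j hj
    obtain ⟨hne, hj⟩ := Finset.mem_erase.mp hj
    obtain ⟨a, ha, ha', rfl⟩ := exists_pow_of_sameCycle (Ne.symm hne) (mem_orb.mp hj)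
    exact ⟨a, Finset.mem_Ico.mpr ⟨ha, by rwa [card_orb]⟩, rfl⟩
  · intro a ha
    have ha := Finset.mem_Ico.mp ha
    rw [card_orb] at ha
    rw [card_orb_mul_swap_pow ha.1 ha.2]

theorem card_orb_add (hij : i ≠ j) (h : σ.SameCycle i j) :
    (orb (σ * swap i j) i).card + (orb (σ * swap i j) j).card = (orb σ i).card := by
  rw [orb_union_of_sameCycle hij h,
    Finset.card_union_of_disjoint (orb_disjoint (not_sameCycle_mul_swap hij h))]

theorem sum_orb_comp (σ : Perm α) (F : Finset α → ℚ) :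
    ∑ x, F (orb σ x) / (orb σ x).card = ∑ O ∈ orbs σ, F O := by
  rw [Finset.sum_comp (fun O : Finset α => F O / O.card) (orb σ)]
  refine Finset.sum_congr rfl fun O hO => ?_
  obtain ⟨x, _, rfl⟩ := Finset.mem_image.mp hO
  have h1 : (Finset.univ.filter fun y => orb σ y = orb σ x) = orb σ x := by
    ext y
    rw [Finset.mem_filter, mem_orb, orb_eq_iff]
    exact ⟨fun h => h.2.symm, fun h => ⟨Finset.mem_univ _, h.symm⟩⟩
  have h2 : ((orb σ x).card : ℚ) ≠ 0 := by exact_mod_cast (card_orb_pos σ x).ne'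
  rw [h1, nsmul_eq_mul]
  field_simp

end Orbits

/-! ### Tree numbers and Abel-type identities -/

section Abel

open Polynomial fwdDiff in
/-- Abel's identity `∑ₖ C(m+1,k+1) (k+1)ᵏ (X - (k+1))ᵐ⁻ᵏ = (m+1) Xᵐ`. -/
theorem abel_polynomial (m : ℕ) :
    ∑ k ∈ Finset.range (m + 1), C ((((m + 1).choose (k + 1) : ℕ) : ℚ) * ((k : ℚ) + 1) ^ k) *
      (X - C ((k : ℚ) + 1)) ^ (m - k) = C ((m : ℚ) + 1) * X ^ m := by
  induction m with
  | zero => simp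
  | succ m ih =>
    have hd : derivative (∑ k ∈ Finset.range (m + 1 + 1),
        C ((((m + 1 + 1).choose (k + 1) : ℕ) : ℚ) * ((k : ℚ) + 1) ^ k) *
        (X - C ((k : ℚ) + 1)) ^ (m + 1 - k)) =
        derivative (C (((m + 1 : ℕ) : ℚ) + 1) * X ^ (m + 1) : ℚ[X]) := by
      have h1 : derivative (C (((m + 1 : ℕ) : ℚ) + 1) * X ^ (m + 1) : ℚ[X]) =
          C (((m + 1 : ℕ) : ℚ) + 1) * (C ((m : ℚ) + 1) * X ^ m) := by
        rw [derivative_C_mul, derivative_X_pow]; simp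
      rw [h1, ← ih, derivative_sum, Finset.sum_range_succ, Finset.mul_sum]
      have h2 : derivative (C ((((m + 1 + 1).choose (m + 1 + 1) : ℕ) : ℚ) *
          (((m + 1 : ℕ) : ℚ) + 1) ^ (m + 1)) *
          (X - C (((m + 1 : ℕ) : ℚ) + 1)) ^ (m + 1 - (m + 1))) = 0 := by
        rw [Nat.sub_self, pow_zero, mul_one, derivative_C]
      rw [h2, add_zero]
      refine Finset.sum_congr rfl fun k hk => ?_
      have hk : k ≤ m := Nat.lt_succ_iff.mp (Finset.mem_range.mp hk)
      obtain ⟨d, rfl⟩ := Nat.exists_eq_add_of_le hk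
      have e1 : k + d + 1 - k = d + 1 := by omega
      have e2 : k + d - k = d := by omega
      have h3 : ((k + d + 1 + 1).choose (k + 1) : ℚ) * (d + 1) =
          (k + d + 1 + 1) * ((k + d + 1).choose (k + 1)) := by
        have := Nat.choose_mul_succ_eq (k + d + 1) (k + 1)
        have e3 : k + d + 1 + 1 - (k + 1) = d + 1 := by omega
        rw [e3] at this
        have h := congrArg (Nat.cast : ℕ → ℚ) this
        push_cast at h
        linarith
      rw [e1, e2, derivative_C_mul, derivative_X_sub_C_pow]
      have h4 := congrArg (C : ℚ → ℚ[X]) h3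
      simp only [Nat.add_sub_cancel, Nat.cast_add, Nat.cast_one, map_add, map_mul, map_natCast,
        map_one] at h4 ⊢
      linear_combination (C (((k : ℚ) + 1) ^ k) * (X - ((k : ℚ[X]) + 1)) ^ d) * h4
    have h0 : (∑ k ∈ Finset.range (m + 1 + 1),
        C ((((m + 1 + 1).choose (k + 1) : ℕ) : ℚ) * ((k : ℚ) + 1) ^ k) *
        (X - C ((k : ℚ) + 1)) ^ (m + 1 - k)).eval 0 =
        (C (((m + 1 : ℕ) : ℚ) + 1) * X ^ (m + 1) : ℚ[X]).eval 0 := by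
      simp only [eval_finsetSum, eval_mul, eval_C, eval_pow, eval_sub, eval_X, zero_sub]
      have h1 : (fwdDiff (1 : ℚ))^[m + 2] (fun x : ℚ => x ^ (m + 1)) = 0 :=
        fwdDiff_iter_pow_eq_zero_of_lt (by omega)
      have h2 := congrFun h1 0
      rw [fwdDiff_iter_eq_sum_shift, Finset.sum_range_succ'] at h2
      simp only [Pi.zero_apply] at h2
      have h3 : (0 : ℚ) ^ (m + 1) = 0 := by simp
      rw [h3, mul_zero]
      simp only [zero_smul, zero_add, h3, smul_zero, add_zero] at h2
      rw [← h2]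
      refine Finset.sum_congr rfl fun k hk => ?_
      have hk : k ≤ m + 1 := Nat.lt_succ_iff.mp (Finset.mem_range.mp hk)
      have e1 : m + 2 - (k + 1) = m + 1 - k := by omega
      rw [neg_pow, e1]
      simp only [nsmul_eq_mul, zsmul_eq_mul, mul_one]
      push_cast
      have e2 : ((k : ℚ) + 1) ^ (m + 1) = (k + 1) ^ k * (k + 1) ^ (m + 1 - k) := by
        rw [← pow_add]; congr 1; omega
      rw [e2]; ring
    rw [← sub_eq_zero]
    rw [← sub_eq_zero, ← derivative_sub] at hd
    have h5 := derivative_eq_zero.mp hd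
    rw [eq_C_of_natDegree_eq_zero h5, coeff_zero_eq_eval_zero]
    simp only [eval_sub, h0, sub_self, map_zero]

/-- The exponential generating coefficients `nⁿ⁻¹ / n!` of rooted labelled trees. -/
noncomputable def treeCoeff (n : ℕ) : ℚ := (n : ℚ) ^ n / (n * n.factorial)

@[simp] theorem treeCoeff_zero : treeCoeff 0 = 0 := by simp [treeCoeff]

theorem treeCoeff_one : treeCoeff 1 = 1 := by simp [treeCoeff]

theorem treeCoeff_succ (n : ℕ) : treeCoeff (n + 1) = ((n : ℚ) + 1) ^ n / (n + 1).factorial := by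
  have : ((n : ℚ) + 1) ≠ 0 := by positivity
  rw [treeCoeff, pow_succ]; push_cast; field_simp

theorem treeCoeff_ne_zero {n : ℕ} (hn : 0 < n) : treeCoeff n ≠ 0 := by
  have : (n : ℚ) ≠ 0 := by positivity
  have := n.factorial_ne_zero
  unfold treeCoeff; positivity

theorem sum_treeCoeff_mul (n : ℕ) :
    ∑ x ∈ Finset.HasAntidiagonal.antidiagonal n, treeCoeff x.1 * (x.2 * treeCoeff x.2) =
      ((n : ℚ) - 1) * treeCoeff n := by
  rcases n with _ | m
  · simp
  rw [Finset.Nat.sum_antidiagonal_eq_sum_range_succ_mk, Finset.sum_range_succ']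
  simp only [treeCoeff_zero, zero_mul, add_zero]
  have h := congrArg (Polynomial.eval ((m : ℚ) + 1)) (abel_polynomial m)
  simp only [Polynomial.eval_finsetSum, Polynomial.eval_mul, Polynomial.eval_C,
    Polynomial.eval_pow, Polynomial.eval_sub, Polynomial.eval_X] at h
  rw [Finset.sum_range_succ] at h ⊢
  have hf : ((m + 1).factorial : ℚ) ≠ 0 := by exact_mod_cast (m + 1).factorial_ne_zero
  have key : ∀ k ∈ Finset.range m, treeCoeff (k + 1) *
      (((m + 1 - (k + 1) : ℕ) : ℚ) * treeCoeff (m + 1 - (k + 1))) * (m + 1).factorial =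
      ((m + 1).choose (k + 1) : ℚ) * ((k : ℚ) + 1) ^ k * ((m : ℚ) + 1 - (k + 1)) ^ (m - k) := by
    intro k hk
    obtain ⟨d, rfl⟩ := Nat.exists_eq_add_of_lt (Finset.mem_range.mp hk)
    have e1 : k + d + 1 + 1 - (k + 1) = d + 1 := by omega
    have e2 : k + d + 1 - k = d + 1 := by omega
    rw [e1, e2, treeCoeff_succ, treeCoeff_succ]
    have hc := Nat.add_choose_mul_factorial_mul_factorial (d + 1) (k + 1)
    have e3 : d + 1 + (k + 1) = k + d + 1 + 1 := by omega
    rw [e3] at hc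
    rw [← hc]
    have h1 : ((k + 1).factorial : ℚ) ≠ 0 := by exact_mod_cast (k + 1).factorial_ne_zero
    have h2 : ((d + 1).factorial : ℚ) ≠ 0 := by exact_mod_cast (d + 1).factorial_ne_zero
    push_cast
    field_simp
    ring
  have hs := Finset.sum_congr rfl key
  rw [← Finset.sum_mul] at hs
  rw [← hs] at h
  simp only [Nat.sub_self, Nat.choose_self, treeCoeff_zero, mul_zero, add_zero, pow_zero] at h ⊢
  generalize ∑ k ∈ Finset.range m, treeCoeff (k + 1) *
      (((m + 1 - (k + 1) : ℕ) : ℚ) * treeCoeff (m + 1 - (k + 1))) = S at h ⊢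
  rw [treeCoeff_succ, mul_div_assoc', eq_div_iff hf]
  push_cast at h ⊢
  linear_combination h

end Abel

section PowerSeriesIdentity

open PowerSeries

/-- The Euler operator `X d/dX`. -/
noncomputable def euler {R : Type*} [CommRing R] (f : R⟦X⟧) : R⟦X⟧ := X * derivative R f

variable {R : Type*} [CommRing R]

theorem coeff_euler (f : R⟦X⟧) (n : ℕ) : coeff n (euler f) = n * coeff n f := by
  rcases n with _ | n
  · simp [euler]
  · rw [euler, coeff_succ_X_mul, coeff_derivative]; push_cast; ring

theorem euler_sub (f g : R⟦X⟧) : euler (f - g) = euler f - euler g := by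
  simp [euler, mul_sub]

theorem euler_mul (f g : R⟦X⟧) : euler (f * g) = euler f * g + f * euler g := by
  simp only [euler, Derivation.leibniz, smul_eq_mul]; ring

theorem euler_C_mul (r : R) (f : R⟦X⟧) : euler (C r * f) = C r * euler f := by
  rw [euler_mul]; simp [euler]

theorem eq_zero_of_mul_euler_eq [IsDomain R] [CharZero R] {κ f : R⟦X⟧}
    (hκ : constantCoeff κ = 1) (h : κ * euler f = f) (h1 : coeff 1 f = 0) : f = 0 := by
  ext n
  rw [map_zero]
  induction n using Nat.strong_induction_on with
  | _ n ih =>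
    have hn := congrArg (coeff n) h
    rw [coeff_mul, Finset.Nat.sum_antidiagonal_eq_sum_range_succ_mk, Finset.sum_range_succ'] at hn
    have h0 : ∑ k ∈ Finset.range n, coeff (k + 1) κ * coeff (n - (k + 1)) (euler f) = 0 := by
      refine Finset.sum_eq_zero fun k hk => ?_
      have := Finset.mem_range.mp hk
      rw [coeff_euler, ih _ (by omega)]; simp
    rw [h0] at hn
    simp only [zero_add, coeff_zero_eq_constantCoeff, hκ, one_mul, Nat.sub_zero,
      coeff_euler] at hn
    rcases eq_or_ne n 1 with rfl | hne
    · exact h1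
    · have h2 : ((n : R) - 1) * coeff n f = 0 := by linear_combination hn
      rcases mul_eq_zero.mp h2 with h3 | h3
      · exact absurd (by exact_mod_cast sub_eq_zero.mp h3) hne
      · exact h3

/-- The tree series over `ℚ[Y]`, and its rescaling by `Y`. -/
noncomputable def treeSeries : (Polynomial ℚ)⟦X⟧ := mk fun n => Polynomial.C (treeCoeff n)

noncomputable def treeSeriesY : (Polynomial ℚ)⟦X⟧ := rescale (Polynomial.X) treeSeries

theorem coeff_treeSeries (n : ℕ) : coeff n treeSeries = Polynomial.C (treeCoeff n) :=
  coeff_mk _ _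

theorem coeff_treeSeriesY (n : ℕ) :
    coeff n treeSeriesY = Polynomial.C (treeCoeff n) * Polynomial.X ^ n := by
  rw [treeSeriesY, coeff_rescale, coeff_treeSeries, mul_comm]

theorem euler_treeSeries : (1 - treeSeries) * euler treeSeries = treeSeries := by
  ext1 n
  rw [sub_mul, one_mul, map_sub, coeff_mul, coeff_euler]
  simp only [coeff_euler, coeff_treeSeries]
  have h := congrArg (Polynomial.C : ℚ → Polynomial ℚ) (sum_treeCoeff_mul n)
  simp only [map_sum, map_mul, map_sub, map_natCast, map_one] at h
  rw [h]; ring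

theorem euler_rescale (r : R) (f : R⟦X⟧) : euler (rescale r f) = rescale r (euler f) := by
  ext n
  simp only [coeff_euler, coeff_rescale]; ring

theorem euler_treeSeriesY : (1 - treeSeriesY) * euler treeSeriesY = treeSeriesY := by
  have := congrArg (rescale (Polynomial.X : Polynomial ℚ)) euler_treeSeries
  rwa [map_mul, map_sub, map_one, ← euler_rescale] at this

/-- The series with coefficients `∑_{a+b=n} a b² t_a t_b / (a+b) Yᵇ`. -/
noncomputable def mixedSeries : (Polynomial ℚ)⟦X⟧ := mk fun n => ∑ x ∈ Finset.HasAntidiagonal.antidiagonal n,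
  Polynomial.C ((x.1 : ℚ) * x.2 ^ 2 * treeCoeff x.1 * treeCoeff x.2 / (x.1 + x.2)) *
    Polynomial.X ^ x.2

theorem euler_mixedSeries :
    euler mixedSeries = euler treeSeries * euler (euler treeSeriesY) := by
  ext1 n
  rw [coeff_euler, coeff_mul, mixedSeries, coeff_mk, Finset.mul_sum]
  refine Finset.sum_congr rfl fun x hx => ?_
  rw [coeff_euler, coeff_euler, coeff_euler, coeff_treeSeries, coeff_treeSeriesY,
    ← Finset.HasAntidiagonal.mem_antidiagonal.mp hx]
  rcases Nat.eq_zero_or_pos x.1 with h | h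
  · simp [h]
  · have h2 : ((x.1 : ℚ) + x.2) ≠ 0 := by positivity
    have h3 : ((x.1 : ℚ) + x.2) * ((x.1 : ℚ) * x.2 ^ 2 * treeCoeff x.1 * treeCoeff x.2 /
        (x.1 + x.2)) = (x.1 * treeCoeff x.1) * (x.2 ^ 2 * treeCoeff x.2) := by field_simp
    have h4 := congrArg (Polynomial.C : ℚ → Polynomial ℚ) h3
    simp only [map_mul, map_add, map_natCast, map_pow] at h4
    push_cast
    linear_combination Polynomial.X ^ x.2 * h4

/-- The series with coefficients `t_n (Y + ⋯ + Yⁿ⁻¹)`. -/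
noncomputable def joinSeries : (Polynomial ℚ)⟦X⟧ := mk fun n =>
  Polynomial.C (treeCoeff n) * (∑ i ∈ Finset.range n, Polynomial.X ^ i - 1)

theorem joinSeries_mul :
    C (1 - Polynomial.X : Polynomial ℚ) * joinSeries =
      C (Polynomial.X : Polynomial ℚ) * treeSeries - treeSeriesY := by
  ext1 n
  rw [coeff_C_mul, map_sub, coeff_C_mul, coeff_treeSeries, coeff_treeSeriesY, joinSeries, coeff_mk]
  have := geom_sum_mul_neg (Polynomial.X : Polynomial ℚ) n
  linear_combination Polynomial.C (treeCoeff n) * this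

theorem euler_joinSeries :
    (1 - treeSeries) * (1 - treeSeriesY) * euler joinSeries =
      joinSeries + treeSeries * treeSeriesY := by
  have h1 := congrArg euler joinSeries_mul
  rw [euler_C_mul, euler_sub, euler_C_mul] at h1
  have hne : C (1 - Polynomial.X : Polynomial ℚ) ≠ 0 := by
    rw [Ne, map_eq_zero_iff _ PowerSeries.C_injective, sub_eq_zero]
    intro h
    simpa using congrArg (Polynomial.eval 0) h
  refine mul_left_cancel₀ hne ?_
  have h2 := euler_treeSeries
  have h3 := euler_treeSeriesY
  have h4 := joinSeries_mul
  rw [map_sub, map_one] at *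
  linear_combination (1 - treeSeries) * (1 - treeSeriesY) * h1 +
    C (Polynomial.X : Polynomial ℚ) * (1 - treeSeriesY) * h2 - (1 - treeSeries) * h3 - h4

theorem mixedSeries_eq :
    (treeSeries - treeSeriesY) * mixedSeries =
      joinSeries - treeSeries * euler treeSeriesY := by
  have hu := euler_treeSeries
  have hv := euler_treeSeriesY
  have hw := euler_joinSeries
  have hA := euler_mixedSeries
  have hv2 := congrArg euler hv
  rw [euler_mul, euler_sub] at hv2
  have h1 : euler (1 : (Polynomial ℚ)⟦X⟧) = 0 := by simp [euler]
  rw [h1] at hv2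
  rw [← sub_eq_zero]
  have hc : ∀ f : (Polynomial ℚ)⟦X⟧, constantCoeff f = coeff 0 f := fun f => by simp
  refine eq_zero_of_mul_euler_eq (κ := (1 - treeSeries) * (1 - treeSeriesY)) ?_ ?_ ?_
  · rw [map_mul, map_sub, map_sub, map_one, hc, hc, coeff_treeSeries, coeff_treeSeriesY]
    simp
  · rw [euler_sub, euler_sub, euler_mul, euler_mul, euler_sub]
    generalize treeSeries = u at *
    generalize treeSeriesY = v at *
    generalize euler (euler v) = vv at *
    generalize euler v = v1 at *
    generalize euler u = u1 at *
    generalize euler mixedSeries = a1 at *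
    generalize euler joinSeries = w1 at *
    generalize mixedSeries = a at *
    generalize joinSeries = w at *
    rw [hA]
    linear_combination (1 - v) * a * hu - (1 - u) * a * hv + (1 - v) * (u - v) * vv * hu +
      (u - v) * u * hv2 - hw + (1 - v) * v1 * hu + u * hv + (1 - u) * u * hv2 +
      u * (1 + v1) * hv - u * hv
  · rw [map_sub, map_sub, coeff_mul, coeff_mul]
    simp [Finset.Nat.antidiagonal_succ, coeff_treeSeries, coeff_treeSeriesY, mixedSeries,
      coeff_euler, joinSeries, -coeff_zero_eq_constantCoeff]

theorem coeff_coeff_mixedSeries (j q : ℕ) : (coeff j mixedSeries).coeff q =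
    if q ≤ j then (((j - q : ℕ) : ℚ) * q ^ 2 * treeCoeff (j - q) * treeCoeff q / ((j - q : ℕ) + q))
      else 0 := by
  rw [mixedSeries, coeff_mk, Polynomial.finsetSum_coeff]
  simp only [Polynomial.coeff_C_mul_X_pow]
  split_ifs with h
  · rw [Finset.sum_eq_single (j - q, q)]
    · simp
    · rintro ⟨a, b⟩ hab hne
      have hab := Finset.HasAntidiagonal.mem_antidiagonal.mp hab
      simp only at hab
      rw [if_neg]
      rintro rfl
      exact hne (by rw [Prod.mk.injEq]; omega)
    · intro h'
      exact absurd (Finset.HasAntidiagonal.mem_antidiagonal.mpr (by simp only; omega)) h'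
  · refine Finset.sum_eq_zero fun x hx => if_neg ?_
    have := Finset.HasAntidiagonal.mem_antidiagonal.mp hx
    omega

/-- The generic term of `mixedSeries`. -/
noncomputable def mixedCoeff (a b : ℕ) : ℚ := (a : ℚ) * b ^ 2 * treeCoeff a * treeCoeff b / (a + b)

theorem mixedCoeff_identity {p q : ℕ} (hp : 0 < p) (hq : 0 < q) :
    ∑ i ∈ Finset.range (p + 1), treeCoeff i * mixedCoeff (p - i) q -
      ∑ i ∈ Finset.range (q + 1), treeCoeff i * mixedCoeff p (q - i) =
    treeCoeff (p + q) - q * treeCoeff p * treeCoeff q := by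
  have h := congrArg (fun f => (coeff (p + q) f).coeff q) mixedSeries_eq
  simp only [sub_mul, map_sub, Polynomial.coeff_sub, coeff_mul, Polynomial.finsetSum_coeff] at h
  simp only [Finset.Nat.sum_antidiagonal_eq_sum_range_succ_mk] at h
  have h1 : ∑ i ∈ Finset.range (p + q).succ,
      (coeff i treeSeries * coeff (p + q - i) mixedSeries).coeff q =
      ∑ i ∈ Finset.range (p + 1), treeCoeff i * mixedCoeff (p - i) q := by
    symm
    refine Finset.sum_subset_zero_on_sdiff ?_ ?_ ?_
    · exact Finset.range_mono (by omega)
    · intro i hi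
      simp only [Finset.mem_sdiff, Finset.mem_range] at hi
      rw [coeff_treeSeries, Polynomial.coeff_C_mul, coeff_coeff_mixedSeries, if_neg (by omega),
        mul_zero]
    · intro i hi
      have hi := Finset.mem_range.mp hi
      have e : p + q - i - q = p - i := by omega
      rw [coeff_treeSeries, Polynomial.coeff_C_mul, coeff_coeff_mixedSeries, if_pos (by omega), e,
        mixedCoeff]
  have h2 : ∑ i ∈ Finset.range (p + q).succ,
      (coeff i treeSeriesY * coeff (p + q - i) mixedSeries).coeff q =
      ∑ i ∈ Finset.range (q + 1), treeCoeff i * mixedCoeff p (q - i) := by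
    symm
    refine Finset.sum_subset_zero_on_sdiff ?_ ?_ ?_
    · exact Finset.range_mono (by omega)
    · intro i hi
      simp only [Finset.mem_sdiff, Finset.mem_range] at hi
      rw [coeff_treeSeriesY, mul_assoc, Polynomial.coeff_C_mul, Polynomial.coeff_X_pow_mul',
        if_neg (by omega), mul_zero]
    · intro i hi
      have hi := Finset.mem_range.mp hi
      have e : p + q - i - (q - i) = p := by omega
      rw [coeff_treeSeriesY, mul_assoc, Polynomial.coeff_C_mul, Polynomial.coeff_X_pow_mul',
        if_pos (by omega), coeff_coeff_mixedSeries, if_pos (by omega), e, mixedCoeff]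
  have h3 : (coeff (p + q) joinSeries).coeff q = treeCoeff (p + q) := by
    rw [joinSeries, coeff_mk, Polynomial.coeff_C_mul, Polynomial.coeff_sub,
      Polynomial.finsetSum_coeff]
    simp only [Polynomial.coeff_X_pow, Polynomial.coeff_one]
    rw [Finset.sum_ite_eq, if_pos (Finset.mem_range.mpr (by omega)), if_neg (by omega)]
    ring
  have h4 : ∑ i ∈ Finset.range (p + q).succ,
      (coeff i treeSeries * coeff (p + q - i) (euler treeSeriesY)).coeff q =
      q * treeCoeff p * treeCoeff q := by
    rw [Finset.sum_eq_single p]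
    · rw [Nat.add_sub_cancel_left, coeff_euler, coeff_treeSeries, coeff_treeSeriesY,
        Polynomial.coeff_C_mul, Polynomial.coeff_natCast_mul, Polynomial.coeff_C_mul_X_pow,
        if_pos rfl]
      ring
    · intro i hi hne
      have hi := Finset.mem_range.mp hi
      rw [coeff_euler, coeff_treeSeries, coeff_treeSeriesY,
        Polynomial.coeff_C_mul, Polynomial.coeff_natCast_mul, Polynomial.coeff_C_mul_X_pow,
        if_neg (by omega)]
      ring
    · intro h'
      exact absurd (Finset.mem_range.mpr (by omega)) h'
  rw [h1, h2, h3, h4] at h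
  exact h

end PowerSeriesIdentity

section Recursions

theorem sum_range_eq_sum_Ico {n : ℕ} (hn : 0 < n) (f : ℕ → ℚ) (h0 : f 0 = 0) (h1 : f n = 0) :
    ∑ i ∈ Finset.range (n + 1), f i = ∑ i ∈ Finset.Ico 1 n, f i := by
  rw [Finset.sum_range_succ, h1, add_zero, Finset.range_eq_Ico,
    Finset.sum_eq_sum_Ico_succ_bot hn, h0, zero_add]

theorem sum_Ico_reflect_sub (n : ℕ) (f : ℕ → ℚ) :
    ∑ i ∈ Finset.Ico 1 n, f (n - i) = ∑ i ∈ Finset.Ico 1 n, f i := by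
  refine Finset.sum_nbij' (fun i => n - i) (fun i => n - i) ?_ ?_ ?_ ?_ ?_ <;>
    intro i hi <;> simp only [Finset.mem_Ico] at hi ⊢ <;> omega

theorem sum_Ico_mul_treeCoeff {n : ℕ} (hn : 0 < n) :
    ∑ a ∈ Finset.Ico 1 n, (a : ℚ) * treeCoeff a * treeCoeff (n - a) =
      ((n : ℚ) - 1) * treeCoeff n := by
  rw [← sum_treeCoeff_mul, Finset.Nat.sum_antidiagonal_eq_sum_range_succ_mk,
    sum_range_eq_sum_Ico hn, ← sum_Ico_reflect_sub]
  · refine Finset.sum_congr rfl fun a ha => ?_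
    have ha := Finset.mem_Ico.mp ha
    rw [Nat.sub_sub_self ha.2.le]; ring
  · simp
  · simp

theorem treeCoeff_split {n : ℕ} (hn : 0 < n) :
    (n : ℚ) * ∑ a ∈ Finset.Ico 1 n, treeCoeff a * treeCoeff (n - a) =
      2 * ((n : ℚ) - 1) * treeCoeff n := by
  have h1 := sum_Ico_mul_treeCoeff hn
  have h2 := h1
  rw [← sum_Ico_reflect_sub] at h2
  rw [mul_assoc, ← h1, two_mul]
  nth_rewrite 2 [h1]
  rw [← h2, ← Finset.sum_add_distrib, Finset.mul_sum]
  refine Finset.sum_congr rfl fun a ha => ?_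
  have ha := Finset.mem_Ico.mp ha
  rw [Nat.sub_sub_self ha.2.le, Nat.cast_sub ha.2.le]; ring

/-- The weight of a pair of zero cycles of lengths `p` and `q`. -/
noncomputable def annularWeight (p q : ℕ) : ℚ := 2 * (p : ℚ) ^ 2 * q ^ 2 / (p + q)

theorem annularWeight_comm (p q : ℕ) : annularWeight p q = annularWeight q p := by
  rw [annularWeight, annularWeight, add_comm (p : ℚ)]; ring

theorem treeCoeff_annular {p q : ℕ} (hp : 0 < p) (hq : 0 < q) :
    ((p : ℚ) + q) * annularWeight p q * treeCoeff p * treeCoeff q =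
      2 * p * q * treeCoeff (p + q) +
      p * treeCoeff q *
        ∑ a ∈ Finset.Ico 1 p, treeCoeff a * treeCoeff (p - a) * annularWeight a q +
      q * treeCoeff p *
        ∑ b ∈ Finset.Ico 1 q, treeCoeff b * treeCoeff (q - b) * annularWeight p b := by
  have hJ := mixedCoeff_identity hp hq
  rw [sum_range_eq_sum_Ico hp _ (by simp) (by simp [mixedCoeff]),
    sum_range_eq_sum_Ico hq _ (by simp) (by simp [mixedCoeff]),
    ← sum_Ico_reflect_sub p, ← sum_Ico_reflect_sub q] at hJ
  have hp' : (0 : ℚ) < p := by exact_mod_cast hp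
  have hq' : (0 : ℚ) < q := by exact_mod_cast hq
  have h1 : treeCoeff q *
      ∑ a ∈ Finset.Ico 1 p, treeCoeff a * treeCoeff (p - a) * annularWeight a q =
      2 * q ^ 2 * treeCoeff q * (((p : ℚ) - 1) * treeCoeff p) -
      2 * q * ∑ i ∈ Finset.Ico 1 p, treeCoeff (p - i) * mixedCoeff (p - (p - i)) q := by
    rw [← sum_Ico_mul_treeCoeff hp, Finset.mul_sum, Finset.mul_sum, Finset.mul_sum,
      ← Finset.sum_sub_distrib]
    refine Finset.sum_congr rfl fun a ha => ?_
    have ha := Finset.mem_Ico.mp ha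
    rw [Nat.sub_sub_self ha.2.le, annularWeight, mixedCoeff]
    field_simp
    ring
  have h2 : treeCoeff p *
      ∑ b ∈ Finset.Ico 1 q, treeCoeff b * treeCoeff (q - b) * annularWeight p b =
      2 * p * ∑ i ∈ Finset.Ico 1 q, treeCoeff (q - i) * mixedCoeff p (q - (q - i)) := by
    rw [Finset.mul_sum, Finset.mul_sum]
    refine Finset.sum_congr rfl fun a ha => ?_
    have ha := Finset.mem_Ico.mp ha
    rw [Nat.sub_sub_self ha.2.le, annularWeight, mixedCoeff]
    field_simp
  have h3 : ((p : ℚ) + q) * annularWeight p q = 2 * p ^ 2 * q ^ 2 := by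
    rw [annularWeight]; field_simp
  linear_combination treeCoeff p * treeCoeff q * h3 - p * h1 - q * h2 + 2 * p * q * hJ

end Recursions

/-! ### Flags of orbits of signed permutations -/

section Flags

open Equiv Equiv.Perm

variable {α : Type*} [Fintype α] [DecidableEq α]

/-- The total sign of the orbit of `x`; it is `1` for zero cycles and `0` for paired cycles. -/
def flag (σ : Perm α) (s : α → ZMod 2) (x : α) : ZMod 2 := ∑ y ∈ orb σ x, s y

/-- The number of orbits with total sign `0`. -/
def numPaired (σ : Perm α) (s : α → ZMod 2) : ℕ :=
  ∑ O ∈ orbs σ, if ∑ y ∈ O, s y = 0 then 1 else 0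

/-- The signs after multiplication by a signed transposition. -/
def swapSign (s : α → ZMod 2) (i j : α) (δ : ZMod 2) (x : α) : ZMod 2 :=
  (if x = i ∨ x = j then δ else 0) + s (swap i j x)

variable {σ : Perm α} {s : α → ZMod 2} {i j : α} {δ : ZMod 2}

theorem flag_eq_of_sameCycle (h : σ.SameCycle i j) : flag σ s i = flag σ s j := by
  rw [flag, flag, orb_eq_iff.mpr h]

omit [Fintype α] in
theorem sum_swapSign_of_notMem {O : Finset α} (hi : i ∉ O) (hj : j ∉ O) :
    ∑ y ∈ O, swapSign s i j δ y = ∑ y ∈ O, s y := by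
  refine Finset.sum_congr rfl fun y hy => ?_
  have h1 : y ≠ i := fun h => hi (h ▸ hy)
  have h2 : y ≠ j := fun h => hj (h ▸ hy)
  rw [swapSign, if_neg (by tauto), zero_add, swap_apply_of_ne_of_ne h1 h2]

theorem sum_swapSign_of_mem {O : Finset α} (hij : i ≠ j) (hi : i ∈ O) (hj : j ∈ O) :
    ∑ y ∈ O, swapSign s i j δ y = ∑ y ∈ O, s y := by
  have h2 : j ∈ O.erase i := Finset.mem_erase.mpr ⟨hij.symm, hj⟩
  rw [← Finset.add_sum_erase _ _ hi, ← Finset.add_sum_erase _ _ h2,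
    ← Finset.add_sum_erase _ s hi, ← Finset.add_sum_erase _ s h2, sum_swapSign_of_notMem (by simp)
    (by simp)]
  simp only [swapSign, true_or, or_true, if_true, swap_apply_left, swap_apply_right]
  linear_combination CharTwo.add_self_eq_zero δ

theorem flag_add_flag_of_split (hij : i ≠ j) (h : σ.SameCycle i j) :
    flag (σ * swap i j) (swapSign s i j δ) i + flag (σ * swap i j) (swapSign s i j δ) j =
      flag σ s i := by
  rw [flag, flag, flag, ← sum_swapSign_of_mem (δ := δ) hij (mem_orb_self σ i) (mem_orb.mpr h),
    orb_union_of_sameCycle hij h,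
    Finset.sum_union (orb_disjoint (not_sameCycle_mul_swap hij h))]

theorem flag_of_join (h : ¬ σ.SameCycle i j) :
    flag (σ * swap i j) (swapSign s i j δ) i = flag σ s i + flag σ s j := by
  have hij : i ≠ j := fun h' => h (h' ▸ SameCycle.refl σ i)
  rw [flag, flag, flag, sum_swapSign_of_mem hij (mem_orb_self _ i)
    (mem_orb.mpr (sameCycle_mul_swap h)), orb_union_of_not_sameCycle h,
    Finset.sum_union (orb_disjoint h)]

theorem flag_mul_swap_of_notMem {x : α} (hi : i ∉ orb σ x) (hj : j ∉ orb σ x) :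
    flag (σ * swap i j) (swapSign s i j δ) x = flag σ s x := by
  rw [flag, flag, orb_mul_swap_of_notMem hi hj, sum_swapSign_of_notMem hi hj]

theorem flag_split_right (hij : i ≠ j) (h : σ.SameCycle i j) :
    flag (σ * swap i j) (swapSign s i j δ) j =
      flag (σ * swap i j) (swapSign s i j 0) j + δ := by
  have hi : i ∉ (orb (σ * swap i j) j).erase j := fun h' =>
    not_sameCycle_mul_swap hij h (mem_orb.mp (Finset.mem_of_mem_erase h')).symm
  rw [flag, flag, ← Finset.add_sum_erase _ _ (mem_orb_self (σ * swap i j) j),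
    ← Finset.add_sum_erase _ (swapSign s i j 0) (mem_orb_self (σ * swap i j) j),
    sum_swapSign_of_notMem hi (by simp), sum_swapSign_of_notMem hi (by simp)]
  simp only [swapSign, or_true, if_true]
  ring

theorem numPaired_split (hij : i ≠ j) (h : σ.SameCycle i j) :
    numPaired (σ * swap i j) (swapSign s i j δ) + (if flag σ s i = 0 then 1 else 0) =
      numPaired σ s + (if flag (σ * swap i j) (swapSign s i j δ) i = 0 then 1 else 0) +
        (if flag (σ * swap i j) (swapSign s i j δ) j = 0 then 1 else 0) :=
  sum_orbs_add_swap hij h (fun O => if ∑ y ∈ O, s y = 0 then 1 else 0)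
    (fun O => if ∑ y ∈ O, swapSign s i j δ y = 0 then 1 else 0)
    fun O hi hj => by simp only [sum_swapSign_of_notMem hi hj]

theorem numPaired_join (h : ¬ σ.SameCycle i j) :
    numPaired (σ * swap i j) (swapSign s i j δ) + (if flag σ s i = 0 then 1 else 0) +
      (if flag σ s j = 0 then 1 else 0) =
      numPaired σ s + (if flag σ s i + flag σ s j = 0 then 1 else 0) := by
  rw [← flag_of_join (δ := δ) h]
  exact sum_orbs_add_swap_of_not h (fun O => if ∑ y ∈ O, s y = 0 then 1 else 0)
    (fun O => if ∑ y ∈ O, swapSign s i j δ y = 0 then 1 else 0)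
    fun O hi hj => by simp only [sum_swapSign_of_notMem hi hj]

theorem flag_add_single (s : α → ZMod 2) (i x : α) :
    flag σ (fun y => (if y = i then 1 else 0) + s y) x =
      (if σ.SameCycle i x then 1 else 0) + flag σ s x := by
  rw [flag, flag, Finset.sum_add_distrib, Finset.sum_ite_eq']
  simp only [mem_orb, sameCycle_comm]

theorem numPaired_add_single (σ : Perm α) (s : α → ZMod 2) (i : α) :
    numPaired σ (fun y => (if y = i then 1 else 0) + s y) + (if flag σ s i = 0 then 1 else 0) =
      numPaired σ s + (if flag σ s i = 1 then 1 else 0) := by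
  unfold numPaired
  rw [← Finset.add_sum_erase _ _ (orb_mem_orbs σ i), ← Finset.add_sum_erase _
    (fun O => if ∑ y ∈ O, s y = 0 then 1 else 0) (orb_mem_orbs σ i)]
  have h1 : ∑ O ∈ (orbs σ).erase (orb σ i),
      (if ∑ y ∈ O, ((if y = i then 1 else 0) + s y) = 0 then 1 else 0) =
      ∑ O ∈ (orbs σ).erase (orb σ i), (if ∑ y ∈ O, s y = 0 then 1 else 0) := by
    refine Finset.sum_congr rfl fun O hO => ?_
    rw [Finset.sum_add_distrib, Finset.sum_ite_eq', if_neg (notMem_of_mem_orbs_erase hO), zero_add]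
  have h2 := flag_add_single (σ := σ) s i i
  rw [if_pos (SameCycle.refl σ i)] at h2
  change (if flag σ _ i = 0 then 1 else 0) + _ + _ = (if flag σ s i = 0 then 1 else 0) + _ + _
  rw [h1, h2]
  have h3 : (1 + flag σ s i = 0) ↔ flag σ s i = 1 := by
    generalize flag σ s i = e; revert e; decide
  simp only [h3]
  ring

theorem numPaired_le_card (σ : Perm α) (s : α → ZMod 2) : numPaired σ s ≤ (orbs σ).card := by
  rw [Finset.card_eq_sum_ones]
  exact Finset.sum_le_sum fun O _ => by split_ifs <;> simp

theorem card_orbs_le (σ : Perm α) : (orbs σ).card ≤ Fintype.card α := Finset.card_image_le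

theorem numPaired_of_flags (h : ∀ x, flag σ s x = 0) : numPaired σ s = (orbs σ).card := by
  rw [Finset.card_eq_sum_ones]
  refine Finset.sum_congr rfl fun O hO => ?_
  obtain ⟨x, _, rfl⟩ := Finset.mem_image.mp hO
  exact if_pos (h x)

theorem orb_one (x : α) : orb (1 : Perm α) x = {x} := by
  ext y; rw [mem_orb, sameCycle_one, Finset.mem_singleton, eq_comm]

theorem flag_one (s : α → ZMod 2) (x : α) : flag (1 : Perm α) s x = s x := by
  rw [flag, orb_one, Finset.sum_singleton]

theorem numPaired_one : numPaired (1 : Perm α) (fun _ => 0) = Fintype.card α := by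
  rw [numPaired_of_flags fun x => flag_one _ x, orbs, Finset.card_image_of_injective,
    Finset.card_univ]
  intro x y h
  simpa [orb_one] using h

theorem eq_one_of_numPaired (h : numPaired σ s = Fintype.card α) : σ = 1 ∧ ∀ x, s x = 0 := by
  have h1 : (orbs σ).card = Fintype.card α :=
    le_antisymm (card_orbs_le σ) (h ▸ numPaired_le_card σ s)
  have h2 : Set.InjOn (orb σ) (Finset.univ : Finset α) := Finset.card_image_iff.mp h1
  have h3 : σ = 1 := by
    ext x
    refine h2 (by simp) (by simp) ?_
    rw [Perm.one_apply, orb_eq_iff, sameCycle_apply_left]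
  refine ⟨h3, fun x => ?_⟩
  by_contra hx
  have h4 : numPaired σ s < (orbs σ).card := by
    rw [Finset.card_eq_sum_ones]
    refine Finset.sum_lt_sum (fun O _ => by split_ifs <;> simp) ⟨orb σ x, orb_mem_orbs σ x, ?_⟩
    change (if flag σ s x = 0 then 1 else 0) < 1
    rw [h3, flag_one, if_neg hx]; simp
  omega

/-- Unless all orbits are paired and trivial, the number of paired orbits can be increased. -/
theorem exists_numPaired_succ (h : ¬ (σ = 1 ∧ ∀ x, s x = 0)) :
    (∃ i, numPaired σ (fun y => (if y = i then 1 else 0) + s y) = numPaired σ s + 1) ∨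
    ∃ i j δ, i ≠ j ∧ numPaired (σ * swap i j) (swapSign s i j δ) = numPaired σ s + 1 := by
  by_cases h1 : ∃ i, flag σ s i = 1
  · obtain ⟨i, hi⟩ := h1
    refine Or.inl ⟨i, ?_⟩
    have := numPaired_add_single σ s i
    rw [hi] at this
    simpa using this
  · push Not at h1
    have h2 : ∀ i, flag σ s i = 0 := by
      intro i
      have := h1 i
      revert this
      generalize flag σ s i = e; revert e; decide
    have h3 : σ ≠ 1 := by
      rintro rfl
      exact h ⟨rfl, fun x => by rw [← flag_one s x, h2]⟩
    obtain ⟨i, hi⟩ : ∃ i, σ i ≠ i := by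
      by_contra! h'
      exact h3 (Equiv.ext h')
    have hs : σ.SameCycle i (σ i) := sameCycle_apply_right.mpr (SameCycle.refl σ i)
    refine Or.inr ⟨i, σ i, flag (σ * swap i (σ i)) (swapSign s i (σ i) 0) (σ i), hi.symm, ?_⟩
    set δ := flag (σ * swap i (σ i)) (swapSign s i (σ i) 0) (σ i) with hδ
    have e1 := flag_split_right (s := s) (δ := δ) hi.symm hs
    have e2 := flag_add_flag_of_split (s := s) (δ := δ) hi.symm hs
    have e3 := numPaired_split (s := s) (δ := δ) hi.symm hs
    rw [← hδ, CharTwo.add_self_eq_zero] at e1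
    rw [e1, h2, add_zero] at e2
    rw [e1, e2, h2] at e3
    simpa using e3

end Flags

/-! ### Signed permutations as permutations with signs -/

section Signed

open Equiv

variable {n : ℕ}

namespace SignedSet

/-- The element `i + 1` of `{±1, …, ±n}`. -/
def emb (i : Fin n) : SignedSet n := ⟨(i : ℤ) + 1, by
  have := i.2
  simp only [Finset.mem_erase, Finset.mem_Icc]
  omega⟩

/-- The index of `|x|`. -/
def idx (x : SignedSet n) : Fin n := ⟨(x : ℤ).natAbs - 1, by
  have := x.2
  simp only [Finset.mem_erase, Finset.mem_Icc] at this
  omega⟩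

/-- The sign of `x`. -/
def sgn (x : SignedSet n) : ZMod 2 := if 0 < (x : ℤ) then 0 else 1

/-- Multiplication by a sign. -/
def act (e : ZMod 2) (x : SignedSet n) : SignedSet n := if e = 0 then x else -x

theorem zmod_cases (e : ZMod 2) : e = 0 ∨ e = 1 := by revert e; decide

theorem ne_one_add (e : ZMod 2) : e ≠ 1 + e := by revert e; decide

@[simp] theorem act_zero (x : SignedSet n) : act 0 x = x := if_pos rfl

@[simp] theorem act_one (x : SignedSet n) : act 1 x = -x := if_neg (by decide)

@[simp] theorem act_act (e f : ZMod 2) (x : SignedSet n) : act e (act f x) = act (e + f) x := by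
  rcases zmod_cases e with rfl | rfl <;> rcases zmod_cases f with rfl | rfl <;> simp
  rw [CharTwo.add_self_eq_zero, act_zero]

theorem neg_act (e : ZMod 2) (x : SignedSet n) : -act e x = act (1 + e) x := by
  rw [← act_act, act_one]

@[simp] theorem idx_neg (x : SignedSet n) : idx (-x) = idx x := by
  simp [idx]

@[simp] theorem idx_act (e : ZMod 2) (x : SignedSet n) : idx (act e x) = idx x := by
  rcases zmod_cases e with rfl | rfl <;> simp

@[simp] theorem idx_emb (i : Fin n) : idx (emb i) = i := by
  ext; simp only [idx, emb]; omega

@[simp] theorem sgn_emb (i : Fin n) : sgn (emb i) = 0 := by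
  rw [sgn, if_pos]; simp only [emb]; omega

theorem sgn_neg (x : SignedSet n) : sgn (-x) = 1 + sgn x := by
  have := coe_ne_zero x
  simp only [sgn, coe_neg]
  split_ifs
  · omega
  · decide
  · simp
  · omega

@[simp] theorem sgn_act (e : ZMod 2) (x : SignedSet n) : sgn (act e x) = e + sgn x := by
  rcases zmod_cases e with rfl | rfl <;> simp [sgn_neg]

theorem act_sgn_emb_idx (x : SignedSet n) : act (sgn x) (emb (idx x)) = x := by
  have h0 := coe_ne_zero x
  rw [sgn]
  split_ifs with h
  · rw [act_zero]
    ext; simp only [emb, idx]; omega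
  · rw [act_one]
    ext; rw [coe_neg]; simp only [emb, idx]; omega

theorem ext_idx_sgn {x y : SignedSet n} (h1 : idx x = idx y) (h2 : sgn x = sgn y) : x = y := by
  rw [← act_sgn_emb_idx x, h1, h2, act_sgn_emb_idx]

theorem act_eq_act_iff {e f : ZMod 2} {x : SignedSet n} : act e x = act f x ↔ e = f := by
  refine ⟨fun h => ?_, fun h => by rw [h]⟩
  have := congrArg sgn h
  rwa [sgn_act, sgn_act, add_left_inj] at this

end SignedSet

open SignedSet

theorem SignedPerm.apply_act (w : SignedPerm n) (e : ZMod 2) (x : SignedSet n) :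
    w.1 (act e x) = act e (w.1 x) := by
  rcases zmod_cases e with rfl | rfl
  · simp
  · simp [SignedPerm.apply_neg]

theorem SignedPerm.idx_apply (w : SignedPerm n) (x : SignedSet n) :
    idx (w.1 x) = idx (w.1 (emb (idx x))) := by
  conv_lhs => rw [← act_sgn_emb_idx x, w.apply_act, idx_act]

/-- The permutation of the absolute values. -/
def absPerm (w : SignedPerm n) : Perm (Fin n) where
  toFun i := idx (w.1 (emb i))
  invFun i := idx ((w⁻¹).1 (emb i))
  left_inv i := by
    change idx ((w⁻¹).1 (emb (idx (w.1 (emb i))))) = i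
    rw [← SignedPerm.idx_apply w⁻¹]
    change idx (w.1⁻¹ (w.1 (emb i))) = i
    simp
  right_inv i := by
    change idx (w.1 (emb (idx ((w⁻¹).1 (emb i))))) = i
    rw [← SignedPerm.idx_apply w]
    change idx (w.1 (w.1⁻¹ (emb i))) = i
    simp

/-- The signs of the values of a signed permutation. -/
def signs (w : SignedPerm n) (i : Fin n) : ZMod 2 := sgn (w.1 (emb i))

theorem SignedPerm.apply_emb (w : SignedPerm n) (i : Fin n) :
    w.1 (emb i) = act (signs w i) (emb (absPerm w i)) := (act_sgn_emb_idx _).symm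

theorem SignedPerm.apply_act_emb (w : SignedPerm n) (e : ZMod 2) (i : Fin n) :
    w.1 (act e (emb i)) = act (e + signs w i) (emb (absPerm w i)) := by
  rw [w.apply_act, w.apply_emb, act_act]

theorem absPerm_mul (w t : SignedPerm n) : absPerm (w * t) = absPerm w * absPerm t := by
  ext1 i
  change idx (w.1 (t.1 (emb i))) = _
  rw [t.apply_emb, w.apply_act_emb]; simp

theorem signs_mul (w t : SignedPerm n) (i : Fin n) :
    signs (w * t) i = signs t i + signs w (absPerm t i) := by
  change sgn (w.1 (t.1 (emb i))) = _
  rw [t.apply_emb, w.apply_act_emb]; simp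

theorem absPerm_one : absPerm (1 : SignedPerm n) = 1 := by
  ext1 i
  change idx (emb i) = i
  simp

theorem signs_one : signs (1 : SignedPerm n) = fun _ => 0 := by
  ext1 i
  change sgn (emb i) = 0
  simp

theorem SignedPerm.ext_signs {w t : SignedPerm n} (h1 : absPerm w = absPerm t)
    (h2 : ∀ i, signs w i = signs t i) : w = t := by
  refine Subtype.ext (Equiv.ext fun x => ?_)
  rw [← act_sgn_emb_idx x, w.apply_act_emb, t.apply_act_emb, h1, h2]

/-- The signed permutation with given absolute values and signs. -/
def SignedPerm.ofSigns (σ : Perm (Fin n)) (s : Fin n → ZMod 2) : SignedPerm n :=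
  ⟨{ toFun := fun x => act (sgn x + s (idx x)) (emb (σ (idx x)))
     invFun := fun x => act (sgn x + s (σ⁻¹ (idx x))) (emb (σ⁻¹ (idx x)))
     left_inv := fun x => ext_idx_sgn (by simp) (by
        simp [add_assoc, CharTwo.add_self_eq_zero])
     right_inv := fun x => ext_idx_sgn (by simp) (by
        simp [add_assoc, CharTwo.add_self_eq_zero]) },
    fun x => by
      change act (sgn (-x) + s (idx (-x))) (emb (σ (idx (-x)))) =
        -act (sgn x + s (idx x)) (emb (σ (idx x)))
      rw [sgn_neg, idx_neg, neg_act, add_assoc]⟩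

theorem SignedPerm.ofSigns_apply (σ : Perm (Fin n)) (s : Fin n → ZMod 2) (x : SignedSet n) :
    (ofSigns σ s).1 x = act (sgn x + s (idx x)) (emb (σ (idx x))) := rfl

@[simp] theorem absPerm_ofSigns (σ : Perm (Fin n)) (s : Fin n → ZMod 2) :
    absPerm (SignedPerm.ofSigns σ s) = σ := by
  ext1 i
  change idx ((SignedPerm.ofSigns σ s).1 (emb i)) = _
  rw [SignedPerm.ofSigns_apply]; simp

@[simp] theorem signs_ofSigns (σ : Perm (Fin n)) (s : Fin n → ZMod 2) :
    signs (SignedPerm.ofSigns σ s) = s := by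
  ext1 i
  change sgn ((SignedPerm.ofSigns σ s).1 (emb i)) = _
  rw [SignedPerm.ofSigns_apply]; simp

/-- The reflection `[i]`. -/
def flipAt (i : Fin n) : SignedPerm n := SignedPerm.ofSigns 1 fun x => if x = i then 1 else 0

/-- The reflection `((i j))` or `((i -j))`. -/
def signedSwap (i j : Fin n) (δ : ZMod 2) : SignedPerm n :=
  SignedPerm.ofSigns (swap i j) fun x => if x = i ∨ x = j then δ else 0

theorem absPerm_mul_flipAt (w : SignedPerm n) (i : Fin n) :
    absPerm (w * flipAt i) = absPerm w := by
  rw [absPerm_mul, flipAt, absPerm_ofSigns, mul_one]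

theorem signs_mul_flipAt (w : SignedPerm n) (i : Fin n) :
    signs (w * flipAt i) = fun x => (if x = i then 1 else 0) + signs w x := by
  ext1 x
  rw [signs_mul, flipAt, absPerm_ofSigns, signs_ofSigns, Perm.one_apply]

theorem absPerm_mul_signedSwap (w : SignedPerm n) (i j : Fin n) (δ : ZMod 2) :
    absPerm (w * signedSwap i j δ) = absPerm w * swap i j := by
  rw [absPerm_mul, signedSwap, absPerm_ofSigns]

theorem signs_mul_signedSwap (w : SignedPerm n) (i j : Fin n) (δ : ZMod 2) :
    signs (w * signedSwap i j δ) = swapSign (signs w) i j δ := by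
  ext1 x
  rw [signs_mul, signedSwap, absPerm_ofSigns, signs_ofSigns, swapSign]

theorem coe_flipAt (e : ZMod 2) (i : Fin n) :
    (flipAt i : SignedPerm n).1 = zeroCycle [act e (emb i)] := by
  rw [zeroCycle_singleton]
  ext1 x
  rw [flipAt, SignedPerm.ofSigns_apply, Perm.one_apply, neg_act]
  rw [← act_sgn_emb_idx x]
  generalize sgn x = f
  generalize idx x = k
  simp only [idx_act, idx_emb, sgn_act, sgn_emb, add_zero]
  by_cases hk : k = i
  · subst hk
    rw [if_pos rfl]
    by_cases hf : f = e
    · subst hf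
      rw [swap_apply_left, add_comm]
    · have hf : f = 1 + e := by revert f e; decide
      subst hf
      rw [swap_apply_right]
      congr 1
      revert e; decide
  · rw [if_neg hk, add_zero, swap_apply_of_ne_of_ne]
    · exact fun h => hk (by simpa using congrArg idx h)
    · exact fun h => hk (by simpa using congrArg idx h)

theorem coe_signedSwap (e f : ZMod 2) {i j : Fin n} (hij : i ≠ j) :
    (signedSwap i j (e + f) : SignedPerm n).1 = pairedCycle [act e (emb i), act f (emb j)] := by
  rw [pairedCycle_pair]
  have hne : ∀ (a b : ZMod 2) (k l : Fin n), k ≠ l → act a (emb k) ≠ act b (emb l) :=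
    fun a b k l hkl h => hkl (by simpa using congrArg idx h)
  ext1 x
  rw [signedSwap, SignedPerm.ofSigns_apply, neg_act, neg_act, Perm.mul_apply]
  rw [← act_sgn_emb_idx x]
  generalize sgn x = g
  generalize idx x = k
  simp only [idx_act, idx_emb, sgn_act, sgn_emb, add_zero]
  by_cases hk : k = i
  · subst hk
    rw [if_pos (Or.inl rfl), swap_apply_left]
    by_cases hg : g = e
    · subst hg
      rw [swap_apply_of_ne_of_ne (fun h => ?_) (hne _ _ _ _ hij), swap_apply_left]
      · congr 1; revert g f; decide
      · exact ne_one_add _ (act_eq_act_iff.mp h)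
    · have hg : g = 1 + e := by revert g e; decide
      subst hg
      rw [swap_apply_left, swap_apply_of_ne_of_ne (hne _ _ _ _ hij.symm) (fun h => ?_)]
      · congr 1; revert e f; decide
      · exact ne_one_add _ (act_eq_act_iff.mp h).symm
  · by_cases hk2 : k = j
    · subst hk2
      rw [if_pos (Or.inr rfl), swap_apply_right]
      by_cases hg : g = f
      · subst hg
        rw [swap_apply_of_ne_of_ne (hne _ _ _ _ hij.symm) (fun h => ?_), swap_apply_right]
        · congr 1; revert g e; decide
        · exact ne_one_add _ (act_eq_act_iff.mp h)
      · have hg : g = 1 + f := by revert g f; decide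
        subst hg
        rw [swap_apply_right, swap_apply_of_ne_of_ne (fun h => ?_) (hne _ _ _ _ hij)]
        · congr 1; revert e f; decide
        · exact ne_one_add _ (act_eq_act_iff.mp h).symm
    · rw [if_neg (by tauto), add_zero, swap_apply_of_ne_of_ne hk hk2,
        swap_apply_of_ne_of_ne (hne _ _ _ _ hk) (hne _ _ _ _ hk2),
        swap_apply_of_ne_of_ne (hne _ _ _ _ hk) (hne _ _ _ _ hk2)]

theorem mem_transpositions_iff {t : SignedPerm n} : t ∈ transpositions n ↔
    (∃ i, t = flipAt i) ∨ ∃ i j δ, i ≠ j ∧ t = signedSwap i j δ := by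
  constructor
  · rintro (⟨a, ha⟩ | ⟨a, b, h1, h2, hab⟩)
    · refine Or.inl ⟨idx a, Subtype.ext ?_⟩
      rw [coe_flipAt (sgn a), act_sgn_emb_idx, ha]
    · have hne : idx a ≠ idx b := by
        intro h
        rcases eq_or_ne (sgn a) (sgn b) with h' | h'
        · exact h1 (ext_idx_sgn h h')
        · refine h2 (ext_idx_sgn (by simpa using h) ?_)
          rw [sgn_neg]
          revert h'
          generalize sgn a = e
          generalize sgn b = f
          revert e f; decide
      refine Or.inr ⟨idx a, idx b, sgn a + sgn b, hne, Subtype.ext ?_⟩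
      rw [coe_signedSwap _ _ hne, act_sgn_emb_idx, act_sgn_emb_idx, hab]
  · rintro (⟨i, rfl⟩ | ⟨i, j, δ, hij, rfl⟩)
    · exact Or.inl ⟨emb i, by rw [coe_flipAt 0, act_zero]⟩
    · refine Or.inr ⟨emb i, act δ (emb j), fun h => hij ?_, fun h => hij ?_, ?_⟩
      · simpa using congrArg idx h
      · simpa using congrArg idx h
      · have := coe_signedSwap 0 δ hij
        rwa [zero_add, act_zero] at this

theorem mem_weylD_iff (w : SignedPerm n) : w ∈ weylD n ↔ ∑ i, signs w i = 0 := by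
  change Even (negatedSet w).card ↔ _
  have h1 : negatedSet w = (Finset.univ.filter fun i => signs w i = 1).map
      ⟨emb, fun i j h => by simpa using congrArg idx h⟩ := by
    ext x
    simp only [negatedSet, positives, Finset.mem_filter, Finset.mem_univ, true_and,
      Finset.mem_map]
    have hs : ∀ y : SignedSet n, sgn y = 1 ↔ (y : ℤ) < 0 := by
      intro y
      have := coe_ne_zero y
      rw [sgn]
      split_ifs with h
      · simp; omega
      · simp; omega
    constructor
    · rintro ⟨h1, h2⟩
      have h3 : emb (idx x) = x := by
        have := act_sgn_emb_idx x
        rwa [sgn, if_pos h1, act_zero] at this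
      refine ⟨idx x, ?_, h3⟩
      rw [signs, h3, hs]; exact h2
    · rintro ⟨i, hi, rfl⟩
      refine ⟨?_, (hs _).mp hi⟩
      change (0 : ℤ) < (i : ℤ) + 1
      omega
  have h2 : ∑ i, signs w i = ((Finset.univ.filter fun i => signs w i = 1).card : ZMod 2) := by
    rw [Finset.card_filter]
    push_cast
    refine Finset.sum_congr rfl fun i _ => ?_
    rcases zmod_cases (signs w i) with h | h <;> rw [h] <;> simp
  rw [h1, Finset.card_map, h2, ZMod.natCast_eq_zero_iff_even]

theorem signedSwap_mem_weylD {i j : Fin n} (hij : i ≠ j) (δ : ZMod 2) :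
    signedSwap i j δ ∈ weylD n := by
  rw [mem_weylD_iff, signedSwap, signs_ofSigns, ← Finset.sum_filter]
  have : (Finset.univ.filter fun x => x = i ∨ x = j) = {i, j} := by ext; simp
  rw [this, Finset.sum_pair hij, CharTwo.add_self_eq_zero]

theorem flipAt_notMem_weylD (i : Fin n) : flipAt i ∉ weylD n := by
  rw [mem_weylD_iff, flipAt, signs_ofSigns]; simp

theorem mem_reflectionsD_iff {t : SignedPerm n} : t ∈ reflectionsD n ↔
    ∃ i j δ, i ≠ j ∧ t = signedSwap i j δ := by
  constructor
  · rintro ⟨h1, h2⟩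
    rcases mem_transpositions_iff.mp h1 with ⟨i, rfl⟩ | h
    · exact absurd h2 (flipAt_notMem_weylD i)
    · exact h
  · rintro ⟨i, j, δ, hij, rfl⟩
    exact ⟨mem_transpositions_iff.mpr (Or.inr ⟨i, j, δ, hij, rfl⟩), signedSwap_mem_weylD hij δ⟩

theorem signedSwap_mul_self (i j : Fin n) (δ : ZMod 2) :
    signedSwap i j δ * signedSwap i j δ = 1 := by
  refine SignedPerm.ext_signs ?_ fun x => ?_
  · rw [absPerm_mul_signedSwap, signedSwap, absPerm_ofSigns, swap_mul_self, absPerm_one]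
  · rw [signs_mul_signedSwap, swapSign, signedSwap, signs_ofSigns, signs_one]
    have h : (swap i j x = i ∨ swap i j x = j) ↔ (x = i ∨ x = j) := by
      rw [swap_apply_eq_iff, swap_apply_eq_iff, swap_apply_left, swap_apply_right, or_comm]
    simp only [h, CharTwo.add_self_eq_zero]

theorem flipAt_mul_self (i : Fin n) : flipAt i * flipAt i = 1 := by
  refine SignedPerm.ext_signs ?_ fun x => ?_
  · rw [absPerm_mul_flipAt, flipAt, absPerm_ofSigns, absPerm_one]
  · rw [signs_mul_flipAt, flipAt, signs_ofSigns, signs_one]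
    exact CharTwo.add_self_eq_zero _

theorem signedSwap_comm (i j : Fin n) (δ : ZMod 2) : signedSwap i j δ = signedSwap j i δ := by
  simp only [signedSwap, swap_comm, or_comm]

theorem mul_self_of_mem_transpositions {t : SignedPerm n} (ht : t ∈ transpositions n) :
    t * t = 1 := by
  rcases mem_transpositions_iff.mp ht with ⟨i, rfl⟩ | ⟨i, j, δ, _, rfl⟩
  · exact flipAt_mul_self i
  · exact signedSwap_mul_self i j δ

/-! ### The absolute length -/

/-- The number of paired nonzero cycles (fixed points included). -/
def pairedCount (w : SignedPerm n) : ℕ := numPaired (absPerm w) (signs w)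

theorem pairedCount_le (w : SignedPerm n) : pairedCount w ≤ n := by
  have := (numPaired_le_card (absPerm w) (signs w)).trans (card_orbs_le _)
  rwa [Fintype.card_fin] at this

theorem pairedCount_one : pairedCount (1 : SignedPerm n) = n := by
  rw [pairedCount, absPerm_one, signs_one, numPaired_one, Fintype.card_fin]

theorem eq_one_of_pairedCount {w : SignedPerm n} (h : pairedCount w = n) : w = 1 := by
  obtain ⟨h1, h2⟩ := eq_one_of_numPaired (h.trans (Fintype.card_fin n).symm)
  refine SignedPerm.ext_signs (by rw [h1, absPerm_one]) fun i => by rw [h2, signs_one]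

theorem pairedCount_mul_le (w : SignedPerm n) {t : SignedPerm n} (ht : t ∈ transpositions n) :
    pairedCount (w * t) ≤ pairedCount w + 1 := by
  rcases mem_transpositions_iff.mp ht with ⟨i, rfl⟩ | ⟨i, j, δ, hij, rfl⟩
  · have := numPaired_add_single (absPerm w) (signs w) i
    rw [pairedCount, pairedCount, absPerm_mul_flipAt, signs_mul_flipAt]
    split_ifs at this <;> omega
  · rw [pairedCount, pairedCount, absPerm_mul_signedSwap, signs_mul_signedSwap]
    by_cases h : (absPerm w).SameCycle i j
    · have h1 := numPaired_split (s := signs w) (δ := δ) hij h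
      have h2 := flag_add_flag_of_split (s := signs w) (δ := δ) hij h
      split_ifs at h1 <;> first | omega | (exfalso; simp_all)
    · have h1 := numPaired_join (s := signs w) (δ := δ) h
      split_ifs at h1 <;> omega

theorem le_pairedCount_add_length (l : List (SignedPerm n)) (hl : ∀ t ∈ l, t ∈ transpositions n) :
    n ≤ pairedCount l.prod + l.length := by
  induction l using List.reverseRecOn with
  | nil => rw [List.prod_nil, pairedCount_one]; omega
  | append_singleton l t ih =>
    have ht : t ∈ transpositions n := hl t (by simp)
    have h1 := ih fun u hu => hl u (by simp [hu])
    have h2 := pairedCount_mul_le (l.prod * t) ht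
    rw [mul_assoc, mul_self_of_mem_transpositions ht, mul_one] at h2
    rw [List.prod_append, List.prod_singleton, List.length_append, List.length_singleton]
    omega

theorem exists_factorization_length (w : SignedPerm n) :
    ∃ l ∈ factorizations (transpositions n) w, l.length + pairedCount w = n := by
  obtain ⟨k, hk⟩ : ∃ k, k + pairedCount w = n :=
    ⟨n - pairedCount w, Nat.sub_add_cancel (pairedCount_le w)⟩
  induction k generalizing w with
  | zero =>
    refine ⟨[], ⟨by simp, ?_⟩, hk⟩
    rw [List.prod_nil, eq_one_of_pairedCount (w := w) (by omega)]
  | succ k ih =>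
    obtain ⟨t, ht, htw⟩ : ∃ t ∈ transpositions n, pairedCount (w * t) = pairedCount w + 1 := by
      have hne : ¬ (absPerm w = 1 ∧ ∀ x, signs w x = 0) := by
        rintro ⟨h1, h2⟩
        have : w = 1 := SignedPerm.ext_signs (by rw [h1, absPerm_one])
          fun i => by rw [h2, signs_one]
        rw [this, pairedCount_one] at hk
        omega
      rcases exists_numPaired_succ hne with ⟨i, hi⟩ | ⟨i, j, δ, hij, h⟩
      · refine ⟨flipAt i, mem_transpositions_iff.mpr (Or.inl ⟨i, rfl⟩), ?_⟩
        rwa [pairedCount, absPerm_mul_flipAt, signs_mul_flipAt]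
      · refine ⟨signedSwap i j δ, mem_transpositions_iff.mpr (Or.inr ⟨i, j, δ, hij, rfl⟩), ?_⟩
        rwa [pairedCount, absPerm_mul_signedSwap, signs_mul_signedSwap]
    obtain ⟨l, hl, hl'⟩ := ih (w * t) (by omega)
    refine ⟨l ++ [t], ⟨?_, ?_⟩, ?_⟩
    · intro u hu
      rcases List.mem_append.mp hu with hu | hu
      · exact hl.1 u hu
      · rw [List.mem_singleton.mp hu]; exact ht
    · rw [List.prod_append, List.prod_singleton, hl.2, mul_assoc,
        mul_self_of_mem_transpositions ht, mul_one]
    · rw [List.length_append, List.length_singleton]; omega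

theorem absLength_add_pairedCount (w : SignedPerm n) : absLength w + pairedCount w = n := by
  obtain ⟨l, hl, hl'⟩ := exists_factorization_length w
  obtain ⟨m, hm, hm'⟩ := exists_of_wordLength factorizations_nonempty w
  have h1 : absLength w ≤ l.length := Nat.sInf_le ⟨l, hl, rfl⟩
  have h2 := le_pairedCount_add_length m hm.1
  rw [hm.2, hm'] at h2
  change n ≤ pairedCount w + absLength w at h2
  omega

end Signed

/-! ### Counting words in a finite set of generators -/

section Words

variable {G : Type*} [Group G]

open Classical in
/-- The words of length `k` in `T` with product `g`. -/
noncomputable def words (T : Finset G) : ℕ → G → Finset (List G)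
  | 0, g => if g = 1 then {[]} else ∅
  | k + 1, g => T.biUnion fun t => (words T k (g * t⁻¹)).image fun l => l ++ [t]

theorem mem_words {T : Finset G} {k : ℕ} {g : G} {l : List G} :
    l ∈ words T k g ↔ (∀ t ∈ l, t ∈ T) ∧ l.prod = g ∧ l.length = k := by
  classical
  induction k generalizing g l with
  | zero =>
    rw [words]
    split_ifs with h
    · subst h
      rw [Finset.mem_singleton]
      constructor
      · rintro rfl; simp
      · rintro ⟨_, _, h⟩; exact List.length_eq_zero_iff.mp h
    · simp only [Finset.notMem_empty, false_iff]
      rintro ⟨_, h1, h2⟩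
      rw [List.length_eq_zero_iff.mp h2, List.prod_nil] at h1
      exact h h1.symm
  | succ k ih =>
    rw [words, Finset.mem_biUnion]
    constructor
    · rintro ⟨t, ht, hl⟩
      obtain ⟨m, hm, rfl⟩ := Finset.mem_image.mp hl
      obtain ⟨h1, h2, h3⟩ := ih.mp hm
      refine ⟨fun u hu => ?_, ?_, ?_⟩
      · rcases List.mem_append.mp hu with hu | hu
        · exact h1 u hu
        · rw [List.mem_singleton.mp hu]; exact ht
      · rw [List.prod_append, List.prod_singleton, h2, inv_mul_cancel_right]
      · rw [List.length_append, h3, List.length_singleton]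
    · rintro ⟨h1, h2, h3⟩
      rcases List.eq_nil_or_concat l with rfl | ⟨m, t, rfl⟩
      · simp at h3
      · rw [List.concat_eq_append] at *
        rw [List.prod_append, List.prod_singleton] at h2
        rw [List.length_append, List.length_singleton] at h3
        refine ⟨t, h1 t (by simp), Finset.mem_image.mpr ⟨m, ih.mpr ⟨fun u hu => h1 u (by simp [hu]),
          ?_, by omega⟩, rfl⟩⟩
        rw [← h2, mul_inv_cancel_right]

theorem card_words_succ (T : Finset G) (k : ℕ) (g : G) :
    (words T (k + 1) g).card = ∑ t ∈ T, (words T k (g * t⁻¹)).card := by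
  classical
  rw [words, Finset.card_biUnion]
  · refine Finset.sum_congr rfl fun t _ => ?_
    exact Finset.card_image_of_injective _ fun l m h => List.append_cancel_right h
  · intro t _ u _ htu
    rw [Function.onFun, Finset.disjoint_left]
    intro l hl hl'
    obtain ⟨m, _, rfl⟩ := Finset.mem_image.mp hl
    obtain ⟨m', _, h⟩ := Finset.mem_image.mp hl'
    exact htu (by simpa using (List.append_inj' h rfl).2.symm)

end Words

section Count

open Equiv Equiv.Perm SignedSet

variable {n : ℕ}

/-- The reflections of `D_n`, as a finset. -/
noncomputable def swapFinset (n : ℕ) : Finset (SignedPerm n) :=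
  ((Finset.univ : Finset (Fin n × Fin n × ZMod 2)).filter fun x => x.1 < x.2.1).image
    fun x => signedSwap x.1 x.2.1 x.2.2

theorem mem_swapFinset {t : SignedPerm n} : t ∈ swapFinset n ↔ t ∈ reflectionsD n := by
  rw [mem_reflectionsD_iff, swapFinset, Finset.mem_image]
  constructor
  · rintro ⟨⟨i, j, δ⟩, h, rfl⟩
    exact ⟨i, j, δ, (Finset.mem_filter.mp h).2.ne, rfl⟩
  · rintro ⟨i, j, δ, hij, rfl⟩
    rcases lt_or_gt_of_ne hij with h | h
    · exact ⟨(i, j, δ), by simpa using h, rfl⟩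
    · exact ⟨(j, i, δ), by simpa using h, signedSwap_comm _ _ _⟩

theorem sum_swapFinset (φ : SignedPerm n → ℚ) :
    ∑ t ∈ swapFinset n, φ t =
      ∑ i, ∑ j, if i < j then ∑ δ, φ (signedSwap i j δ) else 0 := by
  rw [swapFinset, Finset.sum_image]
  · rw [Finset.sum_filter, Fintype.sum_prod_type]
    refine Finset.sum_congr rfl fun i _ => ?_
    rw [Fintype.sum_prod_type]
    refine Finset.sum_congr rfl fun j _ => ?_
    dsimp only
    split_ifs <;> simp
  · rintro ⟨i, j, δ⟩ h ⟨i', j', δ'⟩ h' heq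
    have h : i < j := by simpa using h
    have h' : i' < j' := by simpa using h'
    dsimp only at heq
    have h1 := congrArg absPerm heq
    simp only [signedSwap, absPerm_ofSigns] at h1
    have h2 : i = i' ∧ j = j' := by
      have h3 := congrArg (fun σ : Perm (Fin n) => σ i) h1
      simp only [swap_apply_left, swap_apply_def i'] at h3
      split_ifs at h3 with h4 h5
      · exact ⟨h4, h3⟩
      · exact absurd h (not_lt_of_gt (by rw [h5, h3]; exact h'))
      · exact absurd h3 h.ne'
    obtain ⟨rfl, rfl⟩ := h2
    have h3 := congrFun (congrArg signs heq) i
    simp only [signedSwap, signs_ofSigns, true_or, if_true] at h3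
    rw [h3]

theorem two_mul_sum_swapFinset (φ : SignedPerm n → ℚ) :
    2 * ∑ t ∈ swapFinset n, φ t =
      ∑ i, ∑ j ∈ Finset.univ.erase i, ∑ δ, φ (signedSwap i j δ) := by
  rw [two_mul]
  nth_rewrite 2 [sum_swapFinset]
  rw [Finset.sum_comm, sum_swapFinset, ← Finset.sum_add_distrib]
  refine Finset.sum_congr rfl fun i _ => ?_
  rw [← Finset.sum_add_distrib, ← Finset.sum_erase (a := i) _ (by simp)]
  refine Finset.sum_congr rfl fun j hj => ?_
  rcases lt_or_gt_of_ne (Finset.ne_of_mem_erase hj) with h | h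
  · rw [if_neg (not_lt_of_gt h), if_pos h, zero_add]
    exact Finset.sum_congr rfl fun δ _ => by rw [signedSwap_comm]
  · rw [if_neg (not_lt_of_gt h), if_pos h, add_zero]

/-- The number of words of length `k` in the reflections of `D_n` with product `w`. -/
noncomputable def swapCount (k : ℕ) (w : SignedPerm n) : ℚ := (words (swapFinset n) k w).card

theorem two_mul_swapCount_succ (k : ℕ) (w : SignedPerm n) :
    2 * swapCount (k + 1) w =
      ∑ i, ∑ j ∈ Finset.univ.erase i, ∑ δ, swapCount k (w * signedSwap i j δ) := by
  rw [swapCount, card_words_succ]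
  push_cast
  rw [two_mul_sum_swapFinset fun t => ((words (swapFinset n) k (w * t⁻¹)).card : ℚ)]
  refine Finset.sum_congr rfl fun i _ => Finset.sum_congr rfl fun j _ =>
    Finset.sum_congr rfl fun δ _ => ?_
  rw [swapCount, inv_eq_of_mul_eq_one_right (signedSwap_mul_self i j δ)]

theorem swapCount_eq_zero {k : ℕ} {w : SignedPerm n} (h : k + pairedCount w < n) :
    swapCount k w = 0 := by
  rw [swapCount, Nat.cast_eq_zero, Finset.card_eq_zero, Finset.eq_empty_iff_forall_notMem]
  intro l hl
  obtain ⟨h1, h2, h3⟩ := mem_words.mp hl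
  have := le_pairedCount_add_length l fun t ht => (mem_swapFinset.mp (h1 t ht)).1
  rw [h2, h3] at this
  omega

theorem swapCount_zero_one : swapCount 0 (1 : SignedPerm n) = 1 := by
  simp [swapCount, words]

/-! ### Orbit signs under multiplication by a reflection -/

/-- The total sign of the orbit of `x`: `1` for a zero cycle, `0` for a paired nonzero cycle. -/
def orbitSign (w : SignedPerm n) (x : Fin n) : ZMod 2 := flag (absPerm w) (signs w) x

/-- The product of the tree numbers of the orbits. -/
noncomputable def treeWeight (w : SignedPerm n) : ℚ :=
  ∏ O ∈ orbs (absPerm w), treeCoeff O.card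

/-- The length of the orbit of `x`. -/
def orbLen (w : SignedPerm n) (x : Fin n) : ℕ := (orb (absPerm w) x).card

variable {w : SignedPerm n} {i j : Fin n} {δ : ZMod 2}

theorem orbLen_pos (w : SignedPerm n) (x : Fin n) : 0 < orbLen w x := card_orb_pos _ _

theorem orbitSign_eq (h : (absPerm w).SameCycle i j) : orbitSign w i = orbitSign w j :=
  flag_eq_of_sameCycle h

theorem orbLen_eq (h : (absPerm w).SameCycle i j) : orbLen w i = orbLen w j := by
  rw [orbLen, orbLen, orb_eq_iff.mpr h]

theorem exists_split_sign (hij : i ≠ j) (h : (absPerm w).SameCycle i j) :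
    ∃ d, orbitSign (w * signedSwap i j d) j = 0 ∧
      orbitSign (w * signedSwap i j d) i = orbitSign w i ∧
      orbitSign (w * signedSwap i j (d + 1)) j = 1 ∧
      orbitSign (w * signedSwap i j (d + 1)) i = orbitSign w i + 1 := by
  simp only [orbitSign, absPerm_mul_signedSwap, signs_mul_signedSwap]
  set d := flag (absPerm w * swap i j) (swapSign (signs w) i j 0) j with hd
  have e1 := flag_split_right (s := signs w) (δ := d) hij h
  have e2 := flag_split_right (s := signs w) (δ := d + 1) hij h
  have e3 := flag_add_flag_of_split (s := signs w) (δ := d) hij h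
  have e4 := flag_add_flag_of_split (s := signs w) (δ := d + 1) hij h
  rw [← hd, CharTwo.add_self_eq_zero] at e1
  rw [← hd, ← add_assoc, CharTwo.add_self_eq_zero, zero_add] at e2
  rw [e1, add_zero] at e3
  rw [e2] at e4
  refine ⟨d, e1, e3, e2, ?_⟩
  rw [← e4, add_assoc, CharTwo.add_self_eq_zero, add_zero]

theorem sum_zmod_two (F : ZMod 2 → ℚ) (d : ZMod 2) : ∑ δ, F δ = F d + F (d + 1) := by
  have h : (Finset.univ : Finset (ZMod 2)) = {d, d + 1} := by revert d; decide
  rw [h, Finset.sum_pair]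
  revert d; decide

theorem pairedCount_split (hij : i ≠ j) (h : (absPerm w).SameCycle i j) :
    pairedCount (w * signedSwap i j δ) + (if orbitSign w i = 0 then 1 else 0) =
      pairedCount w + (if orbitSign (w * signedSwap i j δ) i = 0 then 1 else 0) +
        (if orbitSign (w * signedSwap i j δ) j = 0 then 1 else 0) := by
  simp only [pairedCount, orbitSign, absPerm_mul_signedSwap, signs_mul_signedSwap]
  exact numPaired_split hij h

theorem pairedCount_join (h : ¬ (absPerm w).SameCycle i j) :
    pairedCount (w * signedSwap i j δ) + (if orbitSign w i = 0 then 1 else 0) +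
      (if orbitSign w j = 0 then 1 else 0) =
      pairedCount w + (if orbitSign w i + orbitSign w j = 0 then 1 else 0) := by
  simp only [pairedCount, orbitSign, absPerm_mul_signedSwap, signs_mul_signedSwap]
  exact numPaired_join h

theorem treeWeight_split (hij : i ≠ j) (h : (absPerm w).SameCycle i j) :
    treeWeight (w * signedSwap i j δ) * treeCoeff (orbLen w i) =
      treeWeight w * treeCoeff (orbLen (w * signedSwap i j δ) i) *
        treeCoeff (orbLen (w * signedSwap i j δ) j) := by
  simp only [treeWeight, orbLen, absPerm_mul_signedSwap]
  exact prod_orbs_mul_swap hij h (fun O => treeCoeff O.card) (fun O => treeCoeff O.card)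
    fun _ _ _ => rfl

theorem orbLen_join (h : ¬ (absPerm w).SameCycle i j) :
    orbLen (w * signedSwap i j δ) i = orbLen w i + orbLen w j := by
  simp only [orbLen, absPerm_mul_signedSwap]
  rw [orb_union_of_not_sameCycle h, Finset.card_union_of_disjoint (orb_disjoint h)]

theorem treeWeight_join (h : ¬ (absPerm w).SameCycle i j) :
    treeWeight (w * signedSwap i j δ) * treeCoeff (orbLen w i) * treeCoeff (orbLen w j) =
      treeWeight w * treeCoeff (orbLen w i + orbLen w j) := by
  rw [← orbLen_join (δ := δ) h]
  simp only [treeWeight, orbLen, absPerm_mul_signedSwap]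
  exact prod_orbs_mul_swap_of_not h (fun O => treeCoeff O.card) (fun O => treeCoeff O.card)
    fun _ _ _ => rfl

theorem orbLen_split (hij : i ≠ j) (h : (absPerm w).SameCycle i j) :
    orbLen (w * signedSwap i j δ) i = orbLen w i - orbLen (w * signedSwap i j δ) j := by
  have := card_orb_add hij h
  simp only [orbLen, absPerm_mul_signedSwap]
  omega

theorem orb_mul_signedSwap {x : Fin n} (hi : ¬ (absPerm w).SameCycle i x)
    (hj : ¬ (absPerm w).SameCycle j x) :
    orb (absPerm (w * signedSwap i j δ)) x = orb (absPerm w) x ∧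
      orbitSign (w * signedSwap i j δ) x = orbitSign w x := by
  have hi' : i ∉ orb (absPerm w) x := fun h => hi (mem_orb.mp h).symm
  have hj' : j ∉ orb (absPerm w) x := fun h => hj (mem_orb.mp h).symm
  simp only [orbitSign, absPerm_mul_signedSwap, signs_mul_signedSwap]
  exact ⟨orb_mul_swap_of_notMem hi' hj', flag_mul_swap_of_notMem hi' hj'⟩

theorem split_cases (hij : i ≠ j) (h : (absPerm w).SameCycle i j) (δ : ZMod 2) (x : Fin n) :
    (absPerm w).SameCycle i x ↔
      (absPerm (w * signedSwap i j δ)).SameCycle i x ∨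
        (absPerm (w * signedSwap i j δ)).SameCycle j x := by
  rw [absPerm_mul_signedSwap, ← mem_orb, ← mem_orb, ← mem_orb, ← Finset.mem_union,
    orb_union_of_sameCycle hij h]

theorem join_cases (h : ¬ (absPerm w).SameCycle i j) (δ : ZMod 2) (x : Fin n) :
    (absPerm (w * signedSwap i j δ)).SameCycle i x ↔
      (absPerm w).SameCycle i x ∨ (absPerm w).SameCycle j x := by
  rw [absPerm_mul_signedSwap, ← mem_orb, ← mem_orb, ← mem_orb, ← Finset.mem_union,
    orb_union_of_not_sameCycle h]

theorem not_sameCycle_split (hij : i ≠ j) (h : (absPerm w).SameCycle i j) :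
    ¬ (absPerm (w * signedSwap i j δ)).SameCycle i j := by
  rw [absPerm_mul_signedSwap]
  exact not_sameCycle_mul_swap hij h

theorem orbitSign_join (h : ¬ (absPerm w).SameCycle i j) :
    orbitSign (w * signedSwap i j δ) i = orbitSign w i + orbitSign w j := by
  simp only [orbitSign, absPerm_mul_signedSwap, signs_mul_signedSwap]
  exact flag_of_join h

theorem orbitSign_split (hij : i ≠ j) (h : (absPerm w).SameCycle i j) :
    orbitSign (w * signedSwap i j δ) i + orbitSign (w * signedSwap i j δ) j = orbitSign w i := by
  simp only [orbitSign, absPerm_mul_signedSwap, signs_mul_signedSwap]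
  exact flag_add_flag_of_split hij h

/-- The zero cycles of `w` are exactly the orbits of `i` and `j`. -/
def IsZeroPair (w : SignedPerm n) (i j : Fin n) : Prop :=
  ¬ (absPerm w).SameCycle i j ∧
    ∀ x, orbitSign w x = 1 ↔ (absPerm w).SameCycle i x ∨ (absPerm w).SameCycle j x

theorem IsZeroPair.symm (h : IsZeroPair w i j) : IsZeroPair w j i :=
  ⟨fun h' => h.1 h'.symm, fun x => (h.2 x).trans or_comm⟩

theorem IsZeroPair.congr_left {k : Fin n} (h : IsZeroPair w i j)
    (hk : (absPerm w).SameCycle i k) : IsZeroPair w k j :=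
  ⟨fun h' => h.1 (hk.trans h'), fun x => (h.2 x).trans
    (or_congr_left ⟨fun h' => hk.symm.trans h', fun h' => hk.trans h'⟩)⟩

theorem IsZeroPair.split_paired {a b : Fin n} (hab : IsZeroPair w a b) (hij : i ≠ j)
    (h : (absPerm w).SameCycle i j) (h0 : orbitSign w i = 0)
    (hi : orbitSign (w * signedSwap i j δ) i = 0) (hj : orbitSign (w * signedSwap i j δ) j = 0) :
    IsZeroPair (w * signedSwap i j δ) a b ∧ orbLen (w * signedSwap i j δ) a = orbLen w a ∧
      orbLen (w * signedSwap i j δ) b = orbLen w b := by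
  have key : ∀ c, orbitSign w c = 1 →
      orb (absPerm (w * signedSwap i j δ)) c = orb (absPerm w) c := by
    intro c hc
    refine (orb_mul_signedSwap ?_ ?_).1
    · intro h'
      rw [← orbitSign_eq h', h0] at hc
      exact absurd hc (by decide)
    · intro h'
      rw [← orbitSign_eq (h.trans h'), h0] at hc
      exact absurd hc (by decide)
  have ha := key a ((hab.2 a).mpr (Or.inl (SameCycle.refl _ _)))
  have hb := key b ((hab.2 b).mpr (Or.inr (SameCycle.refl _ _)))
  refine ⟨⟨?_, fun x => ?_⟩, by rw [orbLen, ha, orbLen], by rw [orbLen, hb, orbLen]⟩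
  · rw [← mem_orb, ha, mem_orb]; exact hab.1
  · rw [← mem_orb (x := a), ← mem_orb (x := b), ha, hb, mem_orb, mem_orb, ← hab.2]
    by_cases hx : (absPerm w).SameCycle i x
    · rw [← orbitSign_eq hx, h0]
      rcases (split_cases hij h δ x).mp hx with hx' | hx'
      · rw [← orbitSign_eq hx', hi]
      · rw [← orbitSign_eq hx', hj]
    · rw [(orb_mul_signedSwap hx fun h' => hx (h.trans h')).2]

theorem IsZeroPair.split_left {b : Fin n} (hib : IsZeroPair w i b) (hij : i ≠ j)
    (h : (absPerm w).SameCycle i j) (hi : orbitSign (w * signedSwap i j δ) i = 1)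
    (hj : orbitSign (w * signedSwap i j δ) j = 0) :
    IsZeroPair (w * signedSwap i j δ) i b ∧ orbLen (w * signedSwap i j δ) b = orbLen w b := by
  have hb := (orb_mul_signedSwap (δ := δ) hib.1 fun h' => hib.1 (h.trans h')).1
  refine ⟨⟨?_, fun x => ?_⟩, by rw [orbLen, hb, orbLen]⟩
  · intro h'
    exact hib.1 ((split_cases hij h δ b).mpr (Or.inl h'))
  · rw [← mem_orb (x := b), hb, mem_orb]
    by_cases hx : (absPerm w).SameCycle i x
    · have hbx : ¬ (absPerm w).SameCycle b x := fun h' => hib.1 (hx.trans h'.symm)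
      rcases (split_cases hij h δ x).mp hx with hx' | hx'
      · rw [← orbitSign_eq hx', hi]
        simp [hx']
      · rw [← orbitSign_eq hx', hj]
        have : ¬ (absPerm (w * signedSwap i j δ)).SameCycle i x := fun h' =>
          not_sameCycle_split hij h (h'.trans hx'.symm)
        simp [this, hbx]
    · have hx' : ¬ (absPerm (w * signedSwap i j δ)).SameCycle i x := fun h' =>
        hx ((split_cases hij h δ x).mpr (Or.inl h'))
      rw [(orb_mul_signedSwap hx fun h' => hx (h.trans h')).2, hib.2]
      simp [hx, hx']

theorem IsZeroPair.join (hij : IsZeroPair w i j) (x : Fin n) :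
    orbitSign (w * signedSwap i j δ) x = 0 := by
  have hi := (hij.2 i).mpr (Or.inl (SameCycle.refl _ _))
  have hj := (hij.2 j).mpr (Or.inr (SameCycle.refl _ _))
  by_cases hx : (absPerm w).SameCycle i x ∨ (absPerm w).SameCycle j x
  · rw [← orbitSign_eq ((join_cases hij.1 δ x).mpr hx), orbitSign_join hij.1, hi, hj]
    decide
  · have h1 := hx
    rw [← hij.2] at hx
    push Not at h1
    rw [(orb_mul_signedSwap h1.1 h1.2).2]
    exact (zmod_cases _).resolve_right hx

/-! ### The number of factorizations -/

theorem sum_erase_eq_split (w : SignedPerm n) (i : Fin n) (F : Fin n → ℚ) :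
    ∑ j ∈ Finset.univ.erase i, F j = ∑ j ∈ (orb (absPerm w) i).erase i, F j +
      ∑ j ∈ Finset.univ.filter (fun j => ¬ (absPerm w).SameCycle i j), F j := by
  rw [← Finset.sum_filter_add_sum_filter_not (Finset.univ.erase i)
    fun j => (absPerm w).SameCycle i j]
  congr 1
  · refine Finset.sum_congr ?_ fun _ _ => rfl
    ext j
    simp only [Finset.mem_filter, Finset.mem_erase, Finset.mem_univ, mem_orb, and_true]
  · refine Finset.sum_congr ?_ fun _ _ => rfl
    ext j
    simp only [Finset.mem_filter, Finset.mem_erase, Finset.mem_univ, and_true, true_and,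
      and_iff_right_iff_imp]
    rintro h rfl
    exact h (SameCycle.refl _ _)

theorem sum_orbLen_split (w : SignedPerm n) (i : Fin n) (F : ℕ → ℚ) (δ : Fin n → ZMod 2) :
    ∑ j ∈ (orb (absPerm w) i).erase i, F (orbLen (w * signedSwap i j (δ j)) j) =
      ∑ a ∈ Finset.Ico 1 (orbLen w i), F a := by
  simp only [orbLen, absPerm_mul_signedSwap]
  exact sum_orb_mul_swap _ _ _

/-- The contribution of an element of a paired nonzero cycle to the recursion. -/
theorem sum_swapCount_paired {k : ℕ} (hk : k + 1 + pairedCount w = n) (hi : orbitSign w i = 0)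
    (Z : ℚ) (hZ : ∀ j δ, i ≠ j → (absPerm w).SameCycle i j →
      orbitSign (w * signedSwap i j δ) i = 0 → orbitSign (w * signedSwap i j δ) j = 0 →
      swapCount k (w * signedSwap i j δ) =
        k.factorial * treeWeight (w * signedSwap i j δ) * Z) :
    ∑ j ∈ Finset.univ.erase i, ∑ δ, swapCount k (w * signedSwap i j δ) =
      2 * k.factorial * treeWeight w * Z * (1 - 1 / orbLen w i) := by
  have hc : (orbLen w i : ℚ) ≠ 0 := by exact_mod_cast (orbLen_pos w i).ne'
  have hg := treeCoeff_ne_zero (orbLen_pos w i)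
  rw [sum_erase_eq_split w]
  have h2 : ∑ j ∈ Finset.univ.filter (fun j => ¬ (absPerm w).SameCycle i j),
      ∑ δ, swapCount k (w * signedSwap i j δ) = 0 := by
    refine Finset.sum_eq_zero fun j hj => Finset.sum_eq_zero fun δ _ => swapCount_eq_zero ?_
    have := pairedCount_join (δ := δ) (Finset.mem_filter.mp hj).2
    rw [hi, zero_add, if_pos rfl] at this
    omega
  have h1 : ∀ j ∈ (orb (absPerm w) i).erase i, ∑ δ, swapCount k (w * signedSwap i j δ) =
      k.factorial * treeWeight w * Z / treeCoeff (orbLen w i) *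
        (treeCoeff (orbLen (w * signedSwap i j 0) j) *
          treeCoeff (orbLen w i - orbLen (w * signedSwap i j 0) j)) := by
    intro j hj
    obtain ⟨hne, hj⟩ := Finset.mem_erase.mp hj
    have hj := mem_orb.mp hj
    obtain ⟨d, d1, d2, d3, d4⟩ := exists_split_sign (Ne.symm hne) hj
    rw [hi] at d2 d4
    have hN := pairedCount_split (δ := d + 1) (Ne.symm hne) hj
    rw [d3, d4, hi] at hN
    have hl : ∀ δ, orbLen (w * signedSwap i j δ) j = orbLen (w * signedSwap i j 0) j := by
      intro δ; simp only [orbLen, absPerm_mul_signedSwap]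
    rw [sum_zmod_two _ d, hZ j d (Ne.symm hne) hj d2 d1, swapCount_eq_zero (w := _ * _), add_zero]
    · have hW := treeWeight_split (δ := d) (Ne.symm hne) hj
      rw [orbLen_split (Ne.symm hne) hj, hl] at hW
      rw [div_mul_eq_mul_div, eq_div_iff hg]
      linear_combination (k.factorial * Z) * hW
    · simp at hN
      omega
  rw [h2, add_zero, Finset.sum_congr rfl h1, ← Finset.mul_sum,
    sum_orbLen_split w i (fun a => treeCoeff a * treeCoeff (orbLen w i - a)) fun _ => 0]
  have h3 := treeCoeff_split (orbLen_pos w i)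
  field_simp
  linear_combination (treeWeight w * Z) * h3

theorem sum_inv_orbLen (w : SignedPerm n) :
    ∑ i, (if orbitSign w i = 0 then (1 : ℚ) / orbLen w i else 0) = pairedCount w := by
  have := sum_orb_comp (absPerm w) fun O => if ∑ y ∈ O, signs w y = 0 then 1 else 0
  rw [pairedCount, numPaired]
  push_cast
  rw [← this]
  refine Finset.sum_congr rfl fun i _ => ?_
  change _ = (if orbitSign w i = 0 then 1 else 0) / (orbLen w i : ℚ)
  split_ifs <;> simp

/-- The number of minimal factorizations of an element without zero cycles. -/
theorem swapCount_of_paired {k : ℕ} (h : ∀ x, orbitSign w x = 0) (hk : k + pairedCount w = n) :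
    swapCount k w = k.factorial * treeWeight w := by
  induction k generalizing w with
  | zero =>
    obtain rfl : w = 1 := eq_one_of_pairedCount (by omega)
    rw [swapCount_zero_one, treeWeight, absPerm_one, Finset.prod_eq_one]
    · simp
    · intro O hO
      obtain ⟨x, _, rfl⟩ := Finset.mem_image.mp hO
      rw [orb_one, Finset.card_singleton, treeCoeff_one]
  | succ k ih =>
    have h2 := two_mul_swapCount_succ k w
    rw [Finset.sum_congr rfl fun i _ => sum_swapCount_paired hk (h i) 1 ?_] at h2
    · rw [← Finset.mul_sum, Finset.sum_sub_distrib] at h2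
      have h3 := sum_inv_orbLen w
      simp only [h, if_true] at h3
      rw [h3, Finset.sum_const, Finset.card_univ, Fintype.card_fin, nsmul_eq_mul] at h2
      have h4 : (n : ℚ) = k + 1 + pairedCount w := by exact_mod_cast hk.symm
      rw [h4] at h2
      rw [Nat.factorial_succ]
      push_cast
      linear_combination h2 / 2
    · intro j δ hij hs h5 h6
      have hN := pairedCount_split (δ := δ) hij hs
      rw [h5, h6, h i] at hN
      simp only [if_true] at hN
      rw [mul_one]
      refine ih (fun x => ?_) (by omega)
      by_cases hx : (absPerm w).SameCycle i x
      · rcases (split_cases hij hs δ x).mp hx with hx' | hx'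
        · rw [← orbitSign_eq hx', h5]
        · rw [← orbitSign_eq hx', h6]
      · rw [(orb_mul_signedSwap hx fun h' => hx (hs.trans h')).2, h]

/-- The contribution of an element of a zero cycle to the recursion. -/
theorem sum_swapCount_zero {k : ℕ} (hk : k + 1 + pairedCount w = n) (b : Fin n)
    (hib : IsZeroPair w i b)
    (ih : ∀ {v : SignedPerm n} {a b : Fin n}, IsZeroPair v a b → k + pairedCount v = n →
      swapCount k v = k.factorial * treeWeight v * annularWeight (orbLen v a) (orbLen v b)) :
    ∑ j ∈ Finset.univ.erase i, ∑ δ, swapCount k (w * signedSwap i j δ) =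
      2 * k.factorial * treeWeight w *
        ((∑ a ∈ Finset.Ico 1 (orbLen w i), treeCoeff a * treeCoeff (orbLen w i - a) *
            annularWeight a (orbLen w b)) / treeCoeff (orbLen w i) +
          orbLen w b * treeCoeff (orbLen w i + orbLen w b) /
            (treeCoeff (orbLen w i) * treeCoeff (orbLen w b))) := by
  have hg := treeCoeff_ne_zero (orbLen_pos w i)
  have hgb := treeCoeff_ne_zero (orbLen_pos w b)
  have hi : orbitSign w i = 1 := (hib.2 i).mpr (Or.inl (SameCycle.refl _ _))
  rw [sum_erase_eq_split w]
  have h2 : ∑ j ∈ Finset.univ.filter (fun j => ¬ (absPerm w).SameCycle i j),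
      ∑ δ, swapCount k (w * signedSwap i j δ) =
      ∑ j ∈ orb (absPerm w) b, 2 * (k.factorial * treeWeight w *
        treeCoeff (orbLen w i + orbLen w b) /
            (treeCoeff (orbLen w i) * treeCoeff (orbLen w b))) := by
    symm
    refine Finset.sum_subset_zero_on_sdiff ?_ ?_ ?_
    · intro j hj
      rw [Finset.mem_filter]
      exact ⟨Finset.mem_univ _, fun h' => hib.1 (h'.trans (mem_orb.mp hj).symm)⟩
    · intro j hj
      rw [Finset.mem_sdiff, Finset.mem_filter, mem_orb] at hj
      have hj0 : orbitSign w j = 0 := by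
        refine (zmod_cases _).resolve_right fun h' => ?_
        rcases (hib.2 j).mp h' with h'' | h''
        · exact hj.1.2 h''
        · exact hj.2 h''
      refine Finset.sum_eq_zero fun δ _ => swapCount_eq_zero ?_
      have := pairedCount_join (δ := δ) hj.1.2
      rw [hi, hj0] at this
      simp at this
      omega
    · intro j hj
      have hj := mem_orb.mp hj
      have hij : IsZeroPair w i j := (hib.symm.congr_left hj).symm
      have hj1 : orbitSign w j = 1 := by rw [hij.2]; exact Or.inr (SameCycle.refl _ _)
      have hterm : ∀ δ, swapCount k (w * signedSwap i j δ) = k.factorial * treeWeight w *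
          treeCoeff (orbLen w i + orbLen w b) /
            (treeCoeff (orbLen w i) * treeCoeff (orbLen w b)) := by
        intro δ
        have hN := pairedCount_join (δ := δ) hij.1
        rw [hi, hj1, if_neg (by decide), if_pos (by decide)] at hN
        rw [swapCount_of_paired hij.join (by omega), eq_div_iff (mul_ne_zero hg hgb)]
        have hW := treeWeight_join (δ := δ) hij.1
        rw [← orbLen_eq hj] at hW
        linear_combination (k.factorial : ℚ) * hW
      rw [sum_zmod_two _ 0, hterm, hterm, two_mul]
  have h1 : ∀ j ∈ (orb (absPerm w) i).erase i, ∑ δ, swapCount k (w * signedSwap i j δ) =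
      k.factorial * treeWeight w / treeCoeff (orbLen w i) *
        (treeCoeff (orbLen (w * signedSwap i j 0) j) *
          treeCoeff (orbLen w i - orbLen (w * signedSwap i j 0) j) *
          annularWeight (orbLen (w * signedSwap i j 0) j) (orbLen w b) +
         treeCoeff (orbLen (w * signedSwap i j 0) j) *
          treeCoeff (orbLen w i - orbLen (w * signedSwap i j 0) j) *
          annularWeight (orbLen w i - orbLen (w * signedSwap i j 0) j) (orbLen w b)) := by
    intro j hj
    obtain ⟨hne, hj⟩ := Finset.mem_erase.mp hj
    have hj := mem_orb.mp hj
    have hij := Ne.symm hne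
    obtain ⟨d, d1, d2, d3, d4⟩ := exists_split_sign hij hj
    rw [hi] at d2 d4
    rw [CharTwo.add_self_eq_zero] at d4
    have hN1 := pairedCount_split (δ := d) hij hj
    have hN2 := pairedCount_split (δ := d + 1) hij hj
    rw [d1, d2, hi] at hN1
    rw [d3, d4, hi] at hN2
    have hl : ∀ δ, orbLen (w * signedSwap i j δ) j = orbLen (w * signedSwap i j 0) j := by
      intro δ; simp only [orbLen, absPerm_mul_signedSwap]
    have z1 := hib.split_left hij hj d2 d1
    have z2 := (hib.congr_left hj).split_left (δ := d + 1) hne hj.symm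
      (by rwa [signedSwap_comm]) (by rwa [signedSwap_comm])
    rw [signedSwap_comm] at z2
    simp at hN1 hN2
    rw [sum_zmod_two _ d, ih z1.1 (by omega), ih z2.1 (by omega), z1.2, z2.2]
    have hW1 := treeWeight_split (δ := d) hij hj
    have hW2 := treeWeight_split (δ := d + 1) hij hj
    rw [orbLen_split hij hj, hl] at hW1 hW2
    rw [orbLen_split hij hj, hl d, hl (d + 1), div_mul_eq_mul_div, eq_div_iff hg]
    linear_combination (k.factorial * annularWeight (orbLen w i -
      orbLen (w * signedSwap i j 0) j) (orbLen w b)) * hW1 + (k.factorial * annularWeight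
      (orbLen (w * signedSwap i j 0) j) (orbLen w b)) * hW2
  rw [h2, Finset.sum_congr rfl h1, ← Finset.mul_sum,
    sum_orbLen_split w i (fun a => treeCoeff a * treeCoeff (orbLen w i - a) *
      annularWeight a (orbLen w b) + treeCoeff a * treeCoeff (orbLen w i - a) *
      annularWeight (orbLen w i - a) (orbLen w b)) fun _ => 0, Finset.sum_add_distrib]
  have h3 : ∑ a ∈ Finset.Ico 1 (orbLen w i), treeCoeff a * treeCoeff (orbLen w i - a) *
      annularWeight (orbLen w i - a) (orbLen w b) =
      ∑ a ∈ Finset.Ico 1 (orbLen w i), treeCoeff a * treeCoeff (orbLen w i - a) *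
      annularWeight a (orbLen w b) := by
    rw [← sum_Ico_reflect_sub]
    refine Finset.sum_congr rfl fun a ha => ?_
    rw [Nat.sub_sub_self (Finset.mem_Ico.mp ha).2.le]; ring
  rw [h3, Finset.sum_const, nsmul_eq_mul]
  change _ + (orbLen w b : ℚ) * _ = _
  field_simp
  ring

/-- The number of minimal factorizations, into reflections of `D_n`, of an element with
two zero cycles. -/
theorem swapCount_of_isZeroPair {k : ℕ} {a b : Fin n} (h : IsZeroPair w a b)
    (hk : k + pairedCount w = n) :
    swapCount k w =
      k.factorial * treeWeight w * annularWeight (orbLen w a) (orbLen w b) := by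
  induction k generalizing w a b with
  | zero =>
    obtain rfl : w = 1 := eq_one_of_pairedCount (by omega)
    have := (h.2 a).mpr (Or.inl (SameCycle.refl _ _))
    rw [orbitSign, absPerm_one, flag_one, signs_one] at this
    exact absurd this zero_ne_one
  | succ k ih =>
    have h2 := two_mul_swapCount_succ k w
    set Z := annularWeight (orbLen w a) (orbLen w b) with hZ
    set A := (∑ x ∈ Finset.Ico 1 (orbLen w a), treeCoeff x * treeCoeff (orbLen w a - x) *
            annularWeight x (orbLen w b)) / treeCoeff (orbLen w a) +
          orbLen w b * treeCoeff (orbLen w a + orbLen w b) /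
            (treeCoeff (orbLen w a) * treeCoeff (orbLen w b)) with hA
    set B := (∑ x ∈ Finset.Ico 1 (orbLen w b), treeCoeff x * treeCoeff (orbLen w b - x) *
            annularWeight x (orbLen w a)) / treeCoeff (orbLen w b) +
          orbLen w a * treeCoeff (orbLen w b + orbLen w a) /
            (treeCoeff (orbLen w b) * treeCoeff (orbLen w a)) with hB
    have hterm : ∀ i ∈ (Finset.univ : Finset (Fin n)),
        ∑ j ∈ Finset.univ.erase i, ∑ δ, swapCount k (w * signedSwap i j δ) =
        2 * k.factorial * treeWeight w * (Z * (1 - (if orbitSign w i = 0 then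
          (1 : ℚ) / orbLen w i else 0)) + (if i ∈ orb (absPerm w) a then A - Z else 0) +
            (if i ∈ orb (absPerm w) b then B - Z else 0)) := by
      intro i _
      by_cases h0 : orbitSign w i = 0
      · have ha : i ∉ orb (absPerm w) a := by
          intro h'
          rw [(h.2 i).mpr (Or.inl (mem_orb.mp h'))] at h0
          exact absurd h0 (by decide)
        have hb : i ∉ orb (absPerm w) b := by
          intro h'
          rw [(h.2 i).mpr (Or.inr (mem_orb.mp h'))] at h0
          exact absurd h0 (by decide)
        rw [sum_swapCount_paired hk h0 Z, if_pos h0, if_neg ha, if_neg hb]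
        · ring
        · intro j δ hij hs h5 h6
          have hN := pairedCount_split (δ := δ) hij hs
          rw [h5, h6, h0] at hN
          simp only [if_true] at hN
          obtain ⟨z1, z2, z3⟩ := h.split_paired hij hs h0 h5 h6
          rw [ih z1 (by omega), z2, z3]
      · have h1 := (zmod_cases _).resolve_left h0
        rw [if_neg h0]
        rcases (h.2 i).mp h1 with hi | hi
        · have hb : i ∉ orb (absPerm w) b := fun h' => h.1 (hi.trans (mem_orb.mp h').symm)
          rw [if_pos (mem_orb.mpr hi), if_neg hb, sum_swapCount_zero hk b (h.congr_left hi) ih,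
            ← orbLen_eq hi, ← hA]
          ring
        · have ha : i ∉ orb (absPerm w) a := fun h' => h.1 ((mem_orb.mp h').trans hi.symm)
          rw [if_neg ha, if_pos (mem_orb.mpr hi), sum_swapCount_zero hk a (h.symm.congr_left hi) ih,
            ← orbLen_eq hi, ← hB]
          ring
    rw [Finset.sum_congr rfl hterm, ← Finset.mul_sum, Finset.sum_add_distrib,
      Finset.sum_add_distrib, ← Finset.mul_sum, Finset.sum_sub_distrib, sum_inv_orbLen,
      Finset.sum_ite_mem, Finset.sum_ite_mem, Finset.univ_inter, Finset.univ_inter,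
      Finset.sum_const, Finset.sum_const, Finset.sum_const, Finset.card_univ, Fintype.card_fin,
      nsmul_eq_mul, nsmul_eq_mul, nsmul_eq_mul] at h2
    change 2 * swapCount (k + 1) w = 2 * k.factorial * treeWeight w *
      (Z * (n * 1 - pairedCount w) + orbLen w a * (A - Z) + orbLen w b * (B - Z)) at h2
    have h4 : (n : ℚ) = k + 1 + pairedCount w := by exact_mod_cast hk.symm
    rw [h4] at h2
    have hga := treeCoeff_ne_zero (orbLen_pos w a)
    have hgb := treeCoeff_ne_zero (orbLen_pos w b)
    have h5 := treeCoeff_annular (orbLen_pos w a) (orbLen_pos w b)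
    have h6 : orbLen w a * A + orbLen w b * B = (orbLen w a + orbLen w b) * Z := by
      rw [hA, hB, add_comm (orbLen w b)]
      simp only [annularWeight_comm _ (orbLen w a)]
      field_simp
      rw [← hZ] at h5
      linear_combination -h5
    rw [Nat.factorial_succ]
    push_cast
    linear_combination h2 / 2 + k.factorial * treeWeight w * h6

end Count

/-! ### Maximal chains and minimal factorizations -/

section Chains

variable {n : ℕ}

theorem absLength_one : absLength (1 : SignedPerm n) = 0 := wordLength_one _

theorem absLength_mul_le (v w : SignedPerm n) : absLength (v * w) ≤ absLength v + absLength w :=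
  wordLength_mul_le factorizations_nonempty v w

theorem absLength_prod_le {l : List (SignedPerm n)} (hl : ∀ t ∈ l, t ∈ transpositions n) :
    absLength l.prod ≤ l.length :=
  Nat.sInf_le ⟨l, ⟨hl, rfl⟩, rfl⟩

theorem absLength_mono {v w : SignedPerm n} (h : v ≤ w) : absLength v ≤ absLength w := by
  have := (absoluteOrder_le_iff v w).mp h
  omega

theorem eq_of_le_of_absLength {v w : SignedPerm n} (h : v ≤ w)
    (h' : absLength v = absLength w) : v = w := by
  have := (absoluteOrder_le_iff v w).mp h
  exact inv_mul_eq_one.mp (eq_one_of_wordLength factorizations_nonempty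
    (show absLength (v⁻¹ * w) = 0 by omega))

theorem one_le_signedPerm (w : SignedPerm n) : 1 ≤ w := by
  rw [absoluteOrder_le_iff, absLength_one, inv_one, one_mul, zero_add]

variable {γ : SignedPerm n} {l : List (SignedPerm n)}

theorem absLength_prod_take (hl : l ∈ minimalFactorizations (transpositions n) γ) {i : ℕ}
    (hi : i ≤ l.length) : absLength (l.take i).prod = i := by
  obtain ⟨⟨h1, h2⟩, h3⟩ := hl
  have a1 := absLength_prod_le (l := l.take i) fun t ht => h1 t (List.mem_of_mem_take ht)
  have a2 := absLength_prod_le (l := l.drop i) fun t ht => h1 t (List.mem_of_mem_drop ht)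
  have a3 := absLength_mul_le (l.take i).prod (l.drop i).prod
  rw [List.prod_take_mul_prod_drop, h2] at a3
  rw [List.length_take] at a1
  rw [List.length_drop] at a2
  change l.length = absLength γ at h3
  omega

theorem prod_take_le (hl : l ∈ minimalFactorizations (transpositions n) γ) {i j : ℕ}
    (hij : i ≤ j) (hj : j ≤ l.length) : (l.take i).prod ≤ (l.take j).prod := by
  rw [absoluteOrder_le_iff, absLength_prod_take hl hj, absLength_prod_take hl (hij.trans hj)]
  have h1 : (l.take j).prod = (l.take i).prod * ((l.take j).drop i).prod := by
    rw [← List.prod_take_mul_prod_drop (l.take j) i, List.take_take, min_eq_left hij]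
  have a1 := absLength_prod_le (l := (l.take j).drop i) fun t ht =>
    hl.1.1 t (List.mem_of_mem_take (List.mem_of_mem_drop ht))
  have a2 := absLength_mul_le (l.take i).prod ((l.take j).drop i).prod
  rw [← h1, absLength_prod_take hl hj, absLength_prod_take hl (hij.trans hj)] at a2
  rw [h1, inv_mul_cancel_left]
  rw [List.length_drop, List.length_take] at a1
  omega

theorem prod_take_mem_Icc (hl : l ∈ minimalFactorizations (transpositions n) γ) {i : ℕ}
    (hi : i ≤ l.length) : (l.take i).prod ∈ Set.Icc 1 γ := by
  refine ⟨one_le_signedPerm _, ?_⟩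
  have := prod_take_le hl hi le_rfl
  rwa [List.take_length, hl.1.2] at this

/-- The set of prefix products of a word. -/
def prefixSet (γ : SignedPerm n) (l : List (SignedPerm n)) : Set (Set.Icc (1 : SignedPerm n) γ) :=
  {x | ∃ i ≤ l.length, (x : SignedPerm n) = (l.take i).prod}

theorem isMaxChain_prefixSet (hl : l ∈ minimalFactorizations (transpositions n) γ) :
    IsMaxChain (· ≤ ·) (prefixSet γ l) := by
  refine ⟨?_, fun s hs hsub => hsub.antisymm fun x hx => ?_⟩
  · rintro x ⟨i, hi, hx⟩ y ⟨j, hj, hy⟩ _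
    rcases le_total i j with h | h
    · left; change x.1 ≤ y.1; rw [hx, hy]; exact prod_take_le hl h hj
    · right; change y.1 ≤ x.1; rw [hx, hy]; exact prod_take_le hl h hi
  · have h1 : absLength x.1 ≤ l.length := (absLength_mono x.2.2).trans_eq hl.2.symm
    refine ⟨absLength x.1, h1, ?_⟩
    have h2 : (⟨_, prod_take_mem_Icc hl h1⟩ : Set.Icc (1 : SignedPerm n) γ) ∈ s :=
      hsub ⟨_, h1, rfl⟩
    have h3 := absLength_prod_take hl h1
    rcases hs.total hx h2 with h | h
    · exact eq_of_le_of_absLength h h3.symm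
    · exact (eq_of_le_of_absLength h h3).symm

/-- The maximal chain of prefix products of a minimal factorization. -/
def prefixFlag (hl : l ∈ minimalFactorizations (transpositions n) γ) :
    Flag (Set.Icc (1 : SignedPerm n) γ) :=
  Flag.ofIsMaxChain _ (isMaxChain_prefixSet hl)

theorem mem_prefixFlag (hl : l ∈ minimalFactorizations (transpositions n) γ)
    {x : Set.Icc (1 : SignedPerm n) γ} :
    x ∈ prefixFlag hl ↔ ∃ i ≤ l.length, (x : SignedPerm n) = (l.take i).prod := Iff.rfl

theorem prefixFlag_injective {l' : List (SignedPerm n)}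
    (hl : l ∈ minimalFactorizations (transpositions n) γ)
    (hl' : l' ∈ minimalFactorizations (transpositions n) γ)
    (h : prefixFlag hl = prefixFlag hl') : l = l' := by
  have hlen : l.length = l'.length := hl.2.trans hl'.2.symm
  have key : ∀ i ≤ l.length, (l.take i).prod = (l'.take i).prod := by
    intro i hi
    have h1 : (⟨_, prod_take_mem_Icc hl hi⟩ : Set.Icc (1 : SignedPerm n) γ) ∈ prefixFlag hl' :=
      h ▸ (mem_prefixFlag hl).mpr ⟨i, hi, rfl⟩
    obtain ⟨j, hj, hij⟩ := (mem_prefixFlag hl').mp h1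
    have h2 := absLength_prod_take hl hi
    have h3 := absLength_prod_take hl' hj
    simp only at hij
    rw [hij, h3] at h2
    rw [hij, h2]
  refine List.ext_getElem hlen fun i hi hi' => ?_
  have h1 := key (i + 1) hi
  rw [List.prod_take_succ _ _ hi, List.prod_take_succ _ _ hi', key i hi.le] at h1
  exact mul_left_cancel h1

theorem exists_mem_flag (C : Flag (Set.Icc (1 : SignedPerm n) γ)) {i : ℕ}
    (hi : i ≤ absLength γ) : ∃ x ∈ C, absLength x.1 = i := by
  induction i with
  | zero =>
    refine ⟨⟨1, le_rfl, one_le_signedPerm γ⟩, ?_, absLength_one⟩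
    exact Flag.mem_iff_forall_le_or_ge.mpr fun b _ => Or.inl b.2.1
  | succ i ih =>
    obtain ⟨x, hx, hxi⟩ := ih (by omega)
    have htop : (⟨γ, one_le_signedPerm γ, le_rfl⟩ : Set.Icc (1 : SignedPerm n) γ) ∈ C :=
      Flag.mem_iff_forall_le_or_ge.mpr fun b _ => Or.inr b.2.2
    have hex : ∃ m, i < m ∧ ∃ y ∈ C, absLength y.1 = m := ⟨absLength γ, hi, _, htop, rfl⟩
    classical
    obtain ⟨him, y, hy, hym⟩ := Nat.find_spec hex
    have hmin : ∀ c ∈ C, i < absLength c.1 → absLength y.1 ≤ absLength c.1 := fun c hc h =>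
      hym ▸ Nat.find_min' hex ⟨h, c, hc, rfl⟩
    rw [← hym] at him
    clear hym
    have hle : ∀ a ∈ C, ∀ b ∈ C, absLength a.1 ≤ absLength b.1 → a ≤ b := by
      intro a ha b hb hab
      rcases C.le_or_le ha hb with h | h
      · exact h
      · have : b.1 = a.1 := eq_of_le_of_absLength h (le_antisymm (absLength_mono h) hab)
        exact (Subtype.ext this).ge
    have hxy := hle x hx y hy (by omega)
    have hxy' := (absoluteOrder_le_iff _ _).mp (show x.1 ≤ y.1 from hxy)
    obtain ⟨l, hl, hl'⟩ := exists_of_wordLength factorizations_nonempty (x.1⁻¹ * y.1)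
    change l.length = absLength (x.1⁻¹ * y.1) at hl'
    rcases l with _ | ⟨t, l⟩
    · simp only [List.length_nil] at hl'; omega
    obtain ⟨h1, h2⟩ := hl
    rw [List.prod_cons] at h2
    rw [List.length_cons] at hl'
    have ht := absLength_prod_le (l := [t]) fun u hu => h1 u (by
      rw [List.mem_singleton.mp hu]; simp)
    rw [List.prod_singleton, List.length_singleton] at ht
    have hlp := absLength_prod_le (l := l) fun u hu => h1 u (by simp [hu])
    have e1 : (x.1 * t)⁻¹ * y.1 = l.prod := by
      rw [mul_inv_rev, mul_assoc, ← h2, inv_mul_cancel_left]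
    have e2 : (x.1)⁻¹ * (x.1 * t) = t := inv_mul_cancel_left _ _
    have h3 := absLength_mul_le x.1 t
    have h4 := absLength_mul_le (x.1 * t) l.prod
    rw [← e1, mul_inv_cancel_left, e1] at h4
    have hxz : x.1 ≤ x.1 * t := by rw [absoluteOrder_le_iff, e2]; omega
    have hzy : x.1 * t ≤ y.1 := by rw [absoluteOrder_le_iff, e1]; omega
    refine ⟨⟨x.1 * t, one_le_signedPerm _, hzy.trans y.2.2⟩, ?_, by change absLength (x.1 * t) = _; omega⟩
    refine Flag.mem_iff_forall_le_or_ge.mpr fun c hc => ?_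
    rcases le_or_gt (absLength c.1) i with h | h
    · exact Or.inr ((show c.1 ≤ x.1 from hle c hc x hx (by omega)).trans hxz)
    · exact Or.inl (hzy.trans (show y.1 ≤ c.1 from hle y hy c hc (hmin c hc h)))

theorem exists_prefixFlag_eq (C : Flag (Set.Icc (1 : SignedPerm n) γ)) :
    ∃ l, ∃ hl : l ∈ minimalFactorizations (transpositions n) γ, prefixFlag hl = C := by
  have hex : ∀ i, ∃ x : Set.Icc (1 : SignedPerm n) γ,
      i ≤ absLength γ → x ∈ C ∧ absLength x.1 = i := by
    intro i
    by_cases hi : i ≤ absLength γ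
    · obtain ⟨x, hx⟩ := exists_mem_flag C hi
      exact ⟨x, fun _ => hx⟩
    · exact ⟨⟨1, le_rfl, one_le_signedPerm γ⟩, fun h => absurd h hi⟩
  choose c hc using hex
  set N := absLength γ with hN
  set t : ℕ → SignedPerm n := fun i => (c i).1⁻¹ * (c (i + 1)).1 with ht
  have h0 : (c 0).1 = 1 := eq_one_of_wordLength factorizations_nonempty (hc 0 (by omega)).2
  have hprod : ∀ i, ((List.range i).map t).prod = (c i).1 := by
    intro i
    induction i with
    | zero => simp [h0]
    | succ i ih =>
      rw [List.range_succ, List.map_append, List.prod_append, ih]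
      simp [ht]
  have hγ : (c N).1 = γ := eq_of_le_of_absLength (c N).2.2 (hc N le_rfl).2
  have htT : ∀ i, i < N → t i ∈ transpositions n := by
    intro i hi
    obtain ⟨h1, h2⟩ := hc i hi.le
    obtain ⟨h3, h4⟩ := hc (i + 1) hi
    have hle : (c i).1 ≤ (c (i + 1)).1 := by
      rcases C.le_or_le h1 h3 with h | h
      · exact h
      · have := absLength_mono (show (c (i + 1)).1 ≤ (c i).1 from h)
        omega
    have h5 := (absoluteOrder_le_iff _ _).mp hle
    obtain ⟨m, hm, hm'⟩ := exists_of_wordLength factorizations_nonempty (t i)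
    change m.length = absLength ((c i).1⁻¹ * (c (i + 1)).1) at hm'
    have h6 : m.length = 1 := by omega
    obtain ⟨u, rfl⟩ := List.length_eq_one_iff.mp h6
    have := hm.2
    rw [List.prod_singleton] at this
    rw [← this]
    exact hm.1 u (by simp)
  have hl : (List.range N).map t ∈ minimalFactorizations (transpositions n) γ := by
    refine ⟨⟨?_, by rw [hprod, hγ]⟩, by simp [hN, absLength]⟩
    intro u hu
    obtain ⟨i, hi, rfl⟩ := List.mem_map.mp hu
    exact htT i (List.mem_range.mp hi)
  refine ⟨_, hl, ?_⟩
  refine Flag.ext ((isMaxChain_prefixSet hl).2 C.chain_le ?_)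
  rintro x ⟨i, hi, hx⟩
  have hi : i ≤ N := by simpa using hi
  rw [← List.map_take, List.take_range, min_eq_left hi, hprod] at hx
  rw [Subtype.ext hx]
  exact (hc i hi).1

end Chains

/-! ### Connectivity along a minimal factorization -/

section Connectivity

open Equiv Equiv.Perm SignedSet

variable {n : ℕ} {w : SignedPerm n}

theorem exists_step {t : SignedPerm n} (ht : t ∈ transpositions n)
    (h : pairedCount (w * t) = pairedCount w + 1) :
    (∃ i, t = flipAt i ∧ orbitSign w i = 1) ∨
    (∃ i j δ, t = signedSwap i j δ ∧ i ≠ j ∧ (absPerm w).SameCycle i j ∧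
      orbitSign (w * t) i = orbitSign w i ∧ orbitSign (w * t) j = 0) ∨
    ∃ i j δ, t = signedSwap i j δ ∧ ¬ (absPerm w).SameCycle i j ∧
      orbitSign w i = 1 ∧ orbitSign w j = 1 := by
  rcases mem_transpositions_iff.mp ht with ⟨i, rfl⟩ | ⟨i, j, δ, hij, rfl⟩
  · refine Or.inl ⟨i, rfl, ?_⟩
    have := numPaired_add_single (absPerm w) (signs w) i
    rw [pairedCount, pairedCount, absPerm_mul_flipAt, signs_mul_flipAt] at h
    by_contra h1
    change ¬ flag _ _ i = 1 at h1
    rw [if_neg h1] at this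
    omega
  · by_cases hs : (absPerm w).SameCycle i j
    · refine Or.inr (Or.inl ?_)
      have h1 := pairedCount_split (δ := δ) hij hs
      have h2 := orbitSign_split (δ := δ) hij hs
      rcases zmod_cases (orbitSign (w * signedSwap i j δ) j) with hj | hj
      · exact ⟨i, j, δ, rfl, hij, hs, by rwa [hj, add_zero] at h2, hj⟩
      · rcases zmod_cases (orbitSign (w * signedSwap i j δ) i) with hi | hi
        · rw [hi, zero_add] at h2
          exact ⟨j, i, δ, signedSwap_comm _ _ _, hij.symm, hs.symm,
            by rw [h2, orbitSign_eq hs], hi⟩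
        · rw [hi, hj] at h1
          simp at h1
          omega
    · refine Or.inr (Or.inr ⟨i, j, δ, rfl, hs, ?_⟩)
      have h1 := pairedCount_join (δ := δ) hs
      rcases zmod_cases (orbitSign w i) with hi | hi <;>
        rcases zmod_cases (orbitSign w j) with hj | hj <;> rw [hi, hj] at h1 <;> simp at h1
      · omega
      · omega
      · omega
      · exact ⟨hi, hj⟩

theorem orbitSign_mul_flipAt (w : SignedPerm n) (i x : Fin n) :
    orbitSign (w * flipAt i) x =
      (if (absPerm w).SameCycle i x then 1 else 0) + orbitSign w x := by
  rw [orbitSign, absPerm_mul_flipAt, signs_mul_flipAt, flag_add_single, orbitSign]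

variable {i j : Fin n} {δ : ZMod 2}

theorem sameCycle_of_split (hij : i ≠ j) (h : (absPerm w).SameCycle i j) {x y : Fin n}
    (hxy : (absPerm (w * signedSwap i j δ)).SameCycle x y) : (absPerm w).SameCycle x y := by
  by_cases hx : (absPerm w).SameCycle i x
  · refine hx.symm.trans ((split_cases hij h δ y).mpr ?_)
    rcases (split_cases hij h δ x).mp hx with h' | h'
    · exact Or.inl (h'.trans hxy)
    · exact Or.inr (h'.trans hxy)
  · have := (orb_mul_signedSwap (δ := δ) hx fun h' => hx (h.trans h')).1
    rwa [← mem_orb, this, mem_orb] at hxy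

theorem orbitSign_of_split_eq_one (hij : i ≠ j) (h : (absPerm w).SameCycle i j)
    (h1 : orbitSign (w * signedSwap i j δ) i = orbitSign w i)
    (h2 : orbitSign (w * signedSwap i j δ) j = 0) {x : Fin n}
    (hx : orbitSign (w * signedSwap i j δ) x = 1) : orbitSign w x = 1 := by
  by_cases hix : (absPerm w).SameCycle i x
  · rw [← orbitSign_eq hix, ← h1]
    rcases (split_cases hij h δ x).mp hix with h' | h'
    · rwa [orbitSign_eq h']
    · rw [← orbitSign_eq h', h2] at hx
      exact absurd hx (by decide)
  · rwa [(orb_mul_signedSwap hix fun h' => hix (h.trans h')).2] at hx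

theorem sameCycle_split_of_eq_one (hij : i ≠ j) (h : (absPerm w).SameCycle i j)
    (h2 : orbitSign (w * signedSwap i j δ) j = 0) {x y : Fin n}
    (hx : orbitSign (w * signedSwap i j δ) x = 1) (hy : orbitSign (w * signedSwap i j δ) y = 1)
    (hxy : (absPerm w).SameCycle x y) : (absPerm (w * signedSwap i j δ)).SameCycle x y := by
  have key : ∀ z, orbitSign (w * signedSwap i j δ) z = 1 → (absPerm w).SameCycle i z →
      (absPerm (w * signedSwap i j δ)).SameCycle i z := by
    intro z hz hiz
    refine ((split_cases hij h δ z).mp hiz).resolve_right fun h' => ?_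
    rw [← orbitSign_eq h', h2] at hz
    exact absurd hz (by decide)
  by_cases hix : (absPerm w).SameCycle i x
  · exact (key x hx hix).symm.trans (key y hy (hix.trans hxy))
  · have := (orb_mul_signedSwap (δ := δ) hix fun h' => hix (h.trans h')).1
    rwa [← mem_orb, this, mem_orb]

/-- No orbit of `w` meets both `P` and its complement. -/
def NonMixing (P : Fin n → Prop) (w : SignedPerm n) : Prop :=
  ∀ i j, (absPerm w).SameCycle i j → (P i ↔ P j)

/-- Some paired nonzero cycle of `w` meets both `P` and its complement. -/
def HasMixedPaired (P : Fin n → Prop) (w : SignedPerm n) : Prop :=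
  ∃ i j, (absPerm w).SameCycle i j ∧ orbitSign w i = 0 ∧ P i ∧ ¬ P j

theorem NonMixing.not_hasMixedPaired {P : Fin n → Prop} (h : NonMixing P w) :
    ¬ HasMixedPaired P w := by
  rintro ⟨i, j, hij, _, hi, hj⟩
  exact hj ((h i j hij).mp hi)

theorem NonMixing.split {P : Fin n → Prop} (hP : NonMixing P w) (hij : i ≠ j)
    (h : (absPerm w).SameCycle i j) : NonMixing P (w * signedSwap i j δ) :=
  fun x y hxy => hP x y (sameCycle_of_split hij h hxy)

theorem pairedCount_of_append {l : List (SignedPerm n)} {t : SignedPerm n}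
    (hl : ∀ u ∈ l ++ [t], u ∈ transpositions n)
    (hn : (l ++ [t]).length + pairedCount (l ++ [t]).prod = n) :
    (l ++ [t]).prod * t = l.prod ∧ pairedCount l.prod = pairedCount (l ++ [t]).prod + 1 ∧
      l.length + pairedCount l.prod = n := by
  have ht : t ∈ transpositions n := hl t (by simp)
  have h0 : (l ++ [t]).prod * t = l.prod := by
    rw [List.prod_append, List.prod_singleton, mul_assoc, mul_self_of_mem_transpositions ht,
      mul_one]
  have h1 := pairedCount_mul_le (l ++ [t]).prod ht
  rw [h0] at h1
  have h2 := le_pairedCount_add_length l fun u hu => hl u (by simp [hu])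
  rw [List.length_append, List.length_singleton] at hn
  exact ⟨h0, by omega, by omega⟩

theorem forall_mem_weylD_of_paired {l : List (SignedPerm n)}
    (hl : ∀ t ∈ l, t ∈ transpositions n) (hn : l.length + pairedCount l.prod = n)
    (h : ∀ x, orbitSign l.prod x = 0) : ∀ t ∈ l, t ∈ weylD n := by
  induction l using List.reverseRecOn with
  | nil => simp
  | append_singleton l t ih =>
    obtain ⟨e1, e2, e3⟩ := pairedCount_of_append hl hn
    have ht : t ∈ transpositions n := hl t (by simp)
    have hl' : ∀ u ∈ l, u ∈ transpositions n := fun u hu => hl u (by simp [hu])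
    rw [← e1] at e2
    rcases exists_step ht e2 with ⟨i, _, hi⟩ | ⟨i, j, δ, rfl, hij, hs, h1, h2⟩ |
      ⟨i, j, δ, _, _, hi, _⟩
    · rw [h] at hi; exact absurd hi (by decide)
    · have := ih hl' e3 fun x => by
        rw [← e1]
        refine (zmod_cases _).resolve_right fun hx => ?_
        have := orbitSign_of_split_eq_one hij hs h1 h2 hx
        rw [h] at this
        exact absurd this (by decide)
      intro u hu
      rcases List.mem_append.mp hu with hu | hu
      · exact this u hu
      · rw [List.mem_singleton.mp hu]; exact signedSwap_mem_weylD hij δ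
    · rw [h] at hi; exact absurd hi (by decide)

theorem not_hasMixedPaired_prefix {P : Fin n → Prop} {l : List (SignedPerm n)}
    (hl : ∀ t ∈ l, t ∈ transpositions n) (hn : l.length + pairedCount l.prod = n)
    (hP : NonMixing P l.prod)
    (h : ∀ x y, orbitSign l.prod x = 1 → orbitSign l.prod y = 1 →
      (absPerm l.prod).SameCycle x y) :
    ∀ m, m <+: l → ¬ HasMixedPaired P m.prod := by
  induction l using List.reverseRecOn with
  | nil =>
    intro m hm
    rw [List.prefix_nil.mp hm]
    exact hP.not_hasMixedPaired
  | append_singleton l t ih =>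
    obtain ⟨e1, e2, e3⟩ := pairedCount_of_append hl hn
    have ht : t ∈ transpositions n := hl t (by simp)
    have hl' : ∀ u ∈ l, u ∈ transpositions n := fun u hu => hl u (by simp [hu])
    rw [← e1] at e2
    suffices H : NonMixing P l.prod ∧ ∀ x y, orbitSign l.prod x = 1 → orbitSign l.prod y = 1 →
        (absPerm l.prod).SameCycle x y by
      intro m hm
      rcases List.prefix_concat_iff.mp hm with rfl | hm
      · exact hP.not_hasMixedPaired
      · exact ih hl' e3 H.1 H.2 m hm
    rw [← e1]
    rcases exists_step ht e2 with ⟨i, rfl, hi⟩ | ⟨i, j, δ, rfl, hij, hs, h1, h2⟩ |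
      ⟨i, j, δ, _, hs, hi, hj⟩
    · refine ⟨?_, fun x y hx _ => ?_⟩
      · intro x y
        rw [absPerm_mul_flipAt]
        exact hP x y
      · exfalso
        rw [orbitSign_mul_flipAt] at hx
        by_cases h' : orbitSign (l ++ [flipAt i]).prod x = 1
        · rw [if_pos (h _ _ hi h'), h'] at hx
          exact absurd hx (by decide)
        · rw [if_neg, zero_add] at hx
          · exact h' hx
          · exact fun hs => h' (by rw [← orbitSign_eq hs, hi])
    · refine ⟨hP.split hij hs, fun x y hx hy => ?_⟩
      exact sameCycle_split_of_eq_one hij hs h2 hx hy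
        (h x y (orbitSign_of_split_eq_one hij hs h1 h2 hx)
          (orbitSign_of_split_eq_one hij hs h1 h2 hy))
    · exact absurd (h i j hi hj) hs

/-- If `w` has one zero cycle inside `P`, one outside, and no orbit meeting both, then a minimal
factorization of `w` lies in `D_n` iff it passes through a paired cycle meeting both sides. -/
theorem forall_mem_weylD_iff {P : Fin n → Prop} {l : List (SignedPerm n)}
    (hl : ∀ t ∈ l, t ∈ transpositions n) (hn : l.length + pairedCount l.prod = n)
    (hP : NonMixing P l.prod) (ha : ∃ a, P a ∧ orbitSign l.prod a = 1)
    (hb : ∃ b, ¬ P b ∧ orbitSign l.prod b = 1)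
    (h : ∀ x y, orbitSign l.prod x = 1 → orbitSign l.prod y = 1 → (P x ↔ P y) →
      (absPerm l.prod).SameCycle x y) :
    (∀ t ∈ l, t ∈ weylD n) ↔ ∃ m, m <+: l ∧ HasMixedPaired P m.prod := by
  induction l using List.reverseRecOn with
  | nil =>
    obtain ⟨a, _, ha⟩ := ha
    rw [List.prod_nil, orbitSign, absPerm_one, flag_one, signs_one] at ha
    exact absurd ha zero_ne_one
  | append_singleton l t ih =>
    obtain ⟨e1, e2, e3⟩ := pairedCount_of_append hl hn
    have ht : t ∈ transpositions n := hl t (by simp)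
    have hl' : ∀ u ∈ l, u ∈ transpositions n := fun u hu => hl u (by simp [hu])
    have hpre : (∃ m, m <+: l ++ [t] ∧ HasMixedPaired P m.prod) ↔
        ∃ m, m <+: l ∧ HasMixedPaired P m.prod := by
      constructor
      · rintro ⟨m, hm, hm'⟩
        rcases List.prefix_concat_iff.mp hm with rfl | hm
        · exact absurd hm' hP.not_hasMixedPaired
        · exact ⟨m, hm, hm'⟩
      · rintro ⟨m, hm, hm'⟩
        exact ⟨m, hm.trans (List.prefix_append _ _), hm'⟩
    have hmem : (∀ u ∈ l ++ [t], u ∈ weylD n) ↔ (∀ u ∈ l, u ∈ weylD n) ∧ t ∈ weylD n := by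
      simp only [List.mem_append, List.mem_singleton, or_imp, forall_and, forall_eq]
    rw [hpre, hmem]
    rw [← e1] at e2
    rcases exists_step ht e2 with ⟨i, rfl, hi⟩ | ⟨i, j, δ, rfl, hij, hs, h1, h2⟩ |
      ⟨i, j, δ, rfl, hs, hi, hj⟩
    · refine iff_of_false (fun h' => flipAt_notMem_weylD i h'.2) ?_
      rintro ⟨m, hm, hm'⟩
      refine not_hasMixedPaired_prefix hl' e3 ?_ ?_ m hm hm'
      · intro x y
        rw [← e1, absPerm_mul_flipAt]
        exact hP x y
      · have key : ∀ x, orbitSign l.prod x = 1 → orbitSign (l ++ [flipAt i]).prod x = 1 ∧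
            ¬ (P i ↔ P x) := by
          intro x hx
          rw [← e1, orbitSign_mul_flipAt] at hx
          have hnot : ¬ (absPerm (l ++ [flipAt i]).prod).SameCycle i x := by
            intro hs
            rw [if_pos hs, ← orbitSign_eq hs, hi] at hx
            exact absurd hx (by decide)
          rw [if_neg hnot, zero_add] at hx
          exact ⟨hx, fun h' => hnot (h i x hi hx h')⟩
        intro x y hx hy
        rw [← e1, absPerm_mul_flipAt]
        have kx := key x hx
        have ky := key y hy
        exact h x y kx.1 ky.1 (by tauto)
    · rw [and_iff_left (signedSwap_mem_weylD hij δ)]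
      have key : ∀ c, orbitSign (l ++ [signedSwap i j δ]).prod c = 1 →
          ∃ c', (P c ↔ P c') ∧ orbitSign l.prod c' = 1 := by
        intro c hc
        rw [← e1]
        by_cases hic : (absPerm (l ++ [signedSwap i j δ]).prod).SameCycle i c
        · exact ⟨i, (hP i c hic).symm, by rw [h1, orbitSign_eq hic, hc]⟩
        · exact ⟨c, Iff.rfl, by
            rw [(orb_mul_signedSwap hic fun h' => hic (hs.trans h')).2, hc]⟩
      refine ih hl' e3 ?_ ?_ ?_ ?_
      · rw [← e1]; exact hP.split hij hs
      · obtain ⟨a, ha, ha'⟩ := ha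
        obtain ⟨a', h3, h4⟩ := key a ha'
        exact ⟨a', h3.mp ha, h4⟩
      · obtain ⟨b, hb, hb'⟩ := hb
        obtain ⟨b', h3, h4⟩ := key b hb'
        exact ⟨b', fun h' => hb (h3.mpr h'), h4⟩
      · rw [← e1]
        intro x y hx hy hxy
        exact sameCycle_split_of_eq_one hij hs h2 hx hy
          (h x y (orbitSign_of_split_eq_one hij hs h1 h2 hx)
            (orbitSign_of_split_eq_one hij hs h1 h2 hy) hxy)
    · have hPij : ¬ (P i ↔ P j) := fun h' => hs (h i j hi hj h')
      have hij : i ≠ j := fun h' => hs (h' ▸ SameCycle.refl _ _)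
      have hz : IsZeroPair (l ++ [signedSwap i j δ]).prod i j := by
        refine ⟨hs, fun x => ⟨fun hx => ?_, ?_⟩⟩
        · by_cases hix : P i ↔ P x
          · exact Or.inl (h i x hi hx hix)
          · exact Or.inr (h j x hj hx (by tauto))
        · rintro (h' | h')
          · rw [← orbitSign_eq h', hi]
          · rw [← orbitSign_eq h', hj]
      have hzero : ∀ x, orbitSign l.prod x = 0 := fun x => by rw [← e1]; exact hz.join x
      refine iff_of_true ⟨forall_mem_weylD_of_paired hl' e3 hzero, signedSwap_mem_weylD hij δ⟩
        ⟨l, List.prefix_rfl, ?_⟩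
      have hij' : (absPerm l.prod).SameCycle i j := by
        rw [← e1]
        exact (join_cases hs δ j).mpr (Or.inr (SameCycle.refl _ _))
      by_cases hPi : P i
      · exact ⟨i, j, hij', hzero i, hPi, by tauto⟩
      · exact ⟨j, i, hij'.symm, hzero j, by tauto, hPi⟩

end Connectivity

/-! ### Cycles of signed permutations -/

section SignedCycles

open Equiv Equiv.Perm SignedSet Function

variable {n : ℕ} (w : SignedPerm n)

theorem idx_pow_apply (k : ℕ) (x : SignedSet n) :
    idx ((w.1 ^ k) x) = (absPerm w ^ k) (idx x) := by
  induction k with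
  | zero => rfl
  | succ k ih =>
    rw [pow_succ', Perm.mul_apply, w.idx_apply, ih, pow_succ', Perm.mul_apply]; rfl

theorem pow_apply_act_emb (k : ℕ) (e : ZMod 2) (i : Fin n) :
    (w.1 ^ k) (act e (emb i)) = act (e + ∑ m ∈ Finset.range k, signs w ((absPerm w ^ m) i))
      (emb ((absPerm w ^ k) i)) := by
  induction k with
  | zero => simp
  | succ k ih =>
    rw [pow_succ', Perm.mul_apply, ih, w.apply_act_emb, Finset.sum_range_succ, pow_succ',
      Perm.mul_apply, add_assoc]

theorem sum_range_period (i : Fin n) :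
    ∑ m ∈ Finset.range (minimalPeriod (absPerm w) i), signs w ((absPerm w ^ m) i) =
      orbitSign w i := by
  have hc := exists_period (absPerm w) i
  rw [orbitSign, flag, orb_eq_image_of_period hc.1 hc.2, Finset.sum_image]
  · have h1 := Finset.sum_range_succ (fun m => signs w ((absPerm w ^ m) i))
      (minimalPeriod (absPerm w) i)
    rw [Finset.sum_range_succ', hc.2, pow_zero, Perm.one_apply, add_left_inj] at h1
    rw [← h1, Finset.range_eq_Ico, Finset.sum_Ico_add' (fun m => signs w ((absPerm w ^ m) i)) 0 _ 1]
    rfl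
  · rw [Finset.coe_Icc]
    exact pow_injOn_Icc _ _

theorem sameCycle_absPerm {x y : SignedSet n} (h : w.1.SameCycle x y) :
    (absPerm w).SameCycle (idx x) (idx y) := by
  obtain ⟨k, rfl⟩ := h.exists_nat_pow_eq
  rw [idx_pow_apply]
  exact mem_orb.mp (pow_mem_orb _ _ _)

theorem sameCycle_or_of_absPerm {x y : SignedSet n}
    (h : (absPerm w).SameCycle (idx x) (idx y)) :
    w.1.SameCycle x y ∨ w.1.SameCycle x (-y) := by
  obtain ⟨k, hk⟩ := h.exists_nat_pow_eq
  rw [← idx_pow_apply] at hk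
  have h1 : w.1.SameCycle x ((w.1 ^ k) x) := (SameCycle.refl _ _).trans ⟨k, by simp⟩
  by_cases hs : sgn ((w.1 ^ k) x) = sgn y
  · left; rwa [← ext_idx_sgn hk hs]
  · right
    have h2 : sgn ((w.1 ^ k) x) = sgn (-y) := by
      rw [sgn_neg]
      revert hs
      generalize sgn ((w.1 ^ k) x) = e
      generalize sgn y = f
      revert e f; decide
    rwa [← ext_idx_sgn (hk.trans (idx_neg y).symm) h2]

/-- The cycle of `x` is a zero cycle iff the total sign of its orbit is `1`. -/
theorem sameCycle_neg_iff (x : SignedSet n) :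
    w.1.SameCycle x (-x) ↔ orbitSign w (idx x) = 1 := by
  have hc := exists_period (absPerm w) (idx x)
  have hp := pow_apply_act_emb w (minimalPeriod (absPerm w) (idx x)) (sgn x) (idx x)
  rw [sum_range_period, hc.2, act_sgn_emb_idx] at hp
  constructor
  · intro h
    refine (zmod_cases _).resolve_left fun h0 => ?_
    rw [h0, add_zero, act_sgn_emb_idx] at hp
    obtain ⟨k, hk⟩ := h.exists_nat_pow_eq
    have h1 : IsPeriodicPt (absPerm w) k (idx x) := by
      rw [IsPeriodicPt, IsFixedPt, Perm.iterate_eq_pow, ← idx_pow_apply, hk, idx_neg]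
    obtain ⟨m, rfl⟩ := h1.minimalPeriod_dvd
    have h2 : IsPeriodicPt w.1 (minimalPeriod (absPerm w) (idx x)) x := by
      rwa [IsPeriodicPt, IsFixedPt, Perm.iterate_eq_pow]
    have h3 := h2.mul_const m
    rw [IsPeriodicPt, IsFixedPt, Perm.iterate_eq_pow, hk] at h3
    exact ne_neg x h3.symm
  · intro h1
    rw [h1, add_comm, ← act_act, act_sgn_emb_idx, act_one] at hp
    exact ⟨minimalPeriod (absPerm w) (idx x), by simpa using hp⟩

end SignedCycles

section Gamma

open Equiv Equiv.Perm SignedSet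

variable {p q : ℕ}

theorem connectivity_ne_zero_iff (w : SignedPerm (p + q)) :
    connectivity w ≠ 0 ↔ HasMixedPaired (fun i : Fin (p + q) => i.1 < p) w := by
  have habs : ∀ b : SignedSet (p + q), |(b : ℤ)| ≤ p ↔ (idx b).1 < p := by
    intro b
    have := coe_ne_zero b
    simp only [idx]
    rcases abs_cases (b : ℤ) with h | h <;> omega
  have hne : connectivity w ≠ 0 ↔ (connectedCycles w).Nonempty := by
    rw [connectivity, Ne, Set.ncard_eq_zero (Set.toFinite _), Set.nonempty_iff_ne_empty]
  rw [hne]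
  constructor
  · rintro ⟨S, a, ha, rfl, ⟨b, hb, hb'⟩, c, hc, hc'⟩
    have key : ∀ b, (w.1.SameCycle a b ∨ w.1.SameCycle a (-b)) →
        (absPerm w).SameCycle (idx a) (idx b) := by
      rintro b (h | h)
      · exact sameCycle_absPerm w h
      · simpa using sameCycle_absPerm w h
    have hab := key b hb
    have hac := key c hc
    refine ⟨idx b, idx c, hab.symm.trans hac, ?_, (habs b).mp hb', ?_⟩
    · rw [← orbitSign_eq hab]
      rw [sameCycle_neg_iff] at ha
      exact (zmod_cases _).resolve_right ha
    · exact fun h => not_le.mpr hc' ((habs c).mpr h)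
  · rintro ⟨i, j, hij, h0, hi, hj⟩
    refine ⟨_, emb i, ?_, rfl, ⟨emb i, Or.inl (SameCycle.refl _ _), ?_⟩, emb j, ?_, ?_⟩
    · rw [sameCycle_neg_iff, idx_emb, h0]; decide
    · rw [habs, idx_emb]; exact hi
    · exact sameCycle_or_of_absPerm w (by simpa using hij)
    · rw [← not_le, habs, idx_emb]; exact hj

theorem zeroCycle_apply_getElem {n : ℕ} {l : List (SignedSet n)}
    (hl : (l ++ l.map (fun x => -x)).Nodup) {k : ℕ} (hk : k + 1 < l.length) :
    zeroCycle l l[k] = l[k + 1] := by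
  have h := List.formPerm_apply_getElem _ hl k (by rw [List.length_append]; omega)
  rw [zeroCycle]
  simp only [List.length_append, List.length_map] at h
  rw [List.getElem_append_left (by omega)] at h
  rw [h]
  have : (k + 1) % (l.length + l.length) = k + 1 := Nat.mod_eq_of_lt (by omega)
  simp only [this]
  rw [List.getElem_append_left hk]

theorem zeroCycle_apply_last {n : ℕ} {l : List (SignedSet n)}
    (hl : (l ++ l.map (fun x => -x)).Nodup) {k : ℕ} (hk : k + 1 = l.length) :
    zeroCycle l (l[k]'(by omega)) = -(l[0]'(by omega)) := by
  have h := List.formPerm_apply_getElem _ hl k (by rw [List.length_append]; omega)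
  rw [zeroCycle]
  simp only [List.length_append, List.length_map] at h
  rw [List.getElem_append_left (by omega)] at h
  rw [h]
  have : (k + 1) % (l.length + l.length) = l.length := by rw [hk]; exact Nat.mod_eq_of_lt (by omega)
  simp only [this]
  rw [List.getElem_append_right le_rfl]
  simp

theorem zeroCycle_apply_of_idx {n : ℕ} {l : List (SignedSet n)} {x : SignedSet n}
    (hx : ∀ y ∈ l, idx y ≠ idx x) : zeroCycle l x = x := by
  refine List.formPerm_apply_of_notMem fun h => ?_
  rcases List.mem_append.mp h with h | h
  · exact hx x h rfl
  · obtain ⟨y, hy, rfl⟩ := List.mem_map.mp h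
    exact hx y hy (idx_neg y).symm

theorem idx_mem_outerList {x : SignedSet (p + q)} (hx : x ∈ outerList p q) : (idx x).1 < p := by
  obtain ⟨i, rfl⟩ := (List.mem_ofFn' _ _).mp hx
  simp only [idx]
  omega

theorem idx_mem_innerList {x : SignedSet (p + q)} (hx : x ∈ innerList p q) : p ≤ (idx x).1 := by
  obtain ⟨i, rfl⟩ := (List.mem_ofFn' _ _).mp hx
  simp only [idx]
  omega

theorem length_outerList : (outerList p q).length = p := List.length_ofFn

theorem length_innerList : (innerList p q).length = q := List.length_ofFn

theorem getElem_outerList {k : ℕ} (hk : k < (outerList p q).length) :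
    (outerList p q)[k] = emb ⟨k, by rw [length_outerList] at hk; omega⟩ := by
  simp [outerList, emb]

theorem getElem_innerList {k : ℕ} (hk : k < (innerList p q).length) :
    (innerList p q)[k] = emb ⟨p + k, by rw [length_innerList] at hk; omega⟩ := by
  simp [innerList, emb]

theorem gamma_apply_outer {i : Fin (p + q)} (hi : i.1 < p) :
    (gamma p q).1 (emb i) = zeroCycle (outerList p q) (emb i) := by
  change zeroCycle (outerList p q) (zeroCycle (innerList p q) (emb i)) = _
  rw [zeroCycle_apply_of_idx (l := innerList p q)]
  intro y hy h
  have := idx_mem_innerList hy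
  rw [h, idx_emb] at this
  omega

theorem gamma_apply_inner {i : Fin (p + q)} (hi : p ≤ i.1) :
    (gamma p q).1 (emb i) = zeroCycle (innerList p q) (emb i) := by
  change zeroCycle (outerList p q) (zeroCycle (innerList p q) (emb i)) = _
  refine zeroCycle_apply_of_idx fun y hy h => ?_
  have h1 := idx_mem_outerList hy
  have h2 := zeroCycle_mem (innerList_nodup p q)
  have h3 : p ≤ (idx (zeroCycle (innerList p q) (emb i))).1 := by
    obtain ⟨k, hk⟩ := Nat.exists_eq_add_of_le hi
    have hlen := length_innerList (p := p) (q := q)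
    have hkq : k < (innerList p q).length := by have := i.2; omega
    have hik : emb i = (innerList p q)[k] := by
      rw [getElem_innerList]; congr 1; exact Fin.ext hk
    rw [hik]
    rcases Nat.lt_or_ge (k + 1) (innerList p q).length with h | h
    · rw [zeroCycle_apply_getElem (innerList_nodup p q) h]
      exact idx_mem_innerList (List.getElem_mem _)
    · rw [zeroCycle_apply_last (innerList_nodup p q) (by omega), idx_neg]
      exact idx_mem_innerList (List.getElem_mem _)
  rw [← h] at h3
  omega

theorem gamma_outer_succ {k : ℕ} (hk : k + 1 < p) :
    (gamma p q).1 (emb ⟨k, by omega⟩) = emb ⟨k + 1, by omega⟩ := by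
  have hlen := length_outerList (p := p) (q := q)
  rw [gamma_apply_outer (by simp only; omega),
    ← getElem_outerList (k := k) (by omega), zeroCycle_apply_getElem (outerList_nodup p q) (by omega),
    getElem_outerList]

theorem gamma_outer_last {k : ℕ} (hk : k + 1 = p) :
    (gamma p q).1 (emb ⟨k, by omega⟩) = -emb ⟨0, by omega⟩ := by
  have hlen := length_outerList (p := p) (q := q)
  rw [gamma_apply_outer (by simp only; omega),
    ← getElem_outerList (k := k) (by omega), zeroCycle_apply_last (outerList_nodup p q) (by omega),
    getElem_outerList]

theorem gamma_inner_succ {k : ℕ} (hk : k + 1 < q) :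
    (gamma p q).1 (emb ⟨p + k, by omega⟩) = emb ⟨p + (k + 1), by omega⟩ := by
  have hlen := length_innerList (p := p) (q := q)
  rw [gamma_apply_inner (by simp only; omega),
    ← getElem_innerList (k := k) (by omega), zeroCycle_apply_getElem (innerList_nodup p q) (by omega),
    getElem_innerList]

theorem gamma_inner_last {k : ℕ} (hk : k + 1 = q) :
    (gamma p q).1 (emb ⟨p + k, by omega⟩) = -emb ⟨p + 0, by omega⟩ := by
  have hlen := length_innerList (p := p) (q := q)
  rw [gamma_apply_inner (by simp only; omega),
    ← getElem_innerList (k := k) (by omega), zeroCycle_apply_last (innerList_nodup p q) (by omega),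
    getElem_innerList]

theorem absPerm_eq_of_apply {n : ℕ} {w : SignedPerm n} {i j : Fin n} {e : ZMod 2}
    (h : w.1 (emb i) = act e (emb j)) : absPerm w i = j ∧ signs w i = e := by
  constructor
  · change idx (w.1 (emb i)) = j
    rw [h]; simp
  · rw [signs, h]; simp

theorem gamma_data (i : Fin (p + q)) :
    (((absPerm (gamma p q)) i).1 < p ↔ i.1 < p) ∧
      signs (gamma p q) i = if i.1 + 1 = p ∨ i.1 + 1 = p + q then 1 else 0 := by
  obtain ⟨i, hi⟩ := i
  rcases Nat.lt_or_ge i p with h | h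
  · rcases Nat.lt_or_ge (i + 1) p with h' | h'
    · obtain ⟨h1, h2⟩ := absPerm_eq_of_apply
        ((gamma_outer_succ (q := q) h').trans (act_zero _).symm)
      rw [h1, h2, if_neg (by simp only; omega)]
      simp only [and_true]; omega
    · obtain ⟨h1, h2⟩ := absPerm_eq_of_apply
        ((gamma_outer_last (q := q) (le_antisymm h h')).trans (act_one _).symm)
      rw [h1, h2, if_pos (by simp only; omega)]
      simp only [and_true]; omega
  · obtain ⟨k, rfl⟩ := Nat.exists_eq_add_of_le h
    rcases Nat.lt_or_ge (k + 1) q with h' | h'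
    · obtain ⟨h1, h2⟩ := absPerm_eq_of_apply
        ((gamma_inner_succ (p := p) h').trans (act_zero _).symm)
      rw [h1, h2, if_neg (by simp only; omega)]
      simp only [and_true]; omega
    · obtain ⟨h1, h2⟩ := absPerm_eq_of_apply
        ((gamma_inner_last (p := p) (show k + 1 = q by omega)).trans (act_one _).symm)
      rw [h1, h2, if_pos (by simp only; omega)]
      simp only [and_true]; omega

theorem gamma_sameCycle_outer {k : ℕ} (hk : k < p) :
    (absPerm (gamma p q)).SameCycle ⟨0, by omega⟩ ⟨k, by omega⟩ := by
  induction k with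
  | zero => exact SameCycle.refl _ _
  | succ k ih =>
    have h1 := (absPerm_eq_of_apply
        ((gamma_outer_succ (q := q) hk).trans (act_zero _).symm)).1
    rw [← h1, sameCycle_apply_right]
    exact ih (by omega)

theorem gamma_sameCycle_inner {k : ℕ} (hk : k < q) :
    (absPerm (gamma p q)).SameCycle ⟨p + 0, by omega⟩ ⟨p + k, by omega⟩ := by
  induction k with
  | zero => exact SameCycle.refl _ _
  | succ k ih =>
    have h1 := (absPerm_eq_of_apply
        ((gamma_inner_succ (p := p) hk).trans (act_zero _).symm)).1
    rw [← h1, sameCycle_apply_right]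
    exact ih (by omega)

theorem gamma_sameCycle_iff (i j : Fin (p + q)) :
    (absPerm (gamma p q)).SameCycle i j ↔ (i.1 < p ↔ j.1 < p) := by
  constructor
  · intro h
    obtain ⟨k, rfl⟩ := h.exists_nat_pow_eq
    clear h
    induction k with
    | zero => rfl
    | succ k ih => rw [pow_succ', Perm.mul_apply, (gamma_data _).1]; exact ih
  · intro h
    by_cases hi : i.1 < p
    · exact (gamma_sameCycle_outer hi).symm.trans (gamma_sameCycle_outer (h.mp hi))
    · have hj : ¬ j.1 < p := fun h' => hi (h.mpr h')
      obtain ⟨i, hi'⟩ := i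
      obtain ⟨j, hj'⟩ := j
      simp only [not_lt] at hi hj
      obtain ⟨a, rfl⟩ := Nat.exists_eq_add_of_le hi
      obtain ⟨b, rfl⟩ := Nat.exists_eq_add_of_le hj
      exact (gamma_sameCycle_inner (by omega)).symm.trans (gamma_sameCycle_inner (by omega))

theorem gamma_orb (i : Fin (p + q)) :
    orb (absPerm (gamma p q)) i = Finset.univ.filter fun j => i.1 < p ↔ j.1 < p := by
  ext j
  rw [mem_orb, gamma_sameCycle_iff]; simp

variable (hp : 0 < p) (hq : 0 < q)
include hp hq

theorem gamma_orbitSign (i : Fin (p + q)) : orbitSign (gamma p q) i = 1 := by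
  rw [orbitSign, flag, gamma_orb, Finset.sum_congr rfl fun j _ => (gamma_data j).2]
  by_cases hi : i.1 < p
  · rw [Finset.sum_eq_single ⟨p - 1, by omega⟩]
    · rw [if_pos (by simp only; omega)]
    · intro j hj hne
      have hj := (Finset.mem_filter.mp hj).2
      have hne : j.1 ≠ p - 1 := fun h => hne (Fin.ext h)
      rw [if_neg (by omega)]
    · intro h
      exact absurd (Finset.mem_filter.mpr ⟨Finset.mem_univ _, by simp only; omega⟩) h
  · rw [Finset.sum_eq_single ⟨p + q - 1, by omega⟩]
    · rw [if_pos (by simp only; omega)]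
    · intro j hj hne
      have hj := (Finset.mem_filter.mp hj).2
      have hne : j.1 ≠ p + q - 1 := fun h => hne (Fin.ext h)
      rw [if_neg (by omega)]
    · intro h
      exact absurd (Finset.mem_filter.mpr ⟨Finset.mem_univ _, by simp only; omega⟩) h

theorem gamma_orbLen_outer : orbLen (gamma p q) ⟨0, by omega⟩ = p := by
  rw [orbLen, gamma_orb]
  simp only [hp, true_iff]
  rw [Fin.card_filter_val_lt]; omega

theorem gamma_orbLen_inner : orbLen (gamma p q) ⟨p, by omega⟩ = q := by
  have h1 := gamma_orbLen_outer hp hq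
  rw [orbLen, gamma_orb] at h1 ⊢
  simp only [hp, true_iff, lt_irrefl, false_iff] at h1 ⊢
  have := Finset.card_filter_add_card_filter_not (s := (Finset.univ : Finset (Fin (p + q))))
    (fun j => j.1 < p)
  rw [h1, Finset.card_univ, Fintype.card_fin] at this
  omega

theorem gamma_orbs : orbs (absPerm (gamma p q)) = {orb (absPerm (gamma p q)) ⟨0, by omega⟩,
    orb (absPerm (gamma p q)) ⟨p, by omega⟩} := by
  ext O
  rw [Finset.mem_insert, Finset.mem_singleton]
  constructor
  · intro hO
    obtain ⟨x, _, rfl⟩ := Finset.mem_image.mp hO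
    simp only [orb_eq_iff, gamma_sameCycle_iff]
    omega
  · rintro (rfl | rfl) <;> exact orb_mem_orbs _ _

theorem gamma_treeWeight : treeWeight (gamma p q) = treeCoeff p * treeCoeff q := by
  rw [treeWeight, gamma_orbs hp hq, Finset.prod_pair]
  · change treeCoeff (orbLen _ _) * treeCoeff (orbLen _ _) = _
    rw [gamma_orbLen_outer hp hq, gamma_orbLen_inner hp hq]
  · rw [Ne, orb_eq_iff, gamma_sameCycle_iff]
    simp only; omega

theorem gamma_pairedCount : pairedCount (gamma p q) = 0 := by
  rw [pairedCount, numPaired]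
  refine Finset.sum_eq_zero fun O hO => ?_
  obtain ⟨x, _, rfl⟩ := Finset.mem_image.mp hO
  refine if_neg ?_
  change ¬ orbitSign (gamma p q) x = 0
  rw [gamma_orbitSign hp hq]; decide

theorem gamma_absLength : absLength (gamma p q) = p + q := by
  have := absLength_add_pairedCount (gamma p q)
  rwa [gamma_pairedCount hp hq, add_zero] at this

theorem gamma_isZeroPair : IsZeroPair (gamma p q) ⟨0, by omega⟩ ⟨p, by omega⟩ := by
  refine ⟨?_, fun x => ?_⟩
  · rw [gamma_sameCycle_iff]; simp only; omega
  · rw [gamma_orbitSign hp hq, gamma_sameCycle_iff, gamma_sameCycle_iff]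
    simp only [true_iff]; omega

theorem swapCount_gamma : swapCount (p + q) (gamma p q) =
    2 * p * q / (p + q) * ((p + q).choose q : ℚ) * p ^ p * q ^ q := by
  rw [swapCount_of_isZeroPair (gamma_isZeroPair hp hq)
    (by rw [gamma_pairedCount hp hq, add_zero]), gamma_treeWeight hp hq,
    gamma_orbLen_outer hp hq, gamma_orbLen_inner hp hq]
  have h := Nat.add_choose_mul_factorial_mul_factorial p q
  rw [← h]
  have hp' : (p : ℚ) ≠ 0 := by positivity
  have hq' : (q : ℚ) ≠ 0 := by positivity
  have h1 : (p.factorial : ℚ) ≠ 0 := by exact_mod_cast p.factorial_ne_zero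
  have h2 : (q.factorial : ℚ) ≠ 0 := by exact_mod_cast q.factorial_ne_zero
  have h3 : (p : ℚ) + q ≠ 0 := by positivity
  rw [treeCoeff, treeCoeff, annularWeight]
  push_cast
  field_simp

theorem wordLength_reflectionsD_gamma :
    wordLength (reflectionsD (p + q)) (gamma p q) = p + q := by
  have hne : swapCount (p + q) (gamma p q) ≠ 0 := by
    rw [swapCount_gamma hp hq]
    have : 0 < (p + q).choose q := Nat.choose_pos (by omega)
    positivity
  rw [swapCount, Nat.cast_ne_zero, Finset.card_ne_zero] at hne
  obtain ⟨l, hl⟩ := hne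
  obtain ⟨h1, h2, h3⟩ := mem_words.mp hl
  refine le_antisymm (Nat.sInf_le ⟨l, ⟨fun t ht => mem_swapFinset.mp (h1 t ht), h2⟩, h3⟩) ?_
  refine le_csInf ⟨_, l, ⟨fun t ht => mem_swapFinset.mp (h1 t ht), h2⟩, rfl⟩ ?_
  rintro k ⟨m, hm, rfl⟩
  refine (gamma_absLength hp hq).symm.le.trans ?_
  exact Nat.sInf_le ⟨m, ⟨fun t ht => (hm.1 t ht).1, hm.2⟩, rfl⟩

theorem ncard_minimalFactorizations_gamma :
    ((minimalFactorizations (reflectionsD (p + q)) (gamma p q)).ncard : ℚ) =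
      2 * p * q / (p + q) * ((p + q).choose q : ℚ) * p ^ p * q ^ q := by
  rw [← swapCount_gamma hp hq, swapCount, ← Set.ncard_coe_finset]
  congr 2
  ext l
  rw [Finset.mem_coe, mem_words]
  change (_ ∧ _) ∧ l.length = wordLength _ _ ↔ _
  rw [wordLength_reflectionsD_gamma hp hq]
  simp only [mem_swapFinset, and_assoc]

theorem mem_minimalFactorizations_iff (l : List (SignedPerm (p + q))) :
    l ∈ minimalFactorizations (reflectionsD (p + q)) (gamma p q) ↔
      l ∈ minimalFactorizations (transpositions (p + q)) (gamma p q) ∧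
        ∀ t ∈ l, t ∈ weylD (p + q) := by
  change ((_ ∧ _) ∧ l.length = wordLength _ _) ↔ ((_ ∧ _) ∧ l.length = absLength _) ∧ _
  rw [wordLength_reflectionsD_gamma hp hq, gamma_absLength hp hq]
  constructor
  · rintro ⟨⟨h1, h2⟩, h3⟩
    exact ⟨⟨⟨fun t ht => (h1 t ht).1, h2⟩, h3⟩, fun t ht => (h1 t ht).2⟩
  · rintro ⟨⟨⟨h1, h2⟩, h3⟩, h4⟩
    exact ⟨⟨fun t ht => ⟨h1 t ht, h4 t ht⟩, h2⟩, h3⟩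

theorem isConnectedChain_prefixFlag_iff {l : List (SignedPerm (p + q))}
    (hl : l ∈ minimalFactorizations (transpositions (p + q)) (gamma p q)) :
    IsConnectedChain (prefixFlag hl) ↔ ∀ t ∈ l, t ∈ weylD (p + q) := by
  have hprod := hl.1.2
  have hlen : l.length = p + q := hl.2.trans (gamma_absLength hp hq)
  rw [forall_mem_weylD_iff (P := fun i : Fin (p + q) => i.1 < p) hl.1.1]
  · rw [IsConnectedChain]
    push Not
    constructor
    · rintro ⟨x, hx, h⟩
      obtain ⟨i, _, hxi⟩ := (mem_prefixFlag hl).mp hx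
      rw [connectivity_ne_zero_iff, hxi] at h
      exact ⟨l.take i, List.take_prefix _ _, h⟩
    · rintro ⟨m, hm, h⟩
      have hle := hm.length_le
      rw [List.prefix_iff_eq_take.mp hm] at h
      exact ⟨⟨_, prod_take_mem_Icc hl hle⟩, (mem_prefixFlag hl).mpr ⟨_, hle, rfl⟩,
        (connectivity_ne_zero_iff _).mpr h⟩
  · rw [hprod, hlen, gamma_pairedCount hp hq, add_zero]
  · rw [hprod]
    exact fun i j h => (gamma_sameCycle_iff i j).mp h
  · rw [hprod]
    exact ⟨⟨0, by omega⟩, hp, gamma_orbitSign hp hq _⟩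
  · rw [hprod]
    exact ⟨⟨p, by omega⟩, lt_irrefl p, gamma_orbitSign hp hq _⟩
  · rw [hprod]
    exact fun x y _ _ h => (gamma_sameCycle_iff x y).mpr h

theorem ncard_isConnectedChain :
    {C : Flag (AnnularNC p q) | IsConnectedChain C}.ncard =
      (minimalFactorizations (reflectionsD (p + q)) (gamma p q)).ncard := by
  symm
  refine Set.ncard_congr
    (fun l hl => prefixFlag ((mem_minimalFactorizations_iff hp hq l).mp hl).1) ?_ ?_ ?_
  · intro l hl
    exact (isConnectedChain_prefixFlag_iff hp hq _).mpr
      ((mem_minimalFactorizations_iff hp hq l).mp hl).2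
  · intro l l' hl hl' h
    exact prefixFlag_injective _ _ h
  · intro C hC
    obtain ⟨l, hl, rfl⟩ := exists_prefixFlag_eq C
    exact ⟨l, (mem_minimalFactorizations_iff hp hq l).mpr
      ⟨hl, (isConnectedChain_prefixFlag_iff hp hq hl).mp hC⟩, rfl⟩

end Gamma

end AnnularB

theorem mainTheorem3 (p q : ℕ) (hp : 0 < p) (hq : 0 < q) :
    ({C : Flag (AnnularB.AnnularNC p q) | AnnularB.IsConnectedChain C}.ncard : ℚ) =
        2 * p * q / (p + q) * ((p + q).choose q : ℚ) * p ^ p * q ^ q ∧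
      ((AnnularB.minimalFactorizations (AnnularB.reflectionsD (p + q))
          (AnnularB.gamma p q)).ncard : ℚ) =
        2 * p * q / (p + q) * ((p + q).choose q : ℚ) * p ^ p * q ^ q :=
  ⟨by rw [AnnularB.ncard_isConnectedChain hp hq, AnnularB.ncard_minimalFactorizations_gamma hp hq],
    AnnularB.ncard_minimalFactorizations_gamma hp hq⟩
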